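/- **Notation.** Let $\tfrac12+i\gamma$ run over the zeros of the Riemann zeta function on the critical line, indexed so that each zero is repeated according to its multiplicity. For $a>0$ and $t\in\mathbb R$ put $$\Sigma_a(t)=\sum_{\gamma}\frac1{a^2+(t-\gamma)^2}.$$ For $n\ge 2$ and $f:\mathbb R^n\to\mathbb R$ put, with $L=\log T$, $$S_n(T,f)={\sum_{0<\gamma_1,\dots,\gamma_n<T}}' f\Big(\frac{L}{2\pi}\gamma_1,\dots,\frac{L}{2\pi}\gamma_n\Big),$$ where $\sum'$ means that the indices of the $n$ zeros are distinct. Let $W_n(x)=\det\big(K(x_i-x_j)\big)_{i,j\le n}$ with $K(t)=\frac{\sin \pi t}{\pi t}$, $K(0)=1$, let $\overline x=(x_1+\dots+x_n)/n$, and let $\delta$ be the Dirac delta function. For $N\ge 2$, GUE$N$ is the following hypothesis: for every $2\le n\le N$ and every smooth $f:\mathbb R^n\to\mathbb R$ that is symmetric, satisfies $f(x+(t,\dots,t))=f(x)$ for all $t\in\mathbb R$, and decays faster than every power of $|x|$ on the hyperplane $\sum_j x_j=0$, $$\lim_{T\to\infty}\frac{S_n(T,f)}{T\log T}=\frac1{2\pi}\int_{\mathbb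 R^n}f(x)\,W_n(x)\,\delta(\overline x)\,dx .$$ **Proposition 3.** Assume the Riemann Hypothesis and GUE3, and let $0<c\le C$. For every $a>0$ the series $\Sigma_a(t)$ converges for all $t\in\mathbb R$ and all powers of $\Sigma_a$ are integrable over bounded intervals. Moreover, uniformly for $$\frac{c}{\log T}\le a\le\frac{C}{\log T},$$ with implied constants and rates of convergence that depend on $c$ and $C$ only: 1. $\displaystyle \Sigma_a(t)\ll \frac{\log(|t|+2)}{a^2}$ for all $t\in\mathbb R$ and $T\ge 2$; 2. $\displaystyle \int_0^T\Sigma_a(t)\,dt=\frac1{2a}\Big(T\log\frac{T}{2\pi}-T\Big)+O\big(\log^2T\,\log\log T\big)$ for all sufficiently large $T$; 3. $\displaystyle \int_0^T\Sigma_a(t)^2\,dt\sim\frac{1}{4a^2}\,T\log^2T\Big(1+\frac{1-T^{-2a}}{2a^2\log^2T}\Big)$ as $T\to\infty$; 4. $\displaystyle \int_0^T\Sigma_a(t)^3\,dt\sim\frac{1}{8a^3}\,T\log^3T\Big(1+\frac{3}{2a^2\log^2T}\Big)$ as $T\to\infty$. -/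

import Mathlib

open Filter Topology

noncomputable section

/-- Index set of the zeros `1/2 + iγ` of the Riemann zeta function on the critical line, each
repeated according to its multiplicity: the pairs `(γ, k)` with `k` smaller than the order of
vanishing of `ζ` at `1/2 + iγ` (which is `0` if `ζ(1/2 + iγ) ≠ 0`). -/
def ZetaZeroIndex : Type :=
  {p : ℝ × ℕ // p.2 < analyticOrderNatAt riemannZeta ((1 / 2 : ℂ) + (p.1 : ℂ) * Complex.I)}

/-- The ordinate `γ` of an indexed zero. -/
def ZetaZeroIndex.ordinate (j : ZetaZeroIndex) : ℝ := j.1.1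

/-- `Σ_a(t) = ∑_γ 1 / (a² + (t - γ)²)`, over all zeros with multiplicity. -/
def sigmaSum (a t : ℝ) : ℝ :=
  ∑' j : ZetaZeroIndex, 1 / (a ^ 2 + (t - j.ordinate) ^ 2)

/-- The test functions of the correlation sums: smooth functions on `ℝⁿ` that are symmetric,
invariant under diagonal translations, and rapidly decreasing on the hyperplane `∑ xᵢ = 0`. -/
structure IsCorrelationTest {n : ℕ} (f : (Fin n → ℝ) → ℝ) : Prop where
  smooth : ContDiff ℝ ((⊤ : ℕ∞) : WithTop ℕ∞) f
  symm : ∀ (σ : Equiv.Perm (Fin n)) (x : Fin n → ℝ), f (fun i => x (σ i)) = f x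
  translate : ∀ (x : Fin n → ℝ) (t : ℝ), f (fun i => x i + t) = f x
  decay : ∀ k : ℕ, ∃ C : ℝ, ∀ x : Fin n → ℝ, ∑ i, x i = 0 → ‖x‖ ^ k * |f x| ≤ C

/-- `S_n(T, f)`: the sum of `f(Lγ₁/2π, …, Lγₙ/2π)`, `L = log T`, over all `n`-tuples of zeros
with distinct indices and ordinates in `(0, T)`. -/
def correlationSum {n : ℕ} (T : ℝ) (f : (Fin n → ℝ) → ℝ) : ℝ :=
  ∑' p : {p : Fin n → ZetaZeroIndex //
      Function.Injective p ∧ ∀ i, 0 < (p i).ordinate ∧ (p i).ordinate < T},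
    f (fun i => Real.log T / (2 * Real.pi) * (p.1 i).ordinate)

/-- `W_n(x) = det (K(xᵢ - xⱼ))` with `K(t) = sin(πt)/(πt)`, `K(0) = 1`. -/
def gueDensity {n : ℕ} (x : Fin n → ℝ) : ℝ :=
  (Matrix.of fun i j : Fin n => Real.sinc (Real.pi * (x i - x j))).det

/-- `∫_{ℝⁿ} g(x) δ(x̄) dx` for `n = m + 1` and `x̄ = (x₁ + ⋯ + xₙ)/n`. Integrating the Dirac
function over the last variable puts it equal to minus the sum of the others and gives the
factor `n`, the inverse of the derivative of `x̄` in that variable. -/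
def deltaMeanIntegral {m : ℕ} (g : (Fin (m + 1) → ℝ) → ℝ) : ℝ :=
  ((m : ℝ) + 1) * ∫ y : Fin m → ℝ, g (Fin.snoc (α := fun _ => ℝ) y (-∑ i, y i))

/-- The `(m+1)`-correlations of the zeros of `ζ` agree with those of the Gaussian Unitary
Ensemble: `S_n(T, f) ∼ (1/2π) T L ∫ f W_n δ(x̄) dx` for all test functions `f`. The relation is
read as convergence of the quotient by `T L`, so that it makes sense for a vanishing integral. -/
def GUECorrelation (m : ℕ) : Prop :=
  ∀ f : (Fin (m + 1) → ℝ) → ℝ, IsCorrelationTest f →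
    Tendsto (fun T : ℝ => correlationSum T f / (T * Real.log T)) atTop
      (𝓝 (1 / (2 * Real.pi) * deltaMeanIntegral fun x => f x * gueDensity x))

/-- `GUE N`: the `n`-correlations of the zeros of `ζ` agree with GUE for `2 ≤ n ≤ N`. -/
def GUEHypothesis (N : ℕ) : Prop :=
  ∀ m : ℕ, 2 ≤ m + 1 → m + 1 ≤ N → GUECorrelation m

end

/-! ### Partial fractions for logarithmic derivatives of entire functions of order less than two -/

section PartialFractions

open Complex Metric

/-! Write L = log T, a = α/L, and ξ(s) = s(1-s)Λ(s) (`xiFun`).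

The arithmetic input is the identity aΣ_a(t) = Re ξ'/ξ(1/2+a+it) (`sigmaSum_eq`). It comes from
partial fractions of ξ'/ξ, which hold up to an additive constant because ξ has order below two.
Subtracting the expansion at the mirror image of the point in the critical line removes the
constant, and under RH each zero then contributes 2a/(a²+(t-γ)²). On the line Re s = 2 (a = 3/2)
Stirling's formula gives Σ_{3/2}(t) ≪ log(|t|+2), and termwise comparison of Σ_a with Σ_{3/2} gives
the pointwise bound. For the first moment the contour is moved from Re s = 1/2+a to Re s = 2. There
the digamma function supplies the main term and ζ'/ζ integrates to a bounded argument. The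
horizontal side costs O(log T) uniformly in a, since each of the O(log T) nearby zeros contributes
at most π plus a bounded amount (`exists_abs_integral_sigmaSum_sub_le`). Comparing the first moment
with the total mass of the sum over 0 < γ < T also yields the count of zeros
(`tendsto_card_zerosBelow`).

For the second and third moments, Σ_a on [0,T] may be replaced in k-th mean by the sum over 0 < γ <
T on the whole line (`tendsto_integral_sigmaSum_pow_of_zeroSum`). After rescaling, that is L²/(2α)
times a linear statistic of the ordinates formed with the Poisson kernel. Powers of a linear
statistic expand into sums over tuples of distinct zeros. Integrating over the shift turns these
into correlation sums with a translation-invariant test function, to which the GUE hypothesis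
applies (`tendsto_integral_sum_injective`). That argument needs compact support, whereas the Poisson
kernel decays only quadratically. The tail is dominated by a series of unit translates of one bump
with weights 1/m². Since the Lᵏ norm is translation invariant, the tail is small uniformly in T
(`lpNorm_linStat_sub_truncate_le`).

The limits are moments of the sine process. Expanding the determinant over permutations and writing
each sine kernel as a Fourier integral over [0,1] turns them into integrals of exp(-α|ξ|) over cubes
(`integral_mul_prod_sinc`), which are elementary. Finally Σ_a decreases in a, so convergence for
each fixed α, to a continuous limit, is automatically uniform for c ≤ α ≤ C
(`tendstoUniformlyOn_of_antitoneOn`). -/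

theorem Differentiable.analyticOrderAt_ne_top {f : ℂ → ℂ} (hf : Differentiable ℂ f) {z₀ : ℂ}
    (h0 : f z₀ ≠ 0) (z : ℂ) : analyticOrderAt f z ≠ ⊤ := by
  have h := (AnalyticOnNhd.exists_analyticOrderAt_ne_top_iff_forall (U := Set.univ)
    (fun z _ => hf.analyticAt z) isConnected_univ).1
    ⟨⟨z₀, trivial⟩, by
      rw [(hf.analyticAt z₀).analyticOrderAt_eq_zero.2 h0]; simp⟩
  exact h ⟨z, trivial⟩

theorem analyticOrderNatAt_sub_const (c z : ℂ) :
    analyticOrderNatAt (fun w : ℂ => w - c) z = if c = z then 1 else 0 := by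
  have han : AnalyticAt ℂ (fun w : ℂ => w - c) z := by fun_prop
  split_ifs with h
  · subst h
    have : analyticOrderAt (fun w : ℂ => w - c) c = (1 : ℕ) := by
      rw [han.analyticOrderAt_eq_natCast]
      exact ⟨fun _ => 1, by fun_prop, by simp, by simp⟩
    simp [analyticOrderNatAt, this]
  · have : analyticOrderAt (fun w : ℂ => w - c) z = 0 := by
      rw [han.analyticOrderAt_eq_zero]
      exact sub_ne_zero.2 (Ne.symm h)
    simp [analyticOrderNatAt, this]

/-- An entire function can be divided by the linear factors of finitely many of its zeros. -/
theorem Differentiable.exists_eq_prod_sub_mul {f : ℂ → ℂ} (hf : Differentiable ℂ f) {z₀ : ℂ}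
    (h0 : f z₀ ≠ 0) {ι : Type*} (ρ : ι → ℂ) (s : Finset ι)
    (hs : ∀ z, (s.filter (fun i => ρ i = z)).card ≤ analyticOrderNatAt f z) :
    ∃ g : ℂ → ℂ, Differentiable ℂ g ∧ (∀ z, f z = (∏ i ∈ s, (z - ρ i)) * g z) ∧
      ∀ z, analyticOrderNatAt f z =
        (s.filter (fun i => ρ i = z)).card + analyticOrderNatAt g z := by
  classical
  induction s using Finset.induction_on with
  | empty => exact ⟨f, hf, by simp, by simp⟩
  | insert i s hi ih =>
    obtain ⟨g, hg, hfg, hord⟩ := ih (fun z => le_trans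
      (Finset.card_le_card (Finset.filter_subset_filter _ (Finset.subset_insert i s))) (hs z))
    have hg0 : g z₀ ≠ 0 := fun h => h0 (by rw [hfg, h, mul_zero])
    -- Otherwise the indices in `insert i s` over `ρ i` would outnumber the order of `f` there.
    have hgi : g (ρ i) = 0 := by
      by_contra hne
      have h1 := hs (ρ i)
      rw [hord, Finset.filter_insert, if_pos rfl,
        Finset.card_insert_of_notMem (by simp [hi])] at h1
      have h2 : analyticOrderNatAt g (ρ i) = 0 := by
        simp [analyticOrderNatAt, (hg.analyticAt (ρ i)).analyticOrderAt_eq_zero.2 hne]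
      omega
    have hd : Differentiable ℂ (dslope g (ρ i)) := by
      rw [← differentiableOn_univ, Complex.differentiableOn_dslope univ_mem]
      exact hg.differentiableOn
    have hgd : ∀ z, g z = (z - ρ i) * dslope g (ρ i) z := by
      intro z
      have := sub_smul_dslope g (ρ i) z
      rw [hgi, sub_zero, smul_eq_mul] at this
      exact this.symm
    refine ⟨dslope g (ρ i), hd, fun z => ?_, fun z => ?_⟩
    · rw [Finset.prod_insert hi, hfg z, hgd z]; ring
    · have hd0 : dslope g (ρ i) z₀ ≠ 0 := fun h => hg0 (by rw [hgd, h, mul_zero])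
      have hne : z₀ - ρ i ≠ 0 := fun h => hg0 (by rw [hgd, h, zero_mul])
      have hfun : g = (fun w => w - ρ i) * dslope g (ρ i) := by
        ext w; exact hgd w
      have hlin : Differentiable ℂ (fun w : ℂ => w - ρ i) := by fun_prop
      have hmul : analyticOrderNatAt g z =
          analyticOrderNatAt (fun w : ℂ => w - ρ i) z + analyticOrderNatAt (dslope g (ρ i)) z := by
        conv_lhs => rw [hfun]
        exact analyticOrderNatAt_mul (hlin.analyticAt z) (hd.analyticAt z)
          (hlin.analyticOrderAt_ne_top hne z) (hd.analyticOrderAt_ne_top hd0 z)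
      rw [hord, hmul, analyticOrderNatAt_sub_const, Finset.filter_insert]
      split_ifs with h
      · rw [Finset.card_insert_of_notMem (by simp [hi])]; ring
      · ring

/-- The logarithmic derivative of a zero-free function on a disc whose logarithm has real part
at most `M` above its value at the centre is nearly constant near the centre. -/
theorem norm_logDeriv_sub_le_of_norm_le {g : ℂ → ℂ} {z₀ : ℂ} {R M : ℝ} (hR : 0 < R) (hM : 0 < M)
    (hg : DifferentiableOn ℂ g (ball z₀ R)) (hg0 : ∀ z ∈ ball z₀ R, g z ≠ 0)
    (hb : ∀ z ∈ ball z₀ R, ‖g z‖ ≤ Real.exp M * ‖g z₀‖) {z : ℂ} (hz : z ∈ ball z₀ (R / 4)) :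
    ‖logDeriv g z - logDeriv g z₀‖ ≤ 64 * M / R ^ 2 * ‖z - z₀‖ := by
  have hzc : z₀ ∈ ball z₀ R := mem_ball_self hR
  have hld : DifferentiableOn ℂ (logDeriv g) (ball z₀ R) :=
    (hg.deriv isOpen_ball).div hg hg0
  -- `l` is the branch of log(g/g(z₀)) that vanishes at the centre; the hypothesis on `g` bounds its
  -- real part by `M`.
  obtain ⟨l, hl0, hl⟩ := hld.isExactOn_ball.with_val_at z₀ 0
  have hldiff : DifferentiableOn ℂ l (ball z₀ R) :=
    fun w hw => (hl w hw).differentiableAt.differentiableWithinAt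
  -- `exp l * g z₀ = g`
  have hexp : ∀ w ∈ ball z₀ R, g w * exp (-l w) = g z₀ := by
    have hder : ∀ w ∈ ball z₀ R, HasDerivAt (fun w => g w * exp (-l w)) 0 w := by
      intro w hw
      have h1 := (hg.differentiableAt (isOpen_ball.mem_nhds hw)).hasDerivAt
      have h2 := (hl w hw).neg.cexp
      convert! h1.mul h2 using 1
      have := hg0 w hw
      rw [logDeriv_apply]
      field_simp
      ring
    intro w hw
    have := (convex_ball z₀ R).is_const_of_fderivWithin_eq_zero (𝕜 := ℂ)
      (f := fun w => g w * exp (-l w))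
      (fun w hw => (hder w hw).differentiableAt.differentiableWithinAt)
      (fun w hw => by
        rw [fderivWithin_of_isOpen isOpen_ball hw]
        ext
        simp [(hder w hw).deriv]) hw hzc
    simpa [hl0] using this
  have hre : ∀ w ∈ ball z₀ R, (l w).re ≤ M := by
    intro w hw
    have h1 := hexp w hw
    have h2 : ‖g w‖ = Real.exp (l w).re * ‖g z₀‖ := by
      rw [← h1, norm_mul, norm_exp, neg_re, mul_comm, mul_assoc, ← Real.exp_add]
      simp
    have h3 := hb w hw
    rw [h2] at h3
    exact Real.exp_le_exp.1 (le_of_mul_le_mul_right h3 (norm_pos_iff.2 (hg0 z₀ hzc)))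
  -- Borel–Carathéodory: the bound 2M|w|/(R-|w|) is at most 2M for |w| ≤ R/2.
  have hl2 : ∀ w ∈ closedBall z₀ (R / 2), ‖l w‖ ≤ 2 * M := by
    intro w hw
    rw [mem_closedBall, dist_eq_norm] at hw
    have hmaps : Set.MapsTo (fun v : ℂ => v + z₀) (ball 0 R) (ball z₀ R) := by
      intro v hv
      simpa [mem_ball, dist_eq_norm] using hv
    have h1 := borelCaratheodory_zero (f := fun v => l (v + z₀)) (z := w - z₀) (R := R) hM
      (hldiff.comp (by fun_prop) hmaps) (fun v hv => hre _ (hmaps hv)) hR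
      (by rw [mem_ball_zero_iff]; linarith) (by simpa using hl0)
    simp only [sub_add_cancel] at h1
    refine h1.trans ?_
    rw [div_le_iff₀ (by linarith)]
    nlinarith
  -- Cauchy's estimate on discs of radius R/4, which stay inside the disc of radius R/2.
  have hder2 : ∀ w ∈ ball z₀ (R / 4), ‖logDeriv g w‖ ≤ 8 * M / R := by
    intro w hw
    have hsub : closedBall w (R / 4) ⊆ closedBall z₀ (R / 2) := by
      apply closedBall_subset_closedBall'
      have := (mem_ball.1 hw).le
      linarith
    have hsub2 : closedBall z₀ (R / 2) ⊆ ball z₀ R := closedBall_subset_ball (by linarith)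
    have hwR : w ∈ ball z₀ R := ball_subset_ball (by linarith) hw
    have := norm_deriv_le_of_forall_mem_sphere_norm_le (f := l) (c := w) (R := R / 4)
      (C := 2 * M) (by positivity)
      ((hldiff.mono (hsub.trans hsub2)).diffContOnCl_ball subset_rfl)
      (fun v hv => hl2 v (hsub (sphere_subset_closedBall hv)))
    rw [(hl w hwR).deriv] at this
    refine this.trans (le_of_eq ?_)
    field_simp
    norm_num
  -- Schwarz's lemma: the disc of radius R/4 is mapped into one of radius 16M/R, which gives the
  -- Lipschitz constant 64M/R².
  have h1 := dist_le_div_mul_dist_of_mapsTo_ball (f := logDeriv g) (c := z₀) (R₁ := R / 4)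
    (R₂ := 16 * M / R) (hld.mono (ball_subset_ball (by linarith))) (fun w hw => by
      rw [mem_closedBall, dist_eq_norm]
      refine (norm_sub_le _ _).trans ?_
      have h1 := hder2 w hw
      have h2 := hder2 z₀ (mem_ball_self (by positivity))
      calc _ ≤ 8 * M / R + 8 * M / R := add_le_add h1 h2
        _ = 16 * M / R := by ring) hz
  rw [dist_eq_norm, dist_eq_norm] at h1
  refine h1.trans (le_of_eq ?_)
  field_simp
  ring

/-- Partial fractions of the logarithmic derivative of an entire function of order less than two,
up to an additive constant. -/
theorem tendsto_sum_logDeriv_of_growth {f : ℂ → ℂ} (hf : Differentiable ℂ f) {z₀ : ℂ}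
    (h0 : f z₀ ≠ 0) {C : ℝ}
    (hgrowth : ∀ z, ‖f z‖ ≤ Real.exp (C * (1 + ‖z - z₀‖) ^ (3 / 2 : ℝ)))
    {ι : Type*} (ρ : ι → ℂ) (s : ℝ → Finset ι)
    (hs : ∀ R i, i ∈ s R ↔ ‖ρ i - z₀‖ < R)
    (hcard : ∀ R, ∀ z, ‖z - z₀‖ < R →
      ((s R).filter (fun i => ρ i = z)).card = analyticOrderNatAt f z)
    {z : ℂ} (hz : f z ≠ 0) :
    Tendsto (fun R => ∑ i ∈ s R, (1 / (z - ρ i) - 1 / (z₀ - ρ i))) atTop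
      (𝓝 (logDeriv f z - logDeriv f z₀)) := by
  -- `M R` bounds log|f/f(z₀)| on the circle of radius 2R. The growth exponent 3/2 is below 2, so `M
  -- R / R ^ 2` tends to zero.
  set M : ℝ → ℝ := fun R => |C| * (1 + 2 * R) ^ (3 / 2 : ℝ) + |Real.log ‖f z₀‖| + 1 with hMdef
  have hMlim : Tendsto (fun R => 64 * M R / R ^ 2 * ‖z - z₀‖) atTop (𝓝 0) := by
    have h1 : Tendsto (fun R : ℝ => (1 + 2 * R) ^ (3 / 2 : ℝ) / R ^ 2) atTop (𝓝 0) := by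
      have hb : ∀ᶠ R : ℝ in atTop, (1 + 2 * R) ^ (3 / 2 : ℝ) / R ^ 2
          ≤ 3 ^ (3 / 2 : ℝ) * R ^ (-(1 / 2) : ℝ) := by
        filter_upwards [eventually_ge_atTop 1] with R hR
        have hR0 : 0 < R := by linarith
        rw [div_le_iff₀ (by positivity)]
        calc (1 + 2 * R) ^ (3 / 2 : ℝ) ≤ (3 * R) ^ (3 / 2 : ℝ) := by
              apply Real.rpow_le_rpow <;> linarith
          _ = 3 ^ (3 / 2 : ℝ) * R ^ (3 / 2 : ℝ) := by
              rw [Real.mul_rpow (by norm_num) hR0.le]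
          _ = 3 ^ (3 / 2 : ℝ) * R ^ (-(1 / 2) : ℝ) * R ^ 2 := by
              rw [mul_assoc, ← Real.rpow_natCast R 2, ← Real.rpow_add hR0]
              norm_num
      refine squeeze_zero' ?_ hb ?_
      · filter_upwards [eventually_ge_atTop 1] with R hR
        positivity
      · simpa using (tendsto_rpow_neg_atTop (y := 1 / 2) (by norm_num)).const_mul
          ((3 : ℝ) ^ (3 / 2 : ℝ))
    have h2 : Tendsto (fun R : ℝ => (|Real.log ‖f z₀‖| + 1) / R ^ 2) atTop (𝓝 0) :=
      tendsto_const_nhds.div_atTop (tendsto_pow_atTop (by norm_num))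
    have h3 := (((h1.const_mul |C|).add h2).const_mul (64 * ‖z - z₀‖))
    simp only [mul_zero, add_zero] at h3
    refine h3.congr (fun R => ?_)
    simp only [hMdef]
    ring
  rw [tendsto_iff_norm_sub_tendsto_zero]
  refine squeeze_zero' (Eventually.of_forall fun _ => norm_nonneg _) ?_ hMlim
  filter_upwards [eventually_gt_atTop (4 * ‖z - z₀‖), eventually_gt_atTop 0] with R hR hR0
  have hMpos : 0 < M R := by simp only [hMdef]; positivity
  obtain ⟨g, hg, hfg, hord⟩ := hf.exists_eq_prod_sub_mul h0 ρ (s R) (by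
    intro w
    by_cases hw : ‖w - z₀‖ < R
    · exact (hcard R w hw).le
    · have : (s R).filter (fun i => ρ i = w) = ∅ := by
        ext i
        simp only [Finset.mem_filter, hs, Finset.notMem_empty, iff_false]
        rintro ⟨h1, rfl⟩
        exact hw h1
      simp [this])
  have hgz₀ : g z₀ ≠ 0 := fun h => h0 (by rw [hfg, h, mul_zero])
  have hgne : ∀ w ∈ ball z₀ R, g w ≠ 0 := by
    intro w hw hgw
    rw [mem_ball, dist_eq_norm] at hw
    have h1 := hord w
    rw [hcard R w hw] at h1
    have h2 : analyticOrderNatAt g w = 0 := by omega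
    have h3 : analyticOrderAt g w = 0 := by
      rw [← Nat.cast_analyticOrderNatAt (hg.analyticOrderAt_ne_top hgz₀ w), h2]; rfl
    exact (hg.analyticAt w).analyticOrderAt_eq_zero.1 h3 hgw
  have hbound : ∀ w ∈ ball z₀ R, ‖g w‖ ≤ Real.exp (M R) * ‖g z₀‖ := by
    intro w hw
    -- Maximum principle on the doubled disc: on its boundary every removed factor |v-ρ| exceeds R,
    -- hence is at least |z₀-ρ|. Division by the factors therefore does not spoil the bound relative
    -- to the centre.
    refine norm_le_of_forall_mem_frontier_norm_le (U := ball z₀ (2 * R)) isBounded_ball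
      hg.diffContOnCl (fun v hv => ?_) (subset_closure (ball_subset_ball (by linarith) hw))
    rw [frontier_ball z₀ (by positivity), mem_sphere, dist_eq_norm] at hv
    have hprod : ∏ i ∈ s R, ‖z₀ - ρ i‖ ≤ ∏ i ∈ s R, ‖v - ρ i‖ := by
      refine Finset.prod_le_prod (fun _ _ => norm_nonneg _) (fun i hi => ?_)
      rw [hs] at hi
      have h1 := norm_sub_norm_le (v - z₀) (ρ i - z₀)
      rw [sub_sub_sub_cancel_right] at h1
      rw [norm_sub_rev z₀]
      linarith
    have hpos : 0 < ∏ i ∈ s R, ‖z₀ - ρ i‖ := by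
      refine Finset.prod_pos (fun i hi => norm_pos_iff.2 fun h => h0 ?_)
      rw [hfg, Finset.prod_eq_zero hi h, zero_mul]
    have h1 : ‖f v‖ = (∏ i ∈ s R, ‖v - ρ i‖) * ‖g v‖ := by rw [hfg, norm_mul, norm_prod]
    have h2 : ‖f z₀‖ = (∏ i ∈ s R, ‖z₀ - ρ i‖) * ‖g z₀‖ := by rw [hfg, norm_mul, norm_prod]
    have h3 : ‖f v‖ ≤ Real.exp (M R) * ‖f z₀‖ := by
      have hf0 : 0 < ‖f z₀‖ := norm_pos_iff.2 h0
      conv_rhs => rw [← Real.exp_log hf0, ← Real.exp_add]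
      refine (hgrowth v).trans (Real.exp_le_exp.2 ?_)
      rw [hv]
      have : C * (1 + 2 * R) ^ (3 / 2 : ℝ) ≤ |C| * (1 + 2 * R) ^ (3 / 2 : ℝ) := by
        gcongr; exact le_abs_self C
      simp only [hMdef]
      linarith [neg_abs_le (Real.log ‖f z₀‖)]
    have h4 : (∏ i ∈ s R, ‖z₀ - ρ i‖) * ‖g v‖
        ≤ (∏ i ∈ s R, ‖z₀ - ρ i‖) * (Real.exp (M R) * ‖g z₀‖) := by
      calc _ ≤ (∏ i ∈ s R, ‖v - ρ i‖) * ‖g v‖ := by gcongr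
        _ = ‖f v‖ := h1.symm
        _ ≤ _ := h3
        _ = _ := by rw [h2]; ring
    exact le_of_mul_le_mul_left h4 hpos
  have hlog : ∀ w, f w ≠ 0 → logDeriv f w = (∑ i ∈ s R, 1 / (w - ρ i)) + logDeriv g w := by
    intro w hw
    have hp : ∏ i ∈ s R, (w - ρ i) ≠ 0 := fun h => hw (by rw [hfg, h, zero_mul])
    have hgw : g w ≠ 0 := fun h => hw (by rw [hfg, h, mul_zero])
    have hfun : f = fun w => (∏ i ∈ s R, (w - ρ i)) * g w := funext hfg
    conv_lhs => rw [hfun]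
    rw [logDeriv_mul w hp hgw (by fun_prop) (hg w), logDeriv_prod
      (fun i hi => (Finset.prod_ne_zero_iff.1 hp) i hi) (fun i _ => by fun_prop)]
    congr 1
    refine Finset.sum_congr rfl fun i _ => ?_
    simp [logDeriv_apply]
  have hmain := norm_logDeriv_sub_le_of_norm_le hR0 hMpos hg.differentiableOn hgne hbound
    (z := z) (by rw [mem_ball, dist_eq_norm]; linarith)
  rw [hlog z hz, hlog z₀ h0, Finset.sum_sub_distrib, norm_sub_rev]
  refine le_of_eq_of_le (congrArg _ ?_) hmain
  ring

end PartialFractions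

/-! ### The entire function s(1-s)Λ(s): symmetries, zeros and growth -/

section Xi

open Complex

/-- The entire function `s (1 - s) Λ(s)`. -/
noncomputable def xiFun (s : ℂ) : ℂ := s * (1 - s) * completedRiemannZeta₀ s - 1

theorem differentiable_xiFun : Differentiable ℂ xiFun := by
  have := differentiable_completedZeta₀
  unfold xiFun
  fun_prop

theorem xiFun_one_sub (s : ℂ) : xiFun (1 - s) = xiFun s := by
  simp only [xiFun, completedRiemannZeta₀_one_sub]
  ring

theorem xiFun_eq_of_re_pos {s : ℂ} (hs : 0 < s.re) (h1 : s ≠ 1) :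
    xiFun s = s * (1 - s) * Gammaℝ s * riemannZeta s := by
  have h0 : s ≠ 0 := fun h => by simp [h] at hs
  have hG := Gammaℝ_ne_zero_of_re_pos hs
  have h1' : 1 - s ≠ 0 := sub_ne_zero.2 (Ne.symm h1)
  rw [riemannZeta_def_of_ne_zero h0, completedRiemannZeta_eq, xiFun]
  field_simp
  ring

theorem Gammaℝ_conj (s : ℂ) : Gammaℝ (starRingEnd ℂ s) = starRingEnd ℂ (Gammaℝ s) := by
  have h := cpow_conj (Real.pi : ℂ) (-s / 2) (by
    rw [arg_ofReal_of_nonneg Real.pi_pos.le]; exact Real.pi_ne_zero.symm)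
  rw [conj_ofReal] at h
  rw [Gammaℝ_def, Gammaℝ_def, map_mul, ← Gamma_conj, ← h, map_div₀, map_div₀, map_neg, map_ofNat]

/-- For Re s > 0 the factors Γ_ℝ and ζ commute with conjugation; the functional equation carries
this to the other half plane. -/
theorem xiFun_conj (s : ℂ) : xiFun (starRingEnd ℂ s) = starRingEnd ℂ (xiFun s) := by
  have key : ∀ s : ℂ, 0 < s.re → xiFun (starRingEnd ℂ s) = starRingEnd ℂ (xiFun s) := by
    intro s hs
    by_cases h1 : s = 1
    · subst h1; simp [xiFun]
    · have h1' : starRingEnd ℂ s ≠ 1 := fun h => h1 (by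
        have := congrArg (starRingEnd ℂ) h; simpa using this)
      rw [xiFun_eq_of_re_pos hs h1, xiFun_eq_of_re_pos (by simpa using hs) h1', Gammaℝ_conj,
        riemannZeta_conj]
      simp
  by_cases hs : 0 < s.re
  · exact key s hs
  · have := key (1 - s) (by simp; linarith)
    rwa [map_sub, map_one, xiFun_one_sub, xiFun_one_sub] at this

theorem xiFun_ne_zero_of_one_le_re {s : ℂ} (hs : 1 ≤ s.re) : xiFun s ≠ 0 := by
  by_cases h1 : s = 1
  · subst h1; simp [xiFun]
  · have hs0 : 0 < s.re := by linarith
    rw [xiFun_eq_of_re_pos hs0 h1]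
    have h0 : s ≠ 0 := fun h => by simp [h] at hs0
    exact mul_ne_zero (mul_ne_zero (mul_ne_zero h0 (sub_ne_zero.2 (Ne.symm h1)))
      (Gammaℝ_ne_zero_of_re_pos hs0)) (riemannZeta_ne_zero_of_one_le_re hs)

theorem re_eq_half_of_xiFun_eq_zero (hRH : RiemannHypothesis) {s : ℂ} (h : xiFun s = 0) :
    s.re = 1 / 2 := by
  by_cases hs : 0 < s.re
  · have h1 : s ≠ 1 := fun h1 => xiFun_ne_zero_of_one_le_re (by simp [h1]) h
    have h0 : s ≠ 0 := fun h => by simp [h] at hs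
    rw [xiFun_eq_of_re_pos hs h1] at h
    have hz : riemannZeta s = 0 := by
      rcases mul_eq_zero.1 h with h | h
      · exact absurd h (mul_ne_zero (mul_ne_zero h0 (sub_ne_zero.2 (Ne.symm h1)))
          (Gammaℝ_ne_zero_of_re_pos hs))
      · exact h
    refine hRH s hz ?_ h1
    rintro ⟨n, rfl⟩
    have : ((-2 * ((n : ℂ) + 1)).re : ℝ) = -2 * (n + 1) := by simp
    rw [this] at hs
    have : (0 : ℝ) ≤ n := n.cast_nonneg
    linarith
  · rw [← xiFun_one_sub] at h
    exact absurd h (xiFun_ne_zero_of_one_le_re (by simp; linarith))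

/-- The cofactor s(1-s)Γ_ℝ(s) is analytic and nonzero at such a point, so multiplicities for ξ and
for ζ agree. -/
theorem analyticOrderNatAt_xiFun {s : ℂ} (hs : 0 < s.re) (h1 : s ≠ 1) :
    analyticOrderNatAt xiFun s = analyticOrderNatAt riemannZeta s := by
  have hopen : IsOpen {z : ℂ | 0 < z.re ∧ z ≠ 1} :=
    (isOpen_lt continuous_const continuous_re).inter isOpen_ne
  have hmem := hopen.mem_nhds (show s ∈ {z : ℂ | 0 < z.re ∧ z ≠ 1} from ⟨hs, h1⟩)
  have hG : DifferentiableOn ℂ (fun z => z * (1 - z) * Gammaℝ z) {z : ℂ | 0 < z.re ∧ z ≠ 1} := by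
    have : DifferentiableOn ℂ Gammaℝ {z : ℂ | 0 < z.re ∧ z ≠ 1} := by
      have h2 : DifferentiableOn ℂ (fun z => (Gammaℝ z)⁻¹⁻¹) {z : ℂ | 0 < z.re ∧ z ≠ 1} :=
        differentiable_Gammaℝ_inv.differentiableOn.inv
          (fun z hz => inv_ne_zero (Gammaℝ_ne_zero_of_re_pos hz.1))
      simpa using h2
    fun_prop
  have han := hG.analyticAt hmem
  have hz : AnalyticAt ℂ riemannZeta s := by
    have : DifferentiableOn ℂ riemannZeta {z : ℂ | 0 < z.re ∧ z ≠ 1} :=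
      fun z hz => (differentiableAt_riemannZeta hz.2).differentiableWithinAt
    exact this.analyticAt hmem
  have hne : s * (1 - s) * Gammaℝ s ≠ 0 := by
    have h0 : s ≠ 0 := fun h => by simp [h] at hs
    exact mul_ne_zero (mul_ne_zero h0 (sub_ne_zero.2 (Ne.symm h1))) (Gammaℝ_ne_zero_of_re_pos hs)
  have heq : xiFun =ᶠ[𝓝 s] (fun z => z * (1 - z) * Gammaℝ z) * riemannZeta := by
    filter_upwards [hmem] with z hz
    exact xiFun_eq_of_re_pos hz.1 hz.2
  unfold analyticOrderNatAt
  rw [analyticOrderAt_congr heq, analyticOrderAt_mul han hz, han.analyticOrderAt_eq_zero.2 hne,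
    zero_add]

/-- Λ₀ is a Mellin transform that converges absolutely for every s. In a vertical strip the modulus
of the power is bounded by the sum of its values at the two edges, here Re s/2 = 1/4 and Re s/2 = 1.
-/
theorem exists_norm_completedRiemannZeta₀_le :
    ∃ B : ℝ, ∀ s : ℂ, 1 / 2 ≤ s.re → s.re ≤ 2 → ‖completedRiemannZeta₀ s‖ ≤ B := by
  set F := (HurwitzZeta.hurwitzEvenFEPair 0).f_modif with hF
  have hconv : ∀ s : ℂ, MellinConvergent F s := fun s =>
    ((HurwitzZeta.hurwitzEvenFEPair 0).isStrongFEPair_toStrongFEPair.hasMellin s).1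
  have hint : ∀ x : ℝ, MeasureTheory.IntegrableOn (fun t : ℝ => t ^ (x - 1) * ‖F t‖)
      (Set.Ioi 0) := by
    intro x
    have h : MeasureTheory.IntegrableOn (fun t : ℝ => ‖(t : ℂ) ^ ((x : ℂ) - 1) • F t‖)
        (Set.Ioi 0) := (hconv x).norm
    refine h.congr_fun (fun t ht => ?_) measurableSet_Ioi
    have ht' : 0 < t := ht
    simp only [norm_smul]
    rw [norm_cpow_eq_rpow_re_of_pos ht']
    simp
  refine ⟨∫ t in Set.Ioi (0 : ℝ), (t ^ ((1 / 4 : ℝ) - 1) * ‖F t‖ + t ^ ((1 : ℝ) - 1) * ‖F t‖),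
    fun s h1 h2 => ?_⟩
  have hdef : completedRiemannZeta₀ s = mellin F (s / 2) / 2 := rfl
  have hle : ‖mellin F (s / 2)‖ ≤
      ∫ t in Set.Ioi (0 : ℝ), (t ^ ((1 / 4 : ℝ) - 1) * ‖F t‖ + t ^ ((1 : ℝ) - 1) * ‖F t‖) := by
    unfold mellin
    refine MeasureTheory.norm_integral_le_of_norm_le ((hint _).add (hint _)) ?_
    refine (MeasureTheory.ae_restrict_iff' measurableSet_Ioi).2 (Eventually.of_forall fun t ht => ?_)
    have ht' : 0 < t := ht
    rw [norm_smul, norm_cpow_eq_rpow_re_of_pos ht', ← add_mul]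
    refine mul_le_mul_of_nonneg_right ?_ (norm_nonneg _)
    have hre : (s / 2 - 1).re = s.re / 2 - 1 := by simp
    rw [hre]
    rcases le_total t 1 with h | h
    · have : t ^ (s.re / 2 - 1) ≤ t ^ ((1 / 4 : ℝ) - 1) :=
        Real.rpow_le_rpow_of_exponent_ge ht' h (by linarith)
      exact this.trans (le_add_of_nonneg_right (by positivity))
    · have : t ^ (s.re / 2 - 1) ≤ t ^ ((1 : ℝ) - 1) :=
        Real.rpow_le_rpow_of_exponent_le h (by linarith)
      exact this.trans (le_add_of_nonneg_left (by positivity))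
  rw [hdef, norm_div]
  have : ‖(2 : ℂ)‖ = 2 := by simp
  rw [this]
  have := norm_nonneg (mellin F (s / 2))
  linarith

theorem norm_Gamma_le_Gamma_re {s : ℂ} (hs : 0 < s.re) : ‖Gamma s‖ ≤ Real.Gamma s.re := by
  rw [Gamma_eq_integral hs, Real.Gamma_eq_integral hs, GammaIntegral]
  refine MeasureTheory.norm_integral_le_of_norm_le (Real.GammaIntegral_convergent hs) ?_
  refine (MeasureTheory.ae_restrict_iff' measurableSet_Ioi).2 (Eventually.of_forall fun t ht => ?_)
  have ht' : 0 < t := ht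
  rw [norm_mul, norm_cpow_eq_rpow_re_of_pos ht']
  rw [Complex.norm_real, Real.norm_of_nonneg (Real.exp_pos _).le]
  simp

theorem Real.Gamma_le_exp_mul_log {x : ℝ} (hx : 1 ≤ x) :
    Real.Gamma x ≤ Real.exp ((x + 1) * Real.log (x + 1)) := by
  have hx0 : 0 < x := by linarith
  have h1 : Real.Gamma x ≤ Real.Gamma (x + 1) := by
    rw [Real.Gamma_add_one hx0.ne']
    have := Real.Gamma_pos_of_pos hx0
    nlinarith
  have hn : x ≤ ⌈x⌉₊ := Nat.le_ceil x
  have hn' : (⌈x⌉₊ : ℝ) ≤ x + 1 := (Nat.ceil_lt_add_one hx0.le).le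
  have h2 : Real.Gamma (x + 1) ≤ Real.Gamma (⌈x⌉₊ + 1) :=
    Real.Gamma_strictMonoOn_Ici.monotoneOn (by simp; linarith) (by simp; linarith) (by linarith)
  rw [Real.Gamma_nat_eq_factorial] at h2
  have h3 : ((⌈x⌉₊).factorial : ℝ) ≤ (⌈x⌉₊ : ℝ) ^ ⌈x⌉₊ := by
    exact_mod_cast Nat.factorial_le_pow ⌈x⌉₊
  have h4 : (⌈x⌉₊ : ℝ) ^ ⌈x⌉₊ ≤ Real.exp ((x + 1) * Real.log (x + 1)) := by
    rw [mul_comm, ← Real.rpow_def_of_pos (by linarith), ← Real.rpow_natCast]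
    calc (⌈x⌉₊ : ℝ) ^ (⌈x⌉₊ : ℝ) ≤ (x + 1) ^ (⌈x⌉₊ : ℝ) := by gcongr
      _ ≤ (x + 1) ^ (x + 1) := by
        apply Real.rpow_le_rpow_of_exponent_le <;> linarith
  linarith

/-- Termwise comparison with the series at 2. The bound π²/6 - 1 is below 1, which later keeps
ζ(2+it) in the domain of the principal logarithm. -/
theorem norm_riemannZeta_sub_one_le {s : ℂ} (hs : 2 ≤ s.re) :
    ‖riemannZeta s - 1‖ ≤ Real.pi ^ 2 / 6 - 1 := by
  have h1 : 1 < s.re := by linarith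
  have hsum : Summable (fun n : ℕ => 1 / ((n : ℂ) + 1) ^ s) := by
    have := (summable_nat_add_iff 1).2 (summable_one_div_nat_cpow.2 h1)
    simpa using this
  have hsum2 : HasSum (fun n : ℕ => 1 / (n : ℝ) ^ 2) (Real.pi ^ 2 / 6) := hasSum_zeta_two
  have hsum3 : HasSum (fun n : ℕ => 1 / ((n : ℝ) + 2) ^ 2) (Real.pi ^ 2 / 6 - 1) := by
    have := (hasSum_nat_add_iff' 2).2 hsum2
    simpa [Finset.sum_range_succ] using this
  rw [zeta_eq_tsum_one_div_nat_add_one_cpow h1, hsum.tsum_eq_zero_add]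
  simp only [CharP.cast_eq_zero, zero_add, one_cpow, ne_eq, one_ne_zero, not_false_eq_true,
    div_self, add_sub_cancel_left]
  refine tsum_of_norm_bounded hsum3 (fun n => ?_)
  have hcast : ((n + 1 : ℕ) : ℂ) + 1 = ((n + 2 : ℕ) : ℂ) := by push_cast; ring
  rw [hcast, norm_div, norm_one, norm_natCast_cpow_of_pos (by omega)]
  have h2 : ((n + 2 : ℕ) : ℝ) ^ (2 : ℝ) ≤ ((n + 2 : ℕ) : ℝ) ^ s.re :=
    Real.rpow_le_rpow_of_exponent_le (by push_cast; linarith [(n.cast_nonneg : (0 : ℝ) ≤ n)]) hs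
  have h3 : ((n + 2 : ℕ) : ℝ) ^ (2 : ℝ) = ((n : ℝ) + 2) ^ 2 := by
    push_cast; exact_mod_cast Real.rpow_natCast ((n : ℝ) + 2) 2
  rw [← h3]
  gcongr

/-- Any exponent strictly between 1 and 2 would serve. The strip 1/2 ≤ Re s ≤ 2 uses the bound for
Λ₀, the half plane Re s ≥ 2 uses the bounds for Γ and ζ, and the functional equation gives the rest.
-/
theorem exists_norm_xiFun_le :
    ∃ C : ℝ, ∀ s : ℂ, ‖xiFun s‖ ≤ Real.exp (C * (1 + ‖s - 2‖) ^ (3 / 2 : ℝ)) := by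
  obtain ⟨B, hB⟩ := exists_norm_completedRiemannZeta₀_le
  have hB0 : 0 ≤ B := (norm_nonneg _).trans (hB 1 (by norm_num) (by norm_num))
  -- bound on the half plane `1 / 2 ≤ re s`
  have key : ∀ s : ℂ, 1 / 2 ≤ s.re →
      ‖xiFun s‖ ≤ Real.exp ((2 * B + 14) * (1 + ‖s - 2‖) ^ (3 / 2 : ℝ)) := by
    intro s hs
    set u : ℝ := 1 + ‖s - 2‖ with hu
    have hu1 : 1 ≤ u := by rw [hu]; linarith [norm_nonneg (s - 2)]
    have hs1 : ‖s‖ ≤ 2 * u := by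
      have : ‖s‖ ≤ ‖s - 2‖ + ‖(2 : ℂ)‖ := by simpa using norm_add_le (s - 2) 2
      have h2 : ‖(2 : ℂ)‖ = 2 := by simp
      rw [h2] at this
      linarith [norm_nonneg (s - 2)]
    have hs2 : ‖1 - s‖ ≤ u := by
      have : ‖1 - s‖ ≤ ‖s - 2‖ + ‖(1 : ℂ)‖ := by
        have := norm_add_le (s - 2) 1
        rwa [show s - 2 + 1 = -(1 - s) by ring, norm_neg] at this
      rw [norm_one] at this
      linarith
    have hss : ‖s * (1 - s)‖ ≤ 2 * u ^ 2 := by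
      rw [norm_mul]
      calc _ ≤ 2 * u * u := by gcongr
        _ = _ := by ring
    have huu : u ≤ u ^ (3 / 2 : ℝ) := by
      conv_lhs => rw [← Real.rpow_one u]
      exact Real.rpow_le_rpow_of_exponent_le hu1 (by norm_num)
    have hu2 : u ^ 2 ≤ Real.exp (2 * u) := by
      have := Real.add_one_le_exp u
      calc u ^ 2 ≤ (Real.exp u) ^ 2 := by gcongr; linarith
        _ = _ := by rw [← Real.exp_nat_mul]; norm_num
    rcases le_total s.re 2 with h2 | h2
    · have h3 : ‖xiFun s‖ ≤ 2 * u ^ 2 * B + 1 := by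
        unfold xiFun
        refine (norm_sub_le _ _).trans ?_
        rw [norm_one, norm_mul]
        gcongr
        exact hB s hs h2
      calc ‖xiFun s‖ ≤ 2 * u ^ 2 * B + 1 := h3
        _ ≤ (2 * B + 1) * u ^ 2 := by nlinarith
        _ ≤ Real.exp (2 * B) * Real.exp (2 * u) := by
          gcongr
          exact Real.add_one_le_exp _
        _ = Real.exp (2 * B + 2 * u) := by rw [Real.exp_add]
        _ ≤ _ := by
          apply Real.exp_le_exp.2
          nlinarith
    · have hs0 : 0 < s.re := by linarith
      have h1 : s ≠ 1 := fun h => by rw [h] at h2; norm_num at h2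
      rw [xiFun_eq_of_re_pos hs0 h1, Gammaℝ_def, norm_mul, norm_mul _ (_ * _),
        norm_mul (_ ^ _)]
      have hpi : ‖(Real.pi : ℂ) ^ (-s / 2)‖ ≤ 1 := by
        rw [norm_cpow_eq_rpow_re_of_pos Real.pi_pos]
        apply Real.rpow_le_one_of_one_le_of_nonpos
        · linarith [Real.pi_gt_three]
        · simp; linarith
      have hz : ‖riemannZeta s‖ ≤ 2 := by
        have h3 := norm_riemannZeta_sub_one_le h2
        have h4 : ‖riemannZeta s‖ ≤ ‖riemannZeta s - 1‖ + ‖(1 : ℂ)‖ := by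
          simpa using norm_add_le (riemannZeta s - 1) 1
        rw [norm_one] at h4
        have h5 := Real.pi_lt_d2
        nlinarith [Real.pi_gt_three]
      have hre : (s / 2).re = s.re / 2 := by simp
      have hG : ‖Gamma (s / 2)‖ ≤ Real.exp (8 * u ^ (3 / 2 : ℝ)) := by
        refine (norm_Gamma_le_Gamma_re (by rw [hre]; linarith)).trans ?_
        rw [hre]
        refine (Real.Gamma_le_exp_mul_log (by linarith)).trans (Real.exp_le_exp.2 ?_)
        have hx : s.re / 2 + 1 ≤ 2 * u := by
          have := (le_abs_self _).trans (abs_re_le_norm s)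
          linarith
        -- This is where 3/2 arises: the logarithm is absorbed into a square root.
        have hlog : Real.log (s.re / 2 + 1) ≤ 4 * u ^ (1 / 2 : ℝ) := by
          have h6 : Real.log (s.re / 2 + 1) ≤ Real.log (2 * u) :=
            Real.log_le_log (by linarith) hx
          have h7 := Real.log_le_rpow_div (x := 2 * u) (ε := 1 / 2) (by linarith) (by norm_num)
          rw [Real.mul_rpow (by norm_num) (by linarith)] at h7
          have h8 : (2 : ℝ) ^ (1 / 2 : ℝ) ≤ 2 := by
            conv_rhs => rw [← Real.rpow_one 2]
            exact Real.rpow_le_rpow_of_exponent_le (by norm_num) (by norm_num)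
          have h9 : 0 ≤ u ^ (1 / 2 : ℝ) := by positivity
          nlinarith
        have hlog0 : 0 ≤ Real.log (s.re / 2 + 1) := Real.log_nonneg (by linarith)
        calc (s.re / 2 + 1) * Real.log (s.re / 2 + 1) ≤ (2 * u) * (4 * u ^ (1 / 2 : ℝ)) := by
              gcongr
          _ = 8 * (u ^ (1 : ℝ) * u ^ (1 / 2 : ℝ)) := by rw [Real.rpow_one]; ring
          _ = 8 * u ^ (3 / 2 : ℝ) := by rw [← Real.rpow_add (by linarith)]; norm_num
      calc ‖s * (1 - s)‖ * (‖(Real.pi : ℂ) ^ (-s / 2)‖ * ‖Gamma (s / 2)‖) * ‖riemannZeta s‖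
          ≤ (2 * u ^ 2) * (1 * Real.exp (8 * u ^ (3 / 2 : ℝ))) * 2 := by gcongr
        _ = 4 * u ^ 2 * Real.exp (8 * u ^ (3 / 2 : ℝ)) := by ring
        _ ≤ Real.exp 3 * Real.exp (2 * u) * Real.exp (8 * u ^ (3 / 2 : ℝ)) := by
          gcongr
          linarith [Real.add_one_le_exp 3]
        _ = Real.exp (3 + 2 * u + 8 * u ^ (3 / 2 : ℝ)) := by rw [Real.exp_add, Real.exp_add]
        _ ≤ _ := by
          apply Real.exp_le_exp.2
          nlinarith
  -- Reflection enlarges 1+|s-2| by at most the factor 4, and 4^(3/2) = 8.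
  refine ⟨(2 * B + 14) * 8, fun s => ?_⟩
  have h0 := norm_nonneg (s - 2)
  have hfin : ∀ x : ℝ, 0 ≤ x → x ≤ 4 * (1 + ‖s - 2‖) →
      Real.exp ((2 * B + 14) * x ^ (3 / 2 : ℝ))
        ≤ Real.exp ((2 * B + 14) * 8 * (1 + ‖s - 2‖) ^ (3 / 2 : ℝ)) := by
    intro x hx0 hx
    apply Real.exp_le_exp.2
    rw [mul_assoc]
    gcongr
    calc x ^ (3 / 2 : ℝ) ≤ (4 * (1 + ‖s - 2‖)) ^ (3 / 2 : ℝ) := by gcongr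
      _ = 8 * (1 + ‖s - 2‖) ^ (3 / 2 : ℝ) := by
        rw [Real.mul_rpow (by norm_num) (by linarith)]
        congr 1
        rw [show (4 : ℝ) = 2 ^ (2 : ℝ) by norm_num, ← Real.rpow_mul (by norm_num)]
        norm_num
  rcases le_total (1 / 2) s.re with hs | hs
  · exact (key s hs).trans (hfin _ (by linarith) (by linarith))
  · rw [← xiFun_one_sub]
    refine (key (1 - s) (by simp; linarith)).trans (hfin _ (by positivity) ?_)
    have : ‖1 - s - 2‖ ≤ ‖s - 2‖ + ‖(3 : ℂ)‖ := by
      have := norm_add_le (s - 2) 3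
      rwa [show s - 2 + 3 = -(1 - s - 2) by ring, norm_neg] at this
    have h3 : ‖(3 : ℂ)‖ = 3 := by simp
    rw [h3] at this
    linarith

end Xi

/-! ### The sum over zeros as the real part of ξ'/ξ -/

section ZeroSum

open Complex

/-- The zero `1/2 + iγ` with a given index. -/
noncomputable def ZetaZeroIndex.point (j : ZetaZeroIndex) : ℂ := (1 / 2 : ℂ) + (j.ordinate : ℂ) * I

/-- The index of the `k`-th copy of a zero. -/
def ZetaZeroIndex.ofOrder (γ : ℝ) (k : ℕ)
    (h : k < analyticOrderNatAt riemannZeta ((1 / 2 : ℂ) + (γ : ℂ) * I)) : ZetaZeroIndex :=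
  ⟨(γ, k), h⟩

theorem ZetaZeroIndex.point_re (j : ZetaZeroIndex) : j.point.re = 1 / 2 := by
  simp [ZetaZeroIndex.point]

theorem ZetaZeroIndex.point_im (j : ZetaZeroIndex) : j.point.im = j.ordinate := by
  simp [ZetaZeroIndex.point]

theorem ZetaZeroIndex.riemannZeta_point (j : ZetaZeroIndex) : riemannZeta j.point = 0 := by
  have h1 : j.point ≠ 1 := fun h => by
    have := j.point_re
    rw [h] at this
    norm_num at this
  have han : AnalyticAt ℂ riemannZeta j.point := analyticOn_riemannZeta _ h1
  by_contra hne
  have h2 : analyticOrderNatAt riemannZeta j.point = 0 := by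
    simp [analyticOrderNatAt, han.analyticOrderAt_eq_zero.2 hne]
  have h3 := j.2
  change j.1.2 < analyticOrderNatAt riemannZeta j.point at h3
  omega

/-- A compact segment meets the zero set of ζ in finitely many points, and each has finitely many
copies in the index type. -/
theorem ZetaZeroIndex.finite_abs_ordinate_le (R : ℝ) :
    {j : ZetaZeroIndex | |j.ordinate| ≤ R}.Finite := by
  have hcomp : IsCompact ((fun γ : ℝ => (1 / 2 : ℂ) + (γ : ℂ) * I) '' Set.Icc (-R) R) :=
    isCompact_Icc.image (by fun_prop)
  have hinj : Function.Injective (fun γ : ℝ => (1 / 2 : ℂ) + (γ : ℂ) * I) := by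
    intro x y h
    have := congrArg Complex.im h
    simpa using this
  have hfin : {γ : ℝ | |γ| ≤ R ∧ riemannZeta ((1 / 2 : ℂ) + (γ : ℂ) * I) = 0}.Finite := by
    refine Set.Finite.of_finite_image (f := fun γ : ℝ => (1 / 2 : ℂ) + (γ : ℂ) * I)
      (hcomp.inter_riemannZetaZeros_finite.subset ?_) hinj.injOn
    rintro _ ⟨γ, ⟨h1, h2⟩, rfl⟩
    exact ⟨⟨γ, abs_le.1 h1, rfl⟩, h2⟩
  have hfin2 : (⋃ γ ∈ {γ : ℝ | |γ| ≤ R ∧ riemannZeta ((1 / 2 : ℂ) + (γ : ℂ) * I) = 0},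
      (fun k : ℕ => (γ, k)) '' Set.Iio
        (analyticOrderNatAt riemannZeta ((1 / 2 : ℂ) + (γ : ℂ) * I))).Finite :=
    hfin.biUnion fun γ _ => (Set.finite_Iio _).image _
  refine Set.Finite.of_finite_image (f := fun j : ZetaZeroIndex => j.1) (hfin2.subset ?_)
    Subtype.val_injective.injOn
  rintro _ ⟨j, hj, rfl⟩
  simp only [Set.mem_iUnion]
  exact ⟨j.1.1, ⟨hj, j.riemannZeta_point⟩, j.1.2, j.2, rfl⟩

theorem ZetaZeroIndex.finite_norm_point_sub_lt (R : ℝ) :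
    {j : ZetaZeroIndex | ‖j.point - 2‖ < R}.Finite := by
  refine (ZetaZeroIndex.finite_abs_ordinate_le R).subset fun j hj => ?_
  have h := abs_im_le_norm (j.point - 2)
  rw [sub_im, j.point_im] at h
  simp only [im_ofNat, sub_zero] at h
  exact h.trans (le_of_lt hj)

/-- The indices of the zeros in the disc of radius `R` around `2`. -/
noncomputable def zerosInDisc (R : ℝ) : Finset ZetaZeroIndex :=
  (ZetaZeroIndex.finite_norm_point_sub_lt R).toFinset

theorem mem_zerosInDisc {R : ℝ} {j : ZetaZeroIndex} :
    j ∈ zerosInDisc R ↔ ‖j.point - 2‖ < R := by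
  simp [zerosInDisc]

theorem tendsto_zerosInDisc : Tendsto zerosInDisc atTop atTop :=
  tendsto_atTop_finset_of_monotone
    (fun _ _ h _ hj => mem_zerosInDisc.2 ((mem_zerosInDisc.1 hj).trans_le h))
    (fun j => ⟨‖j.point - 2‖ + 1, mem_zerosInDisc.2 (by linarith)⟩)

/-- RH enters here: off the critical line both sides vanish, and on it the copies of a zero are
indexed by the numbers below its order. -/
theorem card_filter_zerosInDisc (hRH : RiemannHypothesis) (R : ℝ) (z : ℂ) (hz : ‖z - 2‖ < R) :
    ((zerosInDisc R).filter (fun j => j.point = z)).card = analyticOrderNatAt xiFun z := by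
  by_cases hre : z.re = 1 / 2
  · have hz' : z = (1 / 2 : ℂ) + (z.im : ℂ) * I := by
      apply Complex.ext <;> simp [hre]
    have h1 : z ≠ 1 := fun h => by rw [h] at hre; norm_num at hre
    rw [analyticOrderNatAt_xiFun (by rw [hre]; norm_num) h1]
    rw [← Finset.card_range (analyticOrderNatAt riemannZeta z)]
    symm
    have hlt : ∀ k ∈ Finset.range (analyticOrderNatAt riemannZeta z),
        k < analyticOrderNatAt riemannZeta ((1 / 2 : ℂ) + (z.im : ℂ) * I) := fun k hk => by
      rw [← hz']; exact Finset.mem_range.1 hk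
    refine Finset.card_bij (fun k hk => ZetaZeroIndex.ofOrder z.im k (hlt k hk)) ?_ ?_ ?_
    · intro k hk
      have : (ZetaZeroIndex.ofOrder z.im k (hlt k hk)).point = z := by
        conv_rhs => rw [hz']
        rfl
      rw [Finset.mem_filter, mem_zerosInDisc, this]
      exact ⟨hz, rfl⟩
    · intro k hk l hl h
      have := congrArg (fun j : ZetaZeroIndex => j.1.2) h
      exact this
    · intro j hj
      rw [Finset.mem_filter] at hj
      have him : j.1.1 = z.im := by
        rw [← hj.2, j.point_im]; rfl
      have hlt : j.1.2 < analyticOrderNatAt riemannZeta j.point := j.2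
      rw [hj.2] at hlt
      refine ⟨j.1.2, Finset.mem_range.2 hlt, ?_⟩
      apply Subtype.ext
      exact Prod.ext him.symm rfl
  · have h1 : xiFun z ≠ 0 := fun h => hre (re_eq_half_of_xiFun_eq_zero hRH h)
    have h2 : analyticOrderNatAt xiFun z = 0 := by
      simp [analyticOrderNatAt, (differentiable_xiFun.analyticAt z).analyticOrderAt_eq_zero.2 h1]
    rw [h2, Finset.card_eq_zero, Finset.filter_eq_empty_iff]
    rintro j - rfl
    exact hre j.point_re

theorem xiFun_ne_zero_of_re_ne (hRH : RiemannHypothesis) {s : ℂ} (hs : s.re ≠ 1 / 2) :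
    xiFun s ≠ 0 := fun h => hs (re_eq_half_of_xiFun_eq_zero hRH h)

/-- The growth argument is centred at 2, where ξ is nonzero; taking a difference replaces 2 by an
arbitrary reference point. -/
theorem tendsto_sum_zerosInDisc (hRH : RiemannHypothesis) {s w : ℂ} (hs : s.re ≠ 1 / 2)
    (hw : w.re ≠ 1 / 2) :
    Tendsto (fun R => ∑ j ∈ zerosInDisc R, (1 / (s - j.point) - 1 / (w - j.point))) atTop
      (𝓝 (logDeriv xiFun s - logDeriv xiFun w)) := by
  obtain ⟨C, hC⟩ := exists_norm_xiFun_le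
  have key : ∀ s : ℂ, s.re ≠ 1 / 2 →
      Tendsto (fun R => ∑ j ∈ zerosInDisc R, (1 / (s - j.point) - 1 / (2 - j.point))) atTop
        (𝓝 (logDeriv xiFun s - logDeriv xiFun 2)) := fun s hs =>
    tendsto_sum_logDeriv_of_growth differentiable_xiFun
      (xiFun_ne_zero_of_one_le_re (by norm_num)) hC ZetaZeroIndex.point zerosInDisc
      (fun _ _ => mem_zerosInDisc) (card_filter_zerosInDisc hRH) (xiFun_ne_zero_of_re_ne hRH hs)
  have h := (key s hs).sub (key w hw)
  rw [sub_sub_sub_cancel_right] at h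
  refine h.congr fun R => ?_
  rw [← Finset.sum_sub_distrib]
  exact Finset.sum_congr rfl fun j _ => by ring

theorem logDeriv_xiFun_one_sub (s : ℂ) : logDeriv xiFun (1 - s) = -logDeriv xiFun s := by
  have h : xiFun ∘ (fun z => 1 - z) = xiFun := funext xiFun_one_sub
  have h2 := logDeriv_comp (f := xiFun) (g := fun z : ℂ => 1 - z) (x := s)
    (differentiable_xiFun _) (by fun_prop)
  rw [h] at h2
  have h3 : deriv (fun z : ℂ => 1 - z) s = -1 := by
    simp
  rw [h2, h3]
  ring

theorem logDeriv_xiFun_conj (s : ℂ) :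
    logDeriv xiFun (starRingEnd ℂ s) = starRingEnd ℂ (logDeriv xiFun s) := by
  have h : (starRingEnd ℂ) ∘ xiFun ∘ (starRingEnd ℂ) = xiFun := by
    ext z
    simp [xiFun_conj]
  have h2 := congrFun (deriv_conj_conj (𝕜 := ℂ) (f := xiFun)) s
  rw [h] at h2
  rw [logDeriv_apply, logDeriv_apply, map_div₀, h2, xiFun_conj]
  simp

/-- `ξ'/ξ` on the line `re s = 1/2 + a` as a sum over zeros. -/
theorem hasSum_one_div_sq_add_sq (hRH : RiemannHypothesis) {a : ℝ} (ha : 0 < a) (t : ℝ) :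
    HasSum (fun j : ZetaZeroIndex => 1 / (a ^ 2 + (t - j.ordinate) ^ 2))
      ((logDeriv xiFun ((1 / 2 + a : ℝ) + t * I)).re / a) := by
  set s : ℂ := (1 / 2 + a : ℝ) + t * I with hs
  -- The mirror image of `s` in the critical line. The functional equation and conjugation give
  -- ξ'/ξ(w) = -conj(ξ'/ξ(s)), so the difference is twice the real part and no additive constant has
  -- to be identified.
  set w : ℂ := 1 - starRingEnd ℂ s with hw
  have hsre : s.re = 1 / 2 + a := by simp [hs]
  have hsim : s.im = t := by simp [hs]
  have hwre : w.re = 1 / 2 - a := by simp [hw, hsre]; ring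
  have hwim : w.im = t := by simp [hw, hsim]
  have hlim := tendsto_sum_zerosInDisc hRH (s := s) (w := w) (by rw [hsre]; linarith)
    (by rw [hwre]; linarith)
  have hval : logDeriv xiFun s - logDeriv xiFun w = ((2 * (logDeriv xiFun s).re : ℝ) : ℂ) := by
    rw [hw, logDeriv_xiFun_one_sub, logDeriv_xiFun_conj, sub_neg_eq_add, add_conj]
  have hterm : ∀ j : ZetaZeroIndex, 1 / (s - j.point) - 1 / (w - j.point) =
      ((2 * a * (1 / (a ^ 2 + (t - j.ordinate) ^ 2)) : ℝ) : ℂ) := by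
    intro j
    have e1 : s - j.point = (a : ℂ) + ((t - j.ordinate : ℝ) : ℂ) * I := by
      apply Complex.ext <;> simp [hsre, hsim, j.point_re, j.point_im]
    have e2 : w - j.point = -(a : ℂ) + ((t - j.ordinate : ℝ) : ℂ) * I := by
      apply Complex.ext <;> simp [hwre, hwim, j.point_re, j.point_im]
    rw [e1, e2]
    set u : ℝ := t - j.ordinate
    have h1 : (a : ℂ) + (u : ℂ) * I ≠ 0 := fun h => by
      have := congrArg Complex.re h; simp at this; exact ha.ne' this
    have h2 : -(a : ℂ) + (u : ℂ) * I ≠ 0 := fun h => by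
      have := congrArg Complex.re h; simp at this; exact ha.ne' this
    have h3 : (a : ℂ) ^ 2 + (u : ℂ) ^ 2 ≠ 0 := by
      exact_mod_cast (by positivity : a ^ 2 + u ^ 2 ≠ 0)
    push_cast
    field_simp
    linear_combination (-2 * (a : ℂ) * u ^ 2 ) * I_sq
  have hlim2 : Tendsto (fun R => ∑ j ∈ zerosInDisc R, 1 / (a ^ 2 + (t - j.ordinate) ^ 2)) atTop
      (𝓝 ((logDeriv xiFun s).re / a)) := by
    rw [hval] at hlim
    simp_rw [hterm, ← ofReal_sum, ← Finset.mul_sum] at hlim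
    have h1 := (continuous_re.tendsto _).comp hlim
    simp only [Function.comp_def, ofReal_re] at h1
    have h2 := h1.const_mul (1 / (2 * a))
    convert h2 using 2
    · field_simp
    · field_simp
  have hmono : Monotone (fun R => ∑ j ∈ zerosInDisc R, 1 / (a ^ 2 + (t - j.ordinate) ^ 2)) := by
    intro R R' h
    refine Finset.sum_le_sum_of_subset_of_nonneg
      (fun _ hj => mem_zerosInDisc.2 ((mem_zerosInDisc.1 hj).trans_le h))
      (fun j _ _ => by positivity)
  -- All terms are nonnegative, so convergence along growing discs already gives unconditional
  -- summability.
  have hsum : Summable (fun j : ZetaZeroIndex => 1 / (a ^ 2 + (t - j.ordinate) ^ 2)) := by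
    refine summable_of_sum_le (c := (logDeriv xiFun s).re / a) (fun j => by positivity)
      (fun u => ?_)
    obtain ⟨R, hR⟩ := (tendsto_zerosInDisc.eventually_ge_atTop u).exists
    exact (Finset.sum_le_sum_of_subset_of_nonneg hR (fun j _ _ => by positivity)).trans
      (hmono.ge_of_tendsto hlim2 R)
  have := tendsto_nhds_unique (hsum.hasSum.comp tendsto_zerosInDisc) hlim2
  rw [← this]
  exact hsum.hasSum

theorem summable_one_div_sq_add_sq (hRH : RiemannHypothesis) {a : ℝ} (ha : 0 < a) (t : ℝ) :
    Summable (fun j : ZetaZeroIndex => 1 / (a ^ 2 + (t - j.ordinate) ^ 2)) :=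
  (hasSum_one_div_sq_add_sq hRH ha t).summable

theorem sigmaSum_eq (hRH : RiemannHypothesis) {a : ℝ} (ha : 0 < a) (t : ℝ) :
    sigmaSum a t = (logDeriv xiFun ((1 / 2 + a : ℝ) + t * I)).re / a :=
  (hasSum_one_div_sq_add_sq hRH ha t).tsum_eq

theorem normSq_sub_point (s : ℂ) (j : ZetaZeroIndex) :
    ‖s - j.point‖ ^ 2 = (s.re - 1 / 2) ^ 2 + (s.im - j.ordinate) ^ 2 := by
  rw [Complex.sq_norm, normSq_apply, sub_re, sub_im, j.point_re, j.point_im]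
  ring

theorem norm_one_div_sub_one_div_le {s w p : ℂ} (hs : s ≠ p) (hw : w ≠ p) :
    ‖1 / (s - p) - 1 / (w - p)‖ ≤ ‖s - w‖ * (1 / ‖s - p‖ ^ 2 + 1 / ‖w - p‖ ^ 2) := by
  have h1 : 0 < ‖s - p‖ := norm_pos_iff.2 (sub_ne_zero.2 hs)
  have h2 : 0 < ‖w - p‖ := norm_pos_iff.2 (sub_ne_zero.2 hw)
  have e : 1 / (s - p) - 1 / (w - p) = -(s - w) * (1 / (s - p) * (1 / (w - p))) := by
    have := sub_ne_zero.2 hs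
    have := sub_ne_zero.2 hw
    field_simp
    ring
  rw [e, norm_mul, norm_neg, norm_mul, norm_div, norm_div, norm_one]
  gcongr
  rw [← one_div_pow, ← one_div_pow]
  nlinarith [sq_nonneg (1 / ‖s - p‖ - 1 / ‖w - p‖), one_div_pos.2 h1, one_div_pos.2 h2]

/-- Differences of partial fractions are dominated by the quadratic sums at both points. Hence the
limit along discs is an unconditional sum, whose imaginary parts can be estimated term by term. -/
theorem hasSum_logDeriv_xiFun_sub (hRH : RiemannHypothesis) {s w : ℂ} (hs : 1 / 2 < s.re)
    (hw : 1 / 2 < w.re) :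
    HasSum (fun j : ZetaZeroIndex => 1 / (s - j.point) - 1 / (w - j.point))
      (logDeriv xiFun s - logDeriv xiFun w) := by
  have hsummable : Summable
      (fun j : ZetaZeroIndex => 1 / (s - j.point) - 1 / (w - j.point)) := by
    have h1 := summable_one_div_sq_add_sq hRH (sub_pos.2 hs) s.im
    have h2 := summable_one_div_sq_add_sq hRH (sub_pos.2 hw) w.im
    refine Summable.of_norm_bounded ((h1.add h2).mul_left ‖s - w‖) (fun j => ?_)
    rw [← normSq_sub_point, ← normSq_sub_point]
    refine norm_one_div_sub_one_div_le (fun h => ?_) (fun h => ?_)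
    · rw [h, j.point_re] at hs; exact lt_irrefl _ hs
    · rw [h, j.point_re] at hw; exact lt_irrefl _ hw
  have := tendsto_nhds_unique (hsummable.hasSum.comp tendsto_zerosInDisc)
    (tendsto_sum_zerosInDisc hRH hs.ne' hw.ne')
  rw [← this]
  exact hsummable.hasSum

end ZeroSum

/-! ### Stirling's formula for the digamma function on Re s = 1 -/

section Digamma

open Complex MeasureTheory Set

/-- The difference between `exp (-x)` and its `n`-th Euler approximation. -/
noncomputable def eulerDefect (n : ℕ) (x : ℝ) : ℝ :=
  Real.exp (-x) - (Ioc 0 (n : ℝ)).indicator (fun x : ℝ => (1 - x / n) ^ n) x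

theorem eulerDefect_nonneg (n : ℕ) (x : ℝ) : 0 ≤ eulerDefect n x := by
  unfold eulerDefect
  rw [sub_nonneg]
  by_cases hx : x ∈ Ioc 0 (n : ℝ)
  · rw [indicator_of_mem hx]
    exact Real.one_sub_div_pow_le_exp_neg hx.2
  · rw [indicator_of_notMem hx]
    positivity

theorem integrableOn_eulerDefect_and_integral {s : ℂ} (hs : 0 < s.re) {n : ℕ} (hn : n ≠ 0) :
    IntegrableOn (fun x : ℝ => (eulerDefect n x : ℂ) * (x : ℂ) ^ (s - 1)) (Ioi 0) ∧
      ∫ x in Ioi (0 : ℝ), (eulerDefect n x : ℂ) * (x : ℂ) ^ (s - 1) = Gamma s - GammaSeq s n := by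
  have h1 : IntegrableOn (fun x : ℝ => (Real.exp (-x) : ℂ) * (x : ℂ) ^ (s - 1)) (Ioi 0) :=
    GammaIntegral_convergent hs
  have h2 : IntegrableOn ((Ioc 0 (n : ℝ)).indicator
      fun x : ℝ => (((1 - x / n) ^ n : ℝ) : ℂ) * (x : ℂ) ^ (s - 1)) (Ioi 0) := by
    rw [IntegrableOn, integrable_indicator_iff measurableSet_Ioc, IntegrableOn,
      Measure.restrict_restrict_of_subset Ioc_subset_Ioi_self, ← IntegrableOn, ←
      intervalIntegrable_iff_integrableOn_Ioc_of_le (by positivity : (0 : ℝ) ≤ n)]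
    apply IntervalIntegrable.continuousOn_mul
    · refine intervalIntegral.intervalIntegrable_cpow' ?_
      rw [sub_re, one_re]
      linarith
    · fun_prop
  have heq : (fun x : ℝ => (eulerDefect n x : ℂ) * (x : ℂ) ^ (s - 1)) =
      fun x : ℝ => (Real.exp (-x) : ℂ) * (x : ℂ) ^ (s - 1) - (Ioc 0 (n : ℝ)).indicator
        (fun x : ℝ => (((1 - x / n) ^ n : ℝ) : ℂ) * (x : ℂ) ^ (s - 1)) x := by
    ext x
    unfold eulerDefect
    by_cases hx : x ∈ Ioc 0 (n : ℝ)
    · rw [indicator_of_mem hx, indicator_of_mem hx]; push_cast; ring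
    · rw [indicator_of_notMem hx, indicator_of_notMem hx]; push_cast; ring
  rw [heq]
  refine ⟨h1.sub h2, ?_⟩
  rw [integral_sub h1 h2, Gamma_eq_integral hs, GammaIntegral,
    GammaSeq_eq_approx_Gamma_integral hs hn,
    MeasureTheory.integral_indicator measurableSet_Ioc,
    intervalIntegral.integral_of_le (by positivity : 0 ≤ (n : ℝ)),
    Measure.restrict_restrict_of_subset Ioc_subset_Ioi_self]

theorem integrableOn_eulerDefect_mul_rpow {x : ℝ} (hx : 0 < x) {n : ℕ} (hn : n ≠ 0) :
    IntegrableOn (fun t : ℝ => eulerDefect n t * t ^ (x - 1)) (Ioi 0) ∧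
      ∫ t in Ioi (0 : ℝ), eulerDefect n t * t ^ (x - 1) = ‖Gamma x - GammaSeq x n‖ := by
  obtain ⟨h1, h2⟩ := integrableOn_eulerDefect_and_integral (s := x) (by simpa using hx) hn
  have heq : ∀ t ∈ Ioi (0 : ℝ), (eulerDefect n t : ℂ) * (t : ℂ) ^ ((x : ℂ) - 1) =
      ((eulerDefect n t * t ^ (x - 1) : ℝ) : ℂ) := by
    intro t ht
    rw [ofReal_mul, ofReal_cpow (le_of_lt ht)]
    push_cast
    rfl
  have h1' : IntegrableOn (fun t : ℝ => ((eulerDefect n t * t ^ (x - 1) : ℝ) : ℂ)) (Ioi 0) :=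
    h1.congr_fun heq measurableSet_Ioi
  refine ⟨?_, ?_⟩
  · have := h1'.re
    unfold IntegrableOn
    simpa using this
  · rw [← h2, setIntegral_congr_fun measurableSet_Ioi heq, integral_complex_ofReal, norm_real,
      Real.norm_of_nonneg]
    refine setIntegral_nonneg measurableSet_Ioi fun t ht => ?_
    exact mul_nonneg (eulerDefect_nonneg n t) (Real.rpow_nonneg (le_of_lt ht) _)

/-- The Euler defect is nonnegative and |t^(s-1)| ≤ t^(-1/2) + t^(1/2) in this strip. Convergence at
the two real edges therefore controls the whole strip. -/
theorem norm_Gamma_sub_GammaSeq_le {s : ℂ} (h1 : 1 / 2 ≤ s.re) (h2 : s.re ≤ 3 / 2) {n : ℕ}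
    (hn : n ≠ 0) :
    ‖Gamma s - GammaSeq s n‖ ≤ ‖Gamma (1 / 2 : ℝ) - GammaSeq (1 / 2 : ℝ) n‖
      + ‖Gamma (3 / 2 : ℝ) - GammaSeq (3 / 2 : ℝ) n‖ := by
  obtain ⟨i1, e1⟩ := integrableOn_eulerDefect_mul_rpow (x := 1 / 2) (by norm_num) hn
  obtain ⟨i2, e2⟩ := integrableOn_eulerDefect_mul_rpow (x := 3 / 2) (by norm_num) hn
  rw [← (integrableOn_eulerDefect_and_integral (s := s) (by linarith) hn).2, ← e1, ← e2,
    ← integral_add i1 i2]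
  refine norm_integral_le_of_norm_le (i1.add i2) ?_
  refine (ae_restrict_iff' measurableSet_Ioi).2 (Eventually.of_forall fun t ht => ?_)
  have ht' : 0 < t := ht
  rw [norm_mul, norm_cpow_eq_rpow_re_of_pos ht', norm_real,
    Real.norm_of_nonneg (eulerDefect_nonneg n t), ← mul_add]
  refine mul_le_mul_of_nonneg_left ?_ (eulerDefect_nonneg n t)
  rw [sub_re, one_re]
  rcases le_total t 1 with h | h
  · exact (Real.rpow_le_rpow_of_exponent_ge ht' h (by linarith)).trans
      (le_add_of_nonneg_right (by positivity))
  · exact (Real.rpow_le_rpow_of_exponent_le h (by linarith)).trans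
      (le_add_of_nonneg_left (by positivity))

theorem tendstoUniformlyOn_GammaSeq :
    TendstoUniformlyOn (fun n s => GammaSeq s n) Gamma atTop
      {s : ℂ | 1 / 2 < s.re ∧ s.re < 3 / 2} := by
  have hlim : Tendsto (fun n => ‖Gamma (1 / 2 : ℝ) - GammaSeq (1 / 2 : ℝ) n‖
      + ‖Gamma (3 / 2 : ℝ) - GammaSeq (3 / 2 : ℝ) n‖) atTop (𝓝 0) := by
    have h1 := ((GammaSeq_tendsto_Gamma ((1 / 2 : ℝ) : ℂ)).const_sub
      (Gamma (1 / 2 : ℝ))).norm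
    have h2 := ((GammaSeq_tendsto_Gamma ((3 / 2 : ℝ) : ℂ)).const_sub
      (Gamma (3 / 2 : ℝ))).norm
    simpa using h1.add h2
  rw [Metric.tendstoUniformlyOn_iff]
  intro ε hε
  filter_upwards [hlim.eventually_lt_const hε, eventually_ne_atTop 0] with n hn hn0 s hs
  rw [dist_eq_norm]
  exact (norm_Gamma_sub_GammaSeq_le hs.1.le hs.2.le hn0).trans_lt hn

theorem add_natCast_ne_zero_of_re_pos {s : ℂ} (hs : 0 < s.re) (k : ℕ) : s + k ≠ 0 := by
  intro h
  have h1 := congrArg Complex.re h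
  simp only [add_re, natCast_re, zero_re] at h1
  have : (0 : ℝ) ≤ k := k.cast_nonneg
  linarith

theorem hasDerivAt_GammaSeq_aux {s : ℂ} (hs : 0 < s.re) {n : ℕ} (hn : n ≠ 0) :
    DifferentiableAt ℂ (fun z => GammaSeq z n) s ∧
      logDeriv (fun z => GammaSeq z n) s = log n - ∑ k ∈ Finset.range (n + 1), 1 / (s + k) := by
  have hn' : (n : ℂ) ≠ 0 := by exact_mod_cast hn
  have hprod : ∏ k ∈ Finset.range (n + 1), (s + k) ≠ 0 :=
    Finset.prod_ne_zero_iff.2 fun k _ => add_natCast_ne_zero_of_re_pos hs k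
  have hd1 : DifferentiableAt ℂ (fun z : ℂ => (n : ℂ) ^ z * (n.factorial : ℂ)) s :=
    (differentiableAt_id.const_cpow (Or.inl hn')).mul_const _
  have hd2 : DifferentiableAt ℂ (fun z : ℂ => ∏ k ∈ Finset.range (n + 1), (z + k)) s := by
    fun_prop
  have hne1 : (n : ℂ) ^ s * (n.factorial : ℂ) ≠ 0 :=
    mul_ne_zero (by simp [cpow_eq_zero_iff, hn']) (by exact_mod_cast n.factorial_ne_zero)
  unfold GammaSeq
  refine ⟨hd1.div hd2 hprod, ?_⟩
  rw [logDeriv_div s hne1 hprod hd1 hd2]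
  congr 1
  · have hd : HasDerivAt (fun z : ℂ => (n : ℂ) ^ z * (n.factorial : ℂ))
        ((n : ℂ) ^ s * log n * n.factorial) s := by
      simpa using ((hasDerivAt_id s).const_cpow (Or.inl hn')).mul_const (n.factorial : ℂ)
    rw [logDeriv_apply, hd.deriv]
    have h1 : (n : ℂ) ^ s ≠ 0 := (mul_ne_zero_iff.1 hne1).1
    have h2 : (n.factorial : ℂ) ≠ 0 := (mul_ne_zero_iff.1 hne1).2
    field_simp
  · rw [logDeriv_prod (fun k _ => add_natCast_ne_zero_of_re_pos hs k) (fun k _ => by fun_prop)]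
    refine Finset.sum_congr rfl fun k _ => ?_
    simp [logDeriv_apply]

/-- Uniform convergence of analytic functions passes to logarithmic derivatives. -/
theorem tendsto_digamma {s : ℂ} (h1 : 1 / 2 < s.re) (h2 : s.re < 3 / 2) :
    Tendsto (fun n : ℕ => log n - ∑ k ∈ Finset.range (n + 1), 1 / (s + k)) atTop
      (𝓝 (digamma s)) := by
  have hopen : IsOpen {s : ℂ | 1 / 2 < s.re ∧ s.re < 3 / 2} :=
    (isOpen_lt continuous_const continuous_re).inter (isOpen_lt continuous_re continuous_const)
  have h := logDeriv_tendsto hopen (x := s) ⟨h1, h2⟩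
    tendstoUniformlyOn_GammaSeq.tendstoLocallyUniformlyOn (by
      filter_upwards [eventually_ne_atTop 0] with n hn z hz
      have hz1 : 1 / 2 < z.re := hz.1
      exact (hasDerivAt_GammaSeq_aux (by linarith) hn).1.differentiableWithinAt)
    (Gamma_ne_zero_of_re_pos (by linarith))
  rw [digamma_def]
  refine h.congr' ?_
  filter_upwards [eventually_ne_atTop 0] with n hn
  exact (hasDerivAt_GammaSeq_aux (by linarith) hn).2

/-- Mean value inequality along the segment from z to z+1: the derivative 1/(z+u) - 1/z has modulus
at most u/|z|². -/
theorem norm_log_add_one_sub_log_sub_le {z : ℂ} (hz : 0 < z.re) :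
    ‖log (z + 1) - log z - 1 / z‖ ≤ 1 / ‖z‖ ^ 2 := by
  have hz0 : z ≠ 0 := fun h => by simp [h] at hz
  have hpos : 0 < ‖z‖ := norm_pos_iff.2 hz0
  have hder : ∀ u ∈ Icc (0 : ℝ) 1, HasDerivWithinAt (fun u : ℝ => log (z + u) - u / z)
      (1 / (z + u) - 1 / z) (Icc 0 1) u := by
    intro u hu
    have hre : 0 < (z + u).re := by simp; linarith [hu.1]
    have h1 : HasDerivAt (fun u : ℝ => z + (u : ℂ)) 1 u := by
      simpa using (ofRealCLM.hasDerivAt (x := u)).const_add z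
    have h2 := h1.clog_real (Or.inl hre)
    have h3 : HasDerivAt (fun u : ℝ => (u : ℂ) / z) (1 / z) u := by
      simpa using (ofRealCLM.hasDerivAt (x := u)).div_const z
    exact (h2.sub h3).hasDerivWithinAt
  have hb : ∀ u ∈ Ico (0 : ℝ) 1, ‖1 / (z + u) - 1 / z‖ ≤ 1 / ‖z‖ ^ 2 := by
    intro u hu
    have hre : 0 < (z + u).re := by simp; linarith [hu.1]
    have hne : z + u ≠ 0 := fun h => by simp [h] at hre
    have e : 1 / (z + u) - 1 / z = -(u : ℂ) / ((z + u) * z) := by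
      field_simp
      ring
    have hle : ‖z‖ ≤ ‖z + u‖ := by
      rw [← sq_le_sq₀ (norm_nonneg _) (norm_nonneg _), Complex.sq_norm, Complex.sq_norm,
        normSq_apply, normSq_apply]
      simp
      nlinarith [hu.1]
    rw [e, norm_div, norm_neg, norm_mul, norm_real, Real.norm_of_nonneg hu.1]
    rw [pow_two]
    gcongr
    exact hu.2.le
  have := norm_image_sub_le_of_norm_deriv_le_segment_01' hder hb
  simp only [ofReal_one, ofReal_zero, add_zero, zero_div, sub_zero] at this
  rwa [sub_right_comm] at this

theorem sum_one_div_sq_add_sq_le (y : ℝ) (n : ℕ) :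
    ∑ k ∈ Finset.range n, 1 / (((k : ℝ) + 1) ^ 2 + y ^ 2) ≤ 4 / (1 + |y|) := by
  have hy := abs_nonneg y
  -- With x = k+1+|y| the left side is at most 2/x², which is at most 2/(x²-1/4), a telescoping
  -- difference.
  have hterm : ∀ k : ℕ, 1 / (((k : ℝ) + 1) ^ 2 + y ^ 2) ≤
      2 / (k + 1 / 2 + |y|) - 2 / ((k + 1 : ℕ) + 1 / 2 + |y|) := by
    intro k
    have hk : (0 : ℝ) ≤ k := k.cast_nonneg
    push_cast
    rw [div_sub_div _ _ (by positivity) (by positivity), div_le_div_iff₀ (by positivity)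
      (by positivity), ← sq_abs y]
    nlinarith [sq_nonneg ((k : ℝ) + 1 - |y|)]
  refine (Finset.sum_le_sum fun k _ => hterm k).trans ?_
  rw [Finset.sum_range_sub' (fun k : ℕ => 2 / ((k : ℝ) + 1 / 2 + |y|))]
  have h1 : (0 : ℝ) ≤ 2 / ((n : ℝ) + 1 / 2 + |y|) := by positivity
  have h2 : 2 / (((0 : ℕ) : ℝ) + 1 / 2 + |y|) ≤ 4 / (1 + |y|) := by
    rw [div_le_div_iff₀ (by push_cast; linarith) (by positivity)]
    push_cast
    nlinarith
  linarith

/-- The logarithm is written as a telescoping sum matching Euler's limit for the digamma function,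
leaving summands bounded by 1/|s+k|². Real part 1 suffices, as the argument s/2 is needed only for
Re s = 2. -/
theorem norm_digamma_sub_log_le (y : ℝ) :
    ‖digamma (1 + y * I) - log (1 + y * I)‖ ≤ 4 / (1 + |y|) := by
  set s : ℂ := 1 + y * I with hs
  have hre : s.re = 1 := by simp [hs]
  have him : s.im = y := by simp [hs]
  have hlim := tendsto_digamma (s := s) (by rw [hre]; norm_num) (by rw [hre]; norm_num)
  have hlog : Tendsto (fun n : ℕ => log (s + (n + 1 : ℕ)) - log n) atTop (𝓝 0) := by
    have h1 : Tendsto (fun n : ℕ => 1 + (s + 1) / (n : ℂ)) atTop (𝓝 1) := by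
      have := (tendsto_const_div_atTop_nhds_zero_nat (𝕜 := ℂ) (s + 1)).const_add 1
      simpa using this
    have h2 := h1.clog (Or.inl (by simp))
    rw [log_one] at h2
    refine h2.congr' ?_
    filter_upwards [eventually_gt_atTop 0] with n hn
    have hn' : (0 : ℝ) < n := by exact_mod_cast hn
    have hn0 : (n : ℂ) ≠ 0 := by exact_mod_cast hn.ne'
    have hne : 1 + (s + 1) / (n : ℂ) ≠ 0 := by
      intro h
      have e : (n : ℂ) * (1 + (s + 1) / (n : ℂ)) = s + (n + 1 : ℕ) := by
        push_cast; field_simp; ring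
      rw [h, mul_zero] at e
      exact add_natCast_ne_zero_of_re_pos (by rw [hre]; norm_num) (n + 1) e.symm
    have e : s + (n + 1 : ℕ) = ((n : ℝ) : ℂ) * (1 + (s + 1) / (n : ℂ)) := by
      push_cast; field_simp; ring
    rw [e, log_ofReal_mul hn' hne, natCast_log]
    simp
  have hlim2 := (hlim.add hlog).sub_const (log s)
  rw [add_zero] at hlim2
  refine le_of_tendsto hlim2.norm (Eventually.of_forall fun n => ?_)
  have e : log n - ∑ k ∈ Finset.range (n + 1), 1 / (s + k) + (log (s + (n + 1 : ℕ)) - log n)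
      - log s = ∑ k ∈ Finset.range (n + 1), (log (s + k + 1) - log (s + k) - 1 / (s + k)) := by
    rw [Finset.sum_sub_distrib]
    have := Finset.sum_range_sub (fun k : ℕ => log (s + k)) (n + 1)
    simp only [Nat.cast_add, Nat.cast_one, ← add_assoc] at this
    rw [this]
    push_cast
    ring_nf
  rw [e]
  refine (norm_sum_le _ _).trans (le_trans (Finset.sum_le_sum fun k _ => ?_)
    (sum_one_div_sq_add_sq_le y (n + 1)))
  have hk : (0 : ℝ) ≤ k := k.cast_nonneg
  refine (norm_log_add_one_sub_log_sub_le (z := s + k) (by simp [hre]; linarith)).trans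
    (le_of_eq ?_)
  rw [Complex.sq_norm, normSq_apply]
  simp [hre, him]
  ring_nf

end Digamma

/-! ### ξ'/ξ on the line Re s = 2 -/

section LineTwo

open Complex

theorem logDeriv_xiFun_eq {s : ℂ} (hs : 1 < s.re) :
    logDeriv xiFun s = 1 / s - 1 / (1 - s) - log Real.pi / 2 + digamma (s / 2) / 2
      + logDeriv riemannZeta s := by
  have hs0 : 0 < s.re := by linarith
  have h0 : s ≠ 0 := fun h => by simp [h] at hs0
  have h1 : s ≠ 1 := fun h => by simp [h] at hs
  have h1' : 1 - s ≠ 0 := sub_ne_zero.2 (Ne.symm h1)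
  have hpi : (Real.pi : ℂ) ≠ 0 := by exact_mod_cast Real.pi_ne_zero
  have hopen : IsOpen {z : ℂ | 1 < z.re} := isOpen_lt continuous_const continuous_re
  have heq : xiFun =ᶠ[𝓝 s] fun z => z * (1 - z) * ((Real.pi : ℂ) ^ (-z / 2) * Gamma (z / 2))
      * riemannZeta z := by
    filter_upwards [hopen.mem_nhds hs] with z hz
    have hz1 : 1 < z.re := hz
    rw [xiFun_eq_of_re_pos (by linarith) (fun h => by simp [h] at hz1), Gammaℝ_def]
  have hre2 : 0 < (s / 2).re := by simp; linarith
  have hG : Gamma (s / 2) ≠ 0 := Gamma_ne_zero_of_re_pos hre2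
  have hGd : DifferentiableAt ℂ Gamma (s / 2) := by
    refine differentiableAt_Gamma _ fun m h => ?_
    rw [h] at hre2
    simp at hre2
    have : (0 : ℝ) ≤ m := m.cast_nonneg
    linarith
  have hdG : DifferentiableAt ℂ (fun z : ℂ => Gamma (z / 2)) s :=
    DifferentiableAt.comp s hGd (by fun_prop)
  have hdp : HasDerivAt (fun z : ℂ => (Real.pi : ℂ) ^ (-z / 2))
      ((Real.pi : ℂ) ^ (-s / 2) * log Real.pi * (-1 / 2)) s :=
    ((hasDerivAt_id s).neg.div_const 2).const_cpow (Or.inl hpi)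
  have hp0 : (Real.pi : ℂ) ^ (-s / 2) ≠ 0 := by simp [cpow_eq_zero_iff, hpi]
  have hz : riemannZeta s ≠ 0 := riemannZeta_ne_zero_of_one_le_re hs.le
  have hzd : DifferentiableAt ℂ riemannZeta s := differentiableAt_riemannZeta h1
  have e1 : logDeriv xiFun s = logDeriv (fun z => z * (1 - z) * ((Real.pi : ℂ) ^ (-z / 2)
      * Gamma (z / 2)) * riemannZeta z) s := by
    rw [logDeriv_apply, logDeriv_apply, heq.deriv_eq, heq.eq_of_nhds]
  have hdpG : DifferentiableAt ℂ (fun z : ℂ => (Real.pi : ℂ) ^ (-z / 2) * Gamma (z / 2)) s :=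
    hdp.differentiableAt.mul hdG
  have hdq : DifferentiableAt ℂ (fun z : ℂ => z * (1 - z)) s := by fun_prop
  have hq0 : s * (1 - s) ≠ 0 := mul_ne_zero h0 h1'
  have hpG0 : (Real.pi : ℂ) ^ (-s / 2) * Gamma (s / 2) ≠ 0 := mul_ne_zero hp0 hG
  rw [e1, logDeriv_mul (f := fun z : ℂ => z * (1 - z) * ((Real.pi : ℂ) ^ (-z / 2)
      * Gamma (z / 2))) s (mul_ne_zero hq0 hpG0) hz (hdq.mul hdpG) hzd,
    logDeriv_mul (f := fun z : ℂ => z * (1 - z)) s hq0 hpG0 hdq hdpG,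
    logDeriv_mul (f := fun z : ℂ => z) (g := fun z : ℂ => 1 - z) s h0 h1' (by fun_prop)
      (by fun_prop),
    logDeriv_mul (f := fun z : ℂ => (Real.pi : ℂ) ^ (-z / 2)) s hp0 hG hdp.differentiableAt hdG]
  have e2 : logDeriv (fun z : ℂ => 1 - z) s = -(1 / (1 - s)) := by
    rw [logDeriv_apply]; simp [neg_div]
  have e3 : logDeriv (fun z : ℂ => (Real.pi : ℂ) ^ (-z / 2)) s = -(log Real.pi / 2) := by
    rw [logDeriv_apply, hdp.deriv]; field_simp
  have e4 : logDeriv (fun z : ℂ => Gamma (z / 2)) s = digamma (s / 2) / 2 := by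
    have := logDeriv_comp (f := Gamma) (g := fun z : ℂ => z / 2) (x := s) hGd (by fun_prop)
    have hd : deriv (fun z : ℂ => z / 2) s = 1 / 2 := by simp
    rw [hd] at this
    rw [digamma_def]
    simp only [Function.comp_def] at this
    rw [this]
    ring
  have e5 : logDeriv (fun z : ℂ => z) s = 1 / s := by
    rw [logDeriv_apply]; simp
  rw [e2, e3, e4, e5]
  ring

theorem one_add_abs_le_two_mul_norm {σ t : ℝ} (hσ : 1 ≤ σ) : 1 + |t| ≤ 2 * ‖(σ : ℂ) + t * I‖ := by
  have h1 := abs_re_le_norm ((σ : ℂ) + t * I)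
  have h2 := abs_im_le_norm ((σ : ℂ) + t * I)
  simp at h1 h2
  rw [abs_of_pos (by linarith)] at h1
  linarith

/-- Stirling's formula for `ξ'/ξ` on the line `re s = 2`. -/
theorem norm_logDeriv_xiFun_two_sub_le (t : ℝ) :
    ‖logDeriv xiFun (2 + t * I) - (log (1 + (t / 2 : ℝ) * I) / 2 - log Real.pi / 2
      + logDeriv riemannZeta (2 + t * I))‖ ≤ 8 / (1 + |t|) := by
  set s : ℂ := 2 + t * I with hs
  have hre : s.re = 2 := by simp [hs]
  have ht := abs_nonneg t
  have h := norm_digamma_sub_log_le (t / 2)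
  have hs2 : s / 2 = 1 + (t / 2 : ℝ) * I := by rw [hs]; push_cast; ring
  rw [logDeriv_xiFun_eq (by rw [hre]; norm_num), hs2]
  have e : 1 / s - 1 / (1 - s) - log Real.pi / 2 + digamma (1 + (t / 2 : ℝ) * I) / 2
      + logDeriv riemannZeta s - (log (1 + (t / 2 : ℝ) * I) / 2 - log Real.pi / 2
      + logDeriv riemannZeta s) = 1 / s - 1 / (1 - s)
      + (digamma (1 + (t / 2 : ℝ) * I) - log (1 + (t / 2 : ℝ) * I)) / 2 := by ring
  rw [e]
  have n1 : ‖1 / s‖ ≤ 2 / (1 + |t|) := by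
    have := one_add_abs_le_two_mul_norm (σ := 2) (t := t) (by norm_num)
    push_cast at this
    rw [norm_div, norm_one, div_le_div_iff₀ (by linarith) (by linarith)]
    linarith
  have n2 : ‖1 / (1 - s)‖ ≤ 2 / (1 + |t|) := by
    have := one_add_abs_le_two_mul_norm (σ := 1) (t := t) (by norm_num)
    have e2 : 1 - s = -(((1 : ℝ) : ℂ) + t * I) := by rw [hs]; push_cast; ring
    rw [e2, norm_div, norm_one, norm_neg, div_le_div_iff₀ (by linarith) (by linarith)]
    linarith
  have n3 : ‖(digamma (1 + (t / 2 : ℝ) * I) - log (1 + (t / 2 : ℝ) * I)) / 2‖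
      ≤ 4 / (1 + |t|) := by
    rw [norm_div, show ‖(2 : ℂ)‖ = 2 by simp]
    have h3 : 4 / (1 + |t / 2|) ≤ 8 / (1 + |t|) := by
      rw [div_le_div_iff₀ (by positivity) (by positivity), abs_div, abs_two]
      linarith
    have h4 : 8 / (1 + |t|) = 2 * (4 / (1 + |t|)) := by ring
    linarith
  have n4 : 8 / (1 + |t|) = 2 / (1 + |t|) + 2 / (1 + |t|) + 4 / (1 + |t|) := by ring
  rw [n4]
  exact (norm_add_le _ _).trans (add_le_add ((norm_sub_le _ _).trans (add_le_add n1 n2)) n3)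

/-- The von Mangoldt series converges absolutely at 2, and its terms depend on t only through a
unimodular factor. -/
theorem exists_norm_logDeriv_riemannZeta_two_le :
    ∃ B : ℝ, ∀ t : ℝ, ‖logDeriv riemannZeta (2 + t * I)‖ ≤ B := by
  set f : ℕ → ℂ := fun n => (ArithmeticFunction.vonMangoldt n : ℂ)
  have hsum : LSeriesSummable f (2 : ℂ) :=
    ArithmeticFunction.LSeriesSummable_vonMangoldt (by norm_num)
  refine ⟨∑' n, ‖LSeries.term f 2 n‖, fun t => ?_⟩
  have h := ArithmeticFunction.LSeries_vonMangoldt_eq_deriv_riemannZeta_div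
    (s := 2 + t * I) (by simp)
  rw [neg_div] at h
  rw [logDeriv_apply, ← norm_neg, ← h]
  refine tsum_of_norm_bounded hsum.norm.hasSum fun n => ?_
  exact LSeries.norm_term_le_of_re_le_re f (by simp) n

theorem riemannZeta_two_add_mem_slitPlane (t : ℝ) : riemannZeta (2 + t * I) ∈ slitPlane := by
  have h := norm_riemannZeta_sub_one_le (s := 2 + t * I) (by simp)
  have h2 : ‖riemannZeta (2 + t * I) - 1‖ < 1 := by
    have h5 := Real.pi_lt_d2
    nlinarith [Real.pi_gt_three]
  simpa using mem_slitPlane_of_norm_lt_one h2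

theorem two_add_mul_I_ne_one (t : ℝ) : (2 + t * I : ℂ) ≠ 1 := fun h => by
  have := congrArg Complex.re h
  simp at this

theorem hasDerivAt_log_riemannZeta_two (t : ℝ) :
    HasDerivAt (fun t : ℝ => log (riemannZeta (2 + t * I)))
      (I * logDeriv riemannZeta (2 + t * I)) t := by
  have hl : HasDerivAt (fun t : ℝ => (2 + t * I : ℂ)) I t := by
    simpa using ((ofRealCLM.hasDerivAt (x := t)).mul_const I).const_add 2
  have h1 := (differentiableAt_riemannZeta (two_add_mul_I_ne_one t)).hasDerivAt.comp t hl
  convert! h1.clog_real (riemannZeta_two_add_mem_slitPlane t) using 1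
  simp only [logDeriv_apply, Function.comp]
  ring

theorem continuous_logDeriv_riemannZeta_two :
    Continuous (fun t : ℝ => logDeriv riemannZeta (2 + t * I)) := by
  rw [continuous_iff_continuousAt]
  intro t
  have han : AnalyticAt ℂ riemannZeta (2 + t * I) :=
    analyticOn_riemannZeta _ (two_add_mul_I_ne_one t)
  have h1 : ContinuousAt (logDeriv riemannZeta) (2 + t * I) :=
    han.deriv.continuousAt.div han.continuousAt (riemannZeta_ne_zero_of_one_le_re (by simp))
  exact ContinuousAt.comp (f := fun t : ℝ => (2 + t * I : ℂ)) h1 (by fun_prop)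

/-- The integrand has the primitive arg ζ(2+it), which is bounded by π because ζ(2+it) stays in the
slit plane. -/
theorem abs_integral_re_logDeriv_riemannZeta_two_le (T : ℝ) :
    |∫ t in (0 : ℝ)..T, (logDeriv riemannZeta (2 + t * I)).re| ≤ 2 * Real.pi := by
  have hint : IntervalIntegrable (fun t : ℝ => I * logDeriv riemannZeta (2 + t * I))
      MeasureTheory.volume 0 T :=
    (continuous_const.mul continuous_logDeriv_riemannZeta_two).intervalIntegrable _ _
  have h1 := intervalIntegral.integral_eq_sub_of_hasDerivAt
    (fun t _ => hasDerivAt_log_riemannZeta_two t) hint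
  have h2 := imCLM.intervalIntegral_comp_comm hint
  simp only [imCLM_apply, mul_im, I_re, I_im, zero_mul, one_mul, zero_add] at h2
  rw [h2, h1, sub_im, log_im, log_im]
  have := abs_arg_le_pi (riemannZeta (2 + T * I))
  have := abs_arg_le_pi (riemannZeta (2 + (0 : ℝ) * I))
  exact (abs_sub _ _).trans (by linarith)

theorem continuous_logDeriv_xiFun_line (hRH : RiemannHypothesis) {σ : ℝ} (hσ : σ ≠ 1 / 2) :
    Continuous (fun t : ℝ => logDeriv xiFun (σ + t * I)) := by
  rw [continuous_iff_continuousAt]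
  intro t
  have han : AnalyticAt ℂ xiFun (σ + t * I) := differentiable_xiFun.analyticAt _
  have h1 : ContinuousAt (logDeriv xiFun) (σ + t * I) :=
    han.deriv.continuousAt.div han.continuousAt (xiFun_ne_zero_of_re_ne hRH (by simpa using hσ))
  exact ContinuousAt.comp (f := fun t : ℝ => (σ + t * I : ℂ)) h1 (by fun_prop)

theorem re_log_one_add_mul_I (y : ℝ) :
    (log (1 + y * I)).re = Real.log (1 + y ^ 2) / 2 := by
  rw [log_re]
  have h : ‖(1 + y * I : ℂ)‖ = Real.sqrt (1 + y ^ 2) := by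
    rw [Complex.norm_def, normSq_apply]
    congr 1
    simp
    ring
  rw [h, Real.log_sqrt (by positivity)]

theorem integral_log_one_add_sq (T : ℝ) :
    ∫ t in (0 : ℝ)..T, Real.log (1 + (t / 2) ^ 2) / 2
      = T * Real.log (1 + (T / 2) ^ 2) / 2 - T + 2 * Real.arctan (T / 2) := by
  have hder : ∀ t : ℝ, HasDerivAt
      (fun t : ℝ => t * Real.log (1 + (t / 2) ^ 2) / 2 - t + 2 * Real.arctan (t / 2))
      (Real.log (1 + (t / 2) ^ 2) / 2) t := by
    intro t
    have hpos : 0 < 1 + (t / 2) ^ 2 := by positivity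
    have h0 : HasDerivAt (fun t : ℝ => t / 2) (1 / 2) t := (hasDerivAt_id t).div_const 2
    have h1 : HasDerivAt (fun t : ℝ => 1 + (t / 2) ^ 2) (2 * (t / 2) * (1 / 2)) t := by
      simpa using (h0.pow 2).const_add 1
    have h2 := h1.log hpos.ne'
    have h3 := ((((hasDerivAt_id t).mul h2).div_const 2).sub (hasDerivAt_id t)).add
      (h0.arctan.const_mul 2)
    convert! h3 using 1
    simp only [id]
    field_simp
    ring
  rw [intervalIntegral.integral_eq_sub_of_hasDerivAt (fun t _ => hder t)]
  · simp
  · refine Continuous.intervalIntegrable ?_ _ _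
    exact (Continuous.log (by fun_prop) (fun t => by positivity)).div_const 2

theorem integral_one_div_one_add_abs {T : ℝ} (hT : 0 ≤ T) :
    ∫ t in (0 : ℝ)..T, 8 / (1 + |t|) = 8 * Real.log (1 + T) := by
  have hcont : Continuous (fun t : ℝ => 8 / (1 + |t|)) :=
    continuous_const.div (by fun_prop) (fun t => by positivity)
  have hder : ∀ t ∈ Set.uIcc 0 T, HasDerivAt (fun t : ℝ => 8 * Real.log (1 + t))
      (8 / (1 + |t|)) t := by
    intro t ht
    rw [Set.uIcc_of_le hT] at ht
    rw [abs_of_nonneg ht.1]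
    have h1 : HasDerivAt (fun t : ℝ => 1 + t) 1 t := (hasDerivAt_id t).const_add 1
    have := (h1.log (by linarith [ht.1])).const_mul 8
    convert! this using 1
    ring
  rw [intervalIntegral.integral_eq_sub_of_hasDerivAt hder (hcont.intervalIntegrable _ _)]
  simp

/-- `∫₀ᵀ re ξ'/ξ(2 + it) dt = (T log (T/2π) - T)/2 + O(log T)`. -/
theorem exists_abs_integral_re_logDeriv_xiFun_two_sub_le (hRH : RiemannHypothesis) :
    ∃ K : ℝ, 0 ≤ K ∧ ∀ T : ℝ, 3 ≤ T →
      |(∫ t in (0 : ℝ)..T, (logDeriv xiFun (2 + t * I)).re)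
        - (T * Real.log (T / (2 * Real.pi)) - T) / 2| ≤ K * Real.log T := by
  -- The three summands pay for the Stirling error 8 log(1+T) ≤ 16 log T, for the arctangent and the
  -- correction log(1+4/T²), and for the argument of ζ.
  refine ⟨8 * 2 + 3 + 2 * Real.pi, by positivity, fun T hT => ?_⟩
  have hT0 : 0 < T := by linarith
  have hlogT : 1 ≤ Real.log T := by
    rw [Real.le_log_iff_exp_le hT0]
    linarith [Real.exp_one_lt_d9]
  have hc1 : Continuous (fun t : ℝ => (logDeriv xiFun (2 + t * I)).re) := by
    have := continuous_logDeriv_xiFun_line hRH (σ := 2) (by norm_num)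
    push_cast at this
    exact continuous_re.comp this
  have hc2 : Continuous (fun t : ℝ => Real.log (1 + (t / 2) ^ 2) / 2) :=
    (Continuous.log (by fun_prop) (fun t => by positivity)).div_const 2
  have hc3 : Continuous (fun t : ℝ => (logDeriv riemannZeta (2 + t * I)).re) :=
    continuous_re.comp continuous_logDeriv_riemannZeta_two
  have hc4 : Continuous (fun t : ℝ => 8 / (1 + |t|)) :=
    continuous_const.div (by fun_prop) (fun t => by positivity)
  set E : ℝ → ℝ := fun t => (logDeriv xiFun (2 + t * I)).re
    - (Real.log (1 + (t / 2) ^ 2) / 2 / 2 - Real.log Real.pi / 2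
      + (logDeriv riemannZeta (2 + t * I)).re) with hE
  have hEb : ∀ t, |E t| ≤ 8 / (1 + |t|) := by
    intro t
    have h := (abs_re_le_norm _).trans (norm_logDeriv_xiFun_two_sub_le t)
    have e : (logDeriv xiFun (2 + t * I) - (log (1 + (t / 2 : ℝ) * I) / 2 - log Real.pi / 2
      + logDeriv riemannZeta (2 + t * I))).re = E t := by
      have e1 : ∀ z : ℂ, (z / 2).re = z.re / 2 := fun z => by simp
      rw [sub_re, add_re, sub_re, e1, e1, re_log_one_add_mul_I, log_ofReal_re]
    rwa [e] at h
  have hcE : Continuous E := by fun_prop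
  have hEint : |∫ t in (0 : ℝ)..T, E t| ≤ 8 * Real.log (1 + T) := by
    rw [← integral_one_div_one_add_abs hT0.le, ← Real.norm_eq_abs]
    refine intervalIntegral.norm_integral_le_of_norm_le hT0.le ?_ (hc4.intervalIntegrable _ _)
    exact Eventually.of_forall fun t _ => hEb t
  have hsplit : (∫ t in (0 : ℝ)..T, (logDeriv xiFun (2 + t * I)).re) =
      (∫ t in (0 : ℝ)..T, E t) + ((∫ t in (0 : ℝ)..T, Real.log (1 + (t / 2) ^ 2) / 2) / 2
        - T * (Real.log Real.pi / 2)
        + ∫ t in (0 : ℝ)..T, (logDeriv riemannZeta (2 + t * I)).re) := by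
    rw [← intervalIntegral.integral_div]
    have hconst : T * (Real.log Real.pi / 2) = ∫ _ in (0 : ℝ)..T, Real.log Real.pi / 2 := by
      simp
      ring
    have i1 : Continuous (fun t : ℝ => Real.log (1 + (t / 2) ^ 2) / 2 / 2) := hc2.div_const 2
    have i2 : Continuous (fun t : ℝ => Real.log (1 + (t / 2) ^ 2) / 2 / 2
      - Real.log Real.pi / 2) := i1.sub continuous_const
    have i3 : Continuous (fun t : ℝ => Real.log (1 + (t / 2) ^ 2) / 2 / 2
      - Real.log Real.pi / 2 + (logDeriv riemannZeta (2 + t * I)).re) := i2.add hc3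
    rw [hconst, ← intervalIntegral.integral_sub (i1.intervalIntegrable _ _) (by simp),
      ← intervalIntegral.integral_add (i2.intervalIntegrable _ _) (hc3.intervalIntegrable _ _),
      ← intervalIntegral.integral_add (hcE.intervalIntegrable _ _) (i3.intervalIntegrable _ _)]
    refine intervalIntegral.integral_congr fun t _ => ?_
    simp only [hE]
    ring
  rw [hsplit, integral_log_one_add_sq]
  have hz := abs_integral_re_logDeriv_riemannZeta_two_le T
  have hlog1 : Real.log (1 + T) ≤ 2 * Real.log T := by
    rw [← Real.log_rpow hT0]
    apply Real.log_le_log (by linarith)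
    norm_num
    nlinarith
  -- Isolates the main term 2 log(T/2); multiplied by T, the remaining logarithm is still at most
  -- 4/T.
  have hlog2 : Real.log (1 + (T / 2) ^ 2)
      = 2 * Real.log (T / 2) + Real.log (1 + 4 / T ^ 2) := by
    have : (1 : ℝ) + (T / 2) ^ 2 = (T / 2) ^ 2 * (1 + 4 / T ^ 2) := by
      field_simp
      ring
    rw [this, Real.log_mul (by positivity) (by positivity), Real.log_pow]
    norm_num
  have hlog3 : 0 ≤ Real.log (1 + 4 / T ^ 2) :=
    Real.log_nonneg (by linarith [show (0 : ℝ) < 4 / T ^ 2 by positivity])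
  have hlog4 : T * Real.log (1 + 4 / T ^ 2) ≤ 4 / T := by
    have h1 := Real.log_le_sub_one_of_pos (show 0 < 1 + 4 / T ^ 2 by positivity)
    calc T * Real.log (1 + 4 / T ^ 2) ≤ T * (4 / T ^ 2) := by gcongr; linarith
      _ = 4 / T := by field_simp
  have hlog4' : 4 / T ≤ 2 := by rw [div_le_iff₀ hT0]; linarith
  have hlog5 : Real.log (T / (2 * Real.pi)) = Real.log (T / 2) - Real.log Real.pi := by
    rw [← Real.log_div (by positivity) Real.pi_ne_zero, div_div]
  have harc1 := Real.arctan_lt_pi_div_two (T / 2)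
  have harc2 : 0 ≤ Real.arctan (T / 2) := Real.arctan_nonneg.2 (by positivity)
  have hTl : 0 ≤ T * Real.log (1 + 4 / T ^ 2) := by positivity
  rw [hlog2, hlog5]
  rw [abs_le] at *
  have hpi := Real.pi_lt_four
  have hpi0 := Real.pi_pos
  have hprod := mul_le_mul_of_nonneg_left hlogT (by positivity : 0 ≤ 2 * Real.pi)
  constructor <;> nlinarith

theorem exists_norm_logDeriv_xiFun_two_le :
    ∃ K : ℝ, 0 ≤ K ∧ ∀ t : ℝ, ‖logDeriv xiFun (2 + t * I)‖ ≤ K * Real.log (|t| + 2) := by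
  obtain ⟨B, hB⟩ := exists_norm_logDeriv_riemannZeta_two_le
  have hB0 : 0 ≤ B := (norm_nonneg _).trans (hB 0)
  have hl2 : 0 < Real.log 2 := Real.log_pos (by norm_num)
  have hlpi : 0 ≤ Real.log Real.pi := Real.log_nonneg (by linarith [Real.pi_gt_three])
  refine ⟨1 + (8 + Real.pi + Real.log Real.pi + B) / Real.log 2, by positivity, fun t => ?_⟩
  have ht := abs_nonneg t
  have hlog2 : Real.log 2 ≤ Real.log (|t| + 2) := Real.log_le_log (by norm_num) (by linarith)
  have h := norm_logDeriv_xiFun_two_sub_le t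
  have h8 : 8 / (1 + |t|) ≤ 8 := by
    rw [div_le_iff₀ (by linarith)]; linarith
  have hlog : ‖log (1 + (t / 2 : ℝ) * I)‖ ≤ Real.log (|t| + 2) + Real.pi := by
    refine (norm_le_abs_re_add_abs_im _).trans (add_le_add ?_ ?_)
    · rw [re_log_one_add_mul_I, abs_of_nonneg (by
        have := Real.log_nonneg (show 1 ≤ 1 + (t / 2) ^ 2 by nlinarith [sq_nonneg (t / 2)])
        linarith)]
      rw [div_le_iff₀ (by norm_num), mul_comm, ← Real.log_rpow (by linarith)]
      apply Real.log_le_log (by positivity)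
      norm_num
      rw [div_pow, ← sq_abs]
      nlinarith
    · rw [log_im]; exact abs_arg_le_pi _
  have hlogpi : ‖log (Real.pi : ℂ)‖ = Real.log Real.pi := by
    rw [← ofReal_log Real.pi_pos.le, norm_real, Real.norm_of_nonneg hlpi]
  set A : ℂ := log (1 + (t / 2 : ℝ) * I) / 2 - log Real.pi / 2 + logDeriv riemannZeta (2 + t * I)
  have hA : ‖A‖ ≤ (Real.log (|t| + 2) + Real.pi) + Real.log Real.pi + B := by
    refine (norm_add_le _ _).trans (add_le_add ((norm_sub_le _ _).trans (add_le_add ?_ ?_)) (hB t))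
    · rw [norm_div, show ‖(2 : ℂ)‖ = 2 by simp]
      linarith [norm_nonneg (log (1 + (t / 2 : ℝ) * I))]
    · rw [norm_div, show ‖(2 : ℂ)‖ = 2 by simp, hlogpi]
      linarith
  have hX : ‖logDeriv xiFun (2 + t * I)‖ ≤ 8 + ‖A‖ := by
    have := norm_add_le (logDeriv xiFun (2 + t * I) - A) A
    rw [sub_add_cancel] at this
    linarith
  have hc : 8 + Real.pi + Real.log Real.pi + B
      ≤ (8 + Real.pi + Real.log Real.pi + B) / Real.log 2 * Real.log (|t| + 2) := by
    rw [div_mul_eq_mul_div, le_div_iff₀ hl2]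
    exact mul_le_mul_of_nonneg_left hlog2 (by positivity)
  linarith

end LineTwo

/-! ### Pointwise bounds and the first moment -/

section SigmaSum

open Complex

theorem sigmaSum_nonneg (a t : ℝ) : 0 ≤ sigmaSum a t := tsum_nonneg fun j => by positivity

theorem sigmaSum_anti (hRH : RiemannHypothesis) {a b : ℝ} (ha : 0 < a) (hab : a ≤ b) (t : ℝ) :
    sigmaSum b t ≤ sigmaSum a t := by
  refine Summable.tsum_le_tsum (fun j => ?_) (summable_one_div_sq_add_sq hRH (ha.trans_le hab) t)
    (summable_one_div_sq_add_sq hRH ha t)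
  gcongr

/-- For each zero (b²+u²)/(a²+u²) is at most (b/a)², with equality at u = 0. -/
theorem sigmaSum_le_mul (hRH : RiemannHypothesis) {a b : ℝ} (ha : 0 < a) (hab : a ≤ b) (t : ℝ) :
    sigmaSum a t ≤ (b / a) ^ 2 * sigmaSum b t := by
  have hb : 0 < b := ha.trans_le hab
  unfold sigmaSum
  rw [← tsum_mul_left]
  refine Summable.tsum_le_tsum (fun j => ?_) (summable_one_div_sq_add_sq hRH ha t)
    ((summable_one_div_sq_add_sq hRH hb t).mul_left _)
  rw [div_pow, div_mul_div_comm, mul_one, div_le_div_iff₀ (by positivity) (by positivity)]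
  nlinarith [mul_le_mul_of_nonneg_right (pow_le_pow_left₀ ha.le hab 2)
    (sq_nonneg (t - j.ordinate))]

theorem continuous_sigmaSum (hRH : RiemannHypothesis) {a : ℝ} (ha : 0 < a) :
    Continuous (sigmaSum a) := by
  have h : sigmaSum a = fun t : ℝ => (logDeriv xiFun ((1 / 2 + a : ℝ) + t * I)).re / a :=
    funext fun t => sigmaSum_eq hRH ha t
  rw [h]
  exact (continuous_re.comp (continuous_logDeriv_xiFun_line hRH (by linarith))).div_const a

/-- The value 3/2 places the abscissa 1/2+a on the line Re s = 2, where ξ'/ξ is O(log). It serves as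
reference for all other a. -/
theorem exists_sigmaSum_three_halves_le (hRH : RiemannHypothesis) :
    ∃ K : ℝ, 0 < K ∧ ∀ t : ℝ, sigmaSum (3 / 2) t ≤ K * Real.log (|t| + 2) := by
  obtain ⟨K, hK0, hK⟩ := exists_norm_logDeriv_xiFun_two_le
  refine ⟨K + 1, by linarith, fun t => ?_⟩
  rw [sigmaSum_eq hRH (by norm_num)]
  have e : (((1 / 2 + 3 / 2 : ℝ) : ℂ) + t * I) = 2 + t * I := by norm_num
  rw [e]
  have h1 := (le_abs_self _).trans ((abs_re_le_norm _).trans (hK t))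
  have h2 : 0 ≤ Real.log (|t| + 2) := Real.log_nonneg (by linarith [abs_nonneg t])
  rw [div_le_iff₀ (by norm_num)]
  nlinarith

/-- A pointwise bound for `Σ_a`, uniform for bounded `a`. -/
theorem exists_sigmaSum_le (hRH : RiemannHypothesis) (A : ℝ) :
    ∃ K : ℝ, 0 < K ∧ ∀ a : ℝ, 0 < a → a ≤ A → ∀ t : ℝ,
      sigmaSum a t ≤ K * (Real.log (|t| + 2) / a ^ 2) := by
  obtain ⟨K, hK0, hK⟩ := exists_sigmaSum_three_halves_le hRH
  refine ⟨K * (9 / 4 + A ^ 2), by positivity, fun a ha haA t => ?_⟩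
  have hl : 0 ≤ Real.log (|t| + 2) := Real.log_nonneg (by linarith [abs_nonneg t])
  rw [← mul_div_assoc, le_div_iff₀ (by positivity)]
  rcases le_total a (3 / 2) with h | h
  · have h1 := sigmaSum_le_mul hRH ha h t
    have h2 : sigmaSum a t * a ^ 2 ≤ 9 / 4 * sigmaSum (3 / 2) t := by
      calc sigmaSum a t * a ^ 2 ≤ (3 / 2 / a) ^ 2 * sigmaSum (3 / 2) t * a ^ 2 := by gcongr
        _ = 9 / 4 * sigmaSum (3 / 2) t := by field_simp; ring
    have h3 : 0 ≤ K * A ^ 2 * Real.log (|t| + 2) := by positivity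
    have := hK t
    nlinarith
  · have h1 := (sigmaSum_anti hRH (by norm_num) h t).trans (hK t)
    have h2 : a ^ 2 ≤ A ^ 2 := by gcongr
    have h3 : 0 ≤ K * Real.log (|t| + 2) := by positivity
    calc sigmaSum a t * a ^ 2 ≤ K * Real.log (|t| + 2) * A ^ 2 := by gcongr
      _ ≤ _ := by nlinarith

/-- The integrand is an arctangent derivative, so the bound does not depend on how close a zero lies
to the horizontal path. -/
theorem integral_abs_div_sq_add_sq_le (u σ₁ σ₂ : ℝ) :
    ∫ x in σ₁..σ₂, |u| / ((x - 1 / 2) ^ 2 + u ^ 2) ≤ Real.pi := by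
  by_cases hu : u = 0
  · simp [hu, Real.pi_pos.le]
  have hu' : 0 < |u| := abs_pos.2 hu
  have hder : ∀ x : ℝ, HasDerivAt (fun x : ℝ => Real.arctan ((x - 1 / 2) / |u|))
      (|u| / ((x - 1 / 2) ^ 2 + u ^ 2)) x := by
    intro x
    have h1 : HasDerivAt (fun x : ℝ => (x - 1 / 2) / |u|) (1 / |u|) x :=
      ((hasDerivAt_id x).sub_const _).div_const _
    convert! h1.arctan using 1
    rw [← sq_abs u]
    field_simp
    ring
  rw [intervalIntegral.integral_eq_sub_of_hasDerivAt (fun x _ => hder x)]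
  · have := Real.arctan_lt_pi_div_two ((σ₂ - 1 / 2) / |u|)
    have := Real.neg_pi_div_two_lt_arctan ((σ₁ - 1 / 2) / |u|)
    linarith
  · refine Continuous.intervalIntegrable ?_ _ _
    exact continuous_const.div (by fun_prop) fun x => by positivity

theorem im_logDeriv_xiFun_ofReal (x : ℝ) : (logDeriv xiFun x).im = 0 := by
  have := logDeriv_xiFun_conj x
  rw [conj_ofReal] at this
  exact conj_eq_iff_im.1 this.symm

/-- The zeros within distance one of height `T`. -/
noncomputable def zerosNear (T : ℝ) : Finset ZetaZeroIndex :=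
  ((ZetaZeroIndex.finite_abs_ordinate_le (|T| + 1)).subset
    (fun j (hj : |T - j.ordinate| < 1) => by
      have := abs_sub_abs_le_abs_sub j.ordinate T
      rw [abs_sub_comm] at this
      show |j.ordinate| ≤ |T| + 1
      linarith) : {j : ZetaZeroIndex | |T - j.ordinate| < 1}.Finite).toFinset

theorem mem_zerosNear {T : ℝ} {j : ZetaZeroIndex} : j ∈ zerosNear T ↔ |T - j.ordinate| < 1 := by
  simp [zerosNear]

/-- A zero within distance one of T contributes at least 1/(9/4+1) ≥ 1/4 to Σ_{3/2}(T). -/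
theorem card_zerosNear_le (hRH : RiemannHypothesis) (T : ℝ) :
    ((zerosNear T).card : ℝ) ≤ 4 * sigmaSum (3 / 2) T := by
  have h1 : ∑ j ∈ zerosNear T, 1 / ((3 / 2 : ℝ) ^ 2 + (T - j.ordinate) ^ 2)
      ≤ sigmaSum (3 / 2) T :=
    (summable_one_div_sq_add_sq hRH (by norm_num) T).sum_le_tsum _ (fun j _ => by positivity)
  have h2 : ∑ _j ∈ zerosNear T, (1 / 4 : ℝ)
      ≤ ∑ j ∈ zerosNear T, 1 / ((3 / 2 : ℝ) ^ 2 + (T - j.ordinate) ^ 2) := by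
    refine Finset.sum_le_sum fun j hj => ?_
    have h3 := mem_zerosNear.1 hj
    have h4 : (T - j.ordinate) ^ 2 ≤ 1 := (sq_le_one_iff_abs_le_one _).2 h3.le
    gcongr
    linarith
  rw [Finset.sum_const, nsmul_eq_mul] at h2
  linarith

/-- ξ'/ξ is compared with its value on Re s = 2. A zero at distance at least 1 from height T
contributes at most (3/2)·2·(13/4) ≤ 10 times its term in Σ_{3/2}(T). Nearby zeros keep their
explicit imaginary part, to be integrated later, plus 1 for the term at Re s = 2. -/
theorem abs_im_logDeriv_xiFun_le (hRH : RiemannHypothesis) {x T : ℝ} (hx : 1 / 2 < x)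
    (hx2 : x ≤ 2) :
    |(logDeriv xiFun (x + T * I)).im| ≤ ‖logDeriv xiFun (2 + T * I)‖
      + (10 * sigmaSum (3 / 2) T + ∑ j ∈ zerosNear T,
        (|T - j.ordinate| / ((x - 1 / 2) ^ 2 + (T - j.ordinate) ^ 2) + 1)) := by
  set s : ℂ := x + T * I with hs
  set w : ℂ := 2 + T * I with hw
  have hsre : s.re = x := by simp [hs]
  have hsim : s.im = T := by simp [hs]
  have hwre : w.re = 2 := by simp [hw]
  have hwim : w.im = T := by simp [hw]
  have hsum := hasSum_logDeriv_xiFun_sub hRH (s := s) (w := w) (by rw [hsre]; exact hx)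
    (by rw [hwre]; norm_num)
  have hsumim := imCLM.hasSum hsum
  classical
  have hb1 := ((summable_one_div_sq_add_sq hRH (a := 3 / 2) (by norm_num) T).hasSum).mul_left 10
  have hb2 : HasSum (fun j : ZetaZeroIndex => if j ∈ zerosNear T then
      (|T - j.ordinate| / ((x - 1 / 2) ^ 2 + (T - j.ordinate) ^ 2) + 1) else 0)
      (∑ j ∈ zerosNear T,
        (|T - j.ordinate| / ((x - 1 / 2) ^ 2 + (T - j.ordinate) ^ 2) + 1)) := by
    have : HasSum (fun j : ZetaZeroIndex => if j ∈ zerosNear T then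
        (|T - j.ordinate| / ((x - 1 / 2) ^ 2 + (T - j.ordinate) ^ 2) + 1) else 0) _ :=
      hasSum_sum_of_ne_finset_zero (s := zerosNear T) (fun j hj => if_neg hj)
    rwa [Finset.sum_ite_mem, Finset.inter_self] at this
  have hbound := tsum_of_norm_bounded (hb1.add hb2) (f := fun j : ZetaZeroIndex =>
    imCLM (1 / (s - j.point) - 1 / (w - j.point))) (fun j => ?_)
  · rw [hsumim.tsum_eq, imCLM_apply, sub_im, Real.norm_eq_abs] at hbound
    have h1 := abs_im_le_norm (logDeriv xiFun w)
    have h2 := abs_add_le ((logDeriv xiFun s).im - (logDeriv xiFun w).im) (logDeriv xiFun w).im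
    rw [sub_add_cancel] at h2
    have h3 : (∑' j : ZetaZeroIndex, 1 / ((3 / 2 : ℝ) ^ 2 + (T - j.ordinate) ^ 2))
      = sigmaSum (3 / 2) T := rfl
    rw [h3] at hbound
    linarith
  · rw [imCLM_apply, Real.norm_eq_abs]
    have hsp : s ≠ j.point := fun h => by
      rw [h, j.point_re] at hsre; linarith
    have hwp : w ≠ j.point := fun h => by
      rw [h, j.point_re] at hwre; norm_num at hwre
    have n1 := normSq_sub_point s j
    have n2 := normSq_sub_point w j
    rw [hsre, hsim] at n1
    rw [hwre, hwim] at n2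
    by_cases hj : j ∈ zerosNear T
    · rw [if_pos hj]
      have e1 : |(1 / (s - j.point)).im|
          = |T - j.ordinate| / ((x - 1 / 2) ^ 2 + (T - j.ordinate) ^ 2) := by
        rw [one_div, inv_im, ← Complex.sq_norm, n1, sub_im, hsim, j.point_im, abs_div, abs_neg,
          abs_of_pos (show 0 < (x - 1 / 2) ^ 2 + (T - j.ordinate) ^ 2 by
            have : 0 < x - 1 / 2 := by linarith
            positivity)]
      have e2 : |(1 / (w - j.point)).im| ≤ 1 := by
        refine (abs_im_le_norm _).trans ?_
        rw [norm_div, norm_one]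
        have h1 : 1 ≤ ‖w - j.point‖ := by
          have := abs_re_le_norm (w - j.point)
          rw [sub_re, hwre, j.point_re] at this
          norm_num at this
          linarith
        exact (div_le_one (by linarith)).2 h1
      rw [sub_im]
      have := abs_sub (1 / (s - j.point)).im (1 / (w - j.point)).im
      have : 0 ≤ 10 * (1 / ((3 / 2 : ℝ) ^ 2 + (T - j.ordinate) ^ 2)) := by positivity
      linarith
    · rw [if_neg hj, add_zero]
      have hfar : 1 ≤ (T - j.ordinate) ^ 2 := by
        rw [mem_zerosNear, not_lt] at hj
        rw [← sq_abs]
        nlinarith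
      refine (abs_im_le_norm _).trans ((norm_one_div_sub_one_div_le hsp hwp).trans ?_)
      rw [n1, n2]
      have hsw : ‖s - w‖ ≤ 3 / 2 := by
        have : s - w = ((x - 2 : ℝ) : ℂ) := by rw [hs, hw]; push_cast; ring
        rw [this, norm_real, Real.norm_eq_abs, abs_le]
        constructor <;> linarith
      have hq : ∀ y : ℝ, 1 / ((y - 1 / 2) ^ 2 + (T - j.ordinate) ^ 2)
          ≤ 13 / 4 * (1 / ((3 / 2 : ℝ) ^ 2 + (T - j.ordinate) ^ 2)) := by
        intro y
        rw [mul_one_div, div_le_div_iff₀ (by positivity) (by positivity)]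
        nlinarith [sq_nonneg (y - 1 / 2)]
      have hpos : 0 ≤ 1 / ((3 / 2 : ℝ) ^ 2 + (T - j.ordinate) ^ 2) := by positivity
      calc ‖s - w‖ * (1 / ((x - 1 / 2) ^ 2 + (T - j.ordinate) ^ 2)
            + 1 / ((2 - 1 / 2) ^ 2 + (T - j.ordinate) ^ 2))
          ≤ 3 / 2 * (13 / 4 * (1 / ((3 / 2 : ℝ) ^ 2 + (T - j.ordinate) ^ 2))
            + 13 / 4 * (1 / ((3 / 2 : ℝ) ^ 2 + (T - j.ordinate) ^ 2))) := by
            gcongr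
            · exact hq x
            · exact hq 2
        _ ≤ _ := by linarith

theorem continuousOn_logDeriv_xiFun_horizontal (hRH : RiemannHypothesis) {σ₁ σ₂ : ℝ}
    (hσ : 1 / 2 < σ₁) (T : ℝ) :
    ContinuousOn (fun x : ℝ => logDeriv xiFun (x + T * I)) (Set.Icc σ₁ σ₂) := by
  intro x hx
  have han : AnalyticAt ℂ xiFun (x + T * I) := differentiable_xiFun.analyticAt _
  have h1 : ContinuousAt (logDeriv xiFun) (x + T * I) :=
    han.deriv.continuousAt.div han.continuousAt (xiFun_ne_zero_of_re_ne hRH (by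
      have := hx.1
      simp
      linarith))
  exact (ContinuousAt.comp (f := fun x : ℝ => (x + T * I : ℂ)) h1
    (by fun_prop)).continuousWithinAt

/-- Each nearby zero integrates to at most π+2 and there are O(log T) of them; the other terms are
O(log T) pointwise. Nothing degenerates as σ approaches 1/2. -/
theorem exists_abs_integral_im_logDeriv_xiFun_le (hRH : RiemannHypothesis) :
    ∃ K : ℝ, 0 ≤ K ∧ ∀ σ T : ℝ, 1 / 2 < σ → σ ≤ 2 → 3 ≤ T →
      |∫ x in σ..2, (logDeriv xiFun (x + T * I)).im| ≤ K * Real.log T := by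
  obtain ⟨K₁, hK₁, h₁⟩ := exists_norm_logDeriv_xiFun_two_le
  obtain ⟨K₂, hK₂, h₂⟩ := exists_sigmaSum_three_halves_le hRH
  refine ⟨2 * (2 * (K₁ + 10 * K₂) + 4 * K₂ * (Real.pi + 2)), by positivity,
    fun σ T hσ hσ2 hT => ?_⟩
  have hlog : Real.log (|T| + 2) ≤ 2 * Real.log T := by
    rw [abs_of_pos (by linarith), ← Real.log_rpow (by linarith)]
    apply Real.log_le_log (by linarith)
    norm_num
    nlinarith
  have hl0 : 0 ≤ Real.log (|T| + 2) := Real.log_nonneg (by linarith [abs_nonneg T])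
  set g : ZetaZeroIndex → ℝ → ℝ := fun j x =>
    |T - j.ordinate| / ((x - 1 / 2) ^ 2 + (T - j.ordinate) ^ 2) + 1 with hg
  have hgi : ∀ j, IntervalIntegrable (g j) MeasureTheory.volume σ 2 := by
    intro j
    refine ContinuousOn.intervalIntegrable ?_
    rw [Set.uIcc_of_le hσ2]
    refine (ContinuousOn.div continuousOn_const (by fun_prop) fun x hx => ?_).add continuousOn_const
    have : 0 < x - 1 / 2 := by linarith [hx.1]
    positivity
  have hgb : ∀ j, ∫ x in σ..2, g j x ≤ Real.pi + 2 := by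
    intro j
    have hi : IntervalIntegrable
        (fun x => |T - j.ordinate| / ((x - 1 / 2) ^ 2 + (T - j.ordinate) ^ 2))
        MeasureTheory.volume σ 2 := by
      simpa [hg] using (hgi j).sub (intervalIntegrable_const (c := (1 : ℝ)))
    rw [hg, intervalIntegral.integral_add hi (by simp)]
    have := integral_abs_div_sq_add_sq_le (T - j.ordinate) σ 2
    simp only [intervalIntegral.integral_const, smul_eq_mul, mul_one]
    linarith
  set Q : ℝ := ‖logDeriv xiFun (2 + T * I)‖ + 10 * sigmaSum (3 / 2) T with hQ
  have hQ0 : 0 ≤ Q := by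
    have := sigmaSum_nonneg (3 / 2) T
    positivity
  have hsumi : IntervalIntegrable (fun x => ∑ j ∈ zerosNear T, g j x)
      MeasureTheory.volume σ 2 := by
    have h : (fun x => ∑ j ∈ zerosNear T, g j x) = ∑ j ∈ zerosNear T, g j := by
      ext x
      simp
    rw [h]
    exact IntervalIntegrable.sum (zerosNear T) (fun j _ => hgi j)
  have hb : |∫ x in σ..2, (logDeriv xiFun (x + T * I)).im|
      ≤ ∫ x in σ..2, (Q + ∑ j ∈ zerosNear T, g j x) := by
    rw [← Real.norm_eq_abs]
    refine intervalIntegral.norm_integral_le_of_norm_le hσ2 ?_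
      ((intervalIntegrable_const (c := Q)).add hsumi)
    refine Eventually.of_forall fun x hx => ?_
    have := abs_im_logDeriv_xiFun_le hRH (T := T) (hσ.trans hx.1) hx.2
    rw [Real.norm_eq_abs]
    simp only [hg, hQ]
    linarith
  have hval : ∫ x in σ..2, (Q + ∑ j ∈ zerosNear T, g j x)
      = (2 - σ) * Q + ∑ j ∈ zerosNear T, ∫ x in σ..2, g j x := by
    rw [intervalIntegral.integral_add intervalIntegrable_const hsumi,
      intervalIntegral.integral_finsetSum (fun j _ => hgi j)]
    simp
  rw [hval] at hb
  have hc : ∑ j ∈ zerosNear T, ∫ x in σ..2, g j x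
      ≤ (4 * sigmaSum (3 / 2) T) * (Real.pi + 2) := by
    refine (Finset.sum_le_sum fun j _ => hgb j).trans ?_
    rw [Finset.sum_const, nsmul_eq_mul]
    exact mul_le_mul_of_nonneg_right (card_zerosNear_le hRH T) (by positivity)
  have hS := h₂ T
  have hX := h₁ T
  have hpi := Real.pi_pos
  calc _ ≤ 2 * Q + (4 * (K₂ * Real.log (|T| + 2))) * (Real.pi + 2) := by
        refine hb.trans (add_le_add ?_ (hc.trans ?_))
        · exact mul_le_mul_of_nonneg_right (by linarith) hQ0
        · gcongr
    _ ≤ 2 * (K₁ * Real.log (|T| + 2) + 10 * (K₂ * Real.log (|T| + 2)))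
        + (4 * (K₂ * Real.log (|T| + 2))) * (Real.pi + 2) := by
        gcongr
        rw [hQ]
        linarith
    _ = (2 * (K₁ + 10 * K₂) + 4 * K₂ * (Real.pi + 2)) * Real.log (|T| + 2) := by ring
    _ ≤ (2 * (K₁ + 10 * K₂) + 4 * K₂ * (Real.pi + 2)) * (2 * Real.log T) := by gcongr
    _ = _ := by ring

/-- Cauchy's theorem on a rectangle free of zeros by RH. The bottom side drops out because ξ'/ξ is
real on the real axis. -/
theorem integral_re_logDeriv_xiFun_eq (hRH : RiemannHypothesis) {σ T : ℝ} (hσ : 1 / 2 < σ)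
    (hσ2 : σ ≤ 2) :
    ∫ t in (0 : ℝ)..T, (logDeriv xiFun (σ + t * I)).re
      = (∫ t in (0 : ℝ)..T, (logDeriv xiFun (2 + t * I)).re)
        - ∫ x in σ..2, (logDeriv xiFun (x + T * I)).im := by
  have hd : DifferentiableOn ℂ (logDeriv xiFun) {z : ℂ | 1 / 2 < z.re} :=
    differentiable_xiFun.deriv.differentiableOn.div differentiable_xiFun.differentiableOn
      (fun z hz => xiFun_ne_zero_of_re_ne hRH (ne_of_gt hz))
  have h := integral_boundary_rect_eq_zero_of_differentiableOn (logDeriv xiFun) (σ : ℂ)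
    (2 + T * I) (hd.mono (by
      rintro z ⟨hz, -⟩
      simp only [ofReal_re, add_re, re_ofNat, mul_re, I_re, mul_zero, ofReal_im, I_im, mul_one,
        sub_self, add_zero, Set.mem_preimage, Set.uIcc_of_le hσ2] at hz
      exact lt_of_lt_of_le hσ hz.1))
  simp only [ofReal_re, ofReal_im, add_re, re_ofNat, mul_re, I_re, mul_zero, I_im, mul_one,
    sub_self, add_zero, ofReal_zero, zero_mul, add_im, im_ofNat, mul_im, zero_add,
    ofReal_ofNat] at h
  have hi1 : IntervalIntegrable (fun x : ℝ => logDeriv xiFun x) MeasureTheory.volume σ 2 := by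
    have := continuousOn_logDeriv_xiFun_horizontal hRH (σ₂ := 2) hσ 0
    rw [← Set.uIcc_of_le hσ2] at this
    simpa using this.intervalIntegrable
  have hi2 : IntervalIntegrable (fun x : ℝ => logDeriv xiFun (x + T * I))
      MeasureTheory.volume σ 2 := by
    have := continuousOn_logDeriv_xiFun_horizontal hRH (σ₂ := 2) hσ T
    rw [← Set.uIcc_of_le hσ2] at this
    exact this.intervalIntegrable
  have hi3 : IntervalIntegrable (fun t : ℝ => logDeriv xiFun (2 + t * I))
      MeasureTheory.volume 0 T := by
    have := continuous_logDeriv_xiFun_line hRH (σ := 2) (by norm_num)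
    push_cast at this
    exact this.intervalIntegrable _ _
  have hi4 : IntervalIntegrable (fun t : ℝ => logDeriv xiFun (σ + t * I))
      MeasureTheory.volume 0 T :=
    (continuous_logDeriv_xiFun_line hRH (ne_of_gt hσ)).intervalIntegrable _ _
  have r1 := imCLM.intervalIntegral_comp_comm hi1
  have r2 := imCLM.intervalIntegral_comp_comm hi2
  have r3 := reCLM.intervalIntegral_comp_comm hi3
  have r4 := reCLM.intervalIntegral_comp_comm hi4
  simp only [imCLM_apply, reCLM_apply, im_logDeriv_xiFun_ofReal,
    intervalIntegral.integral_zero] at r1 r2 r3 r4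
  have him := congrArg Complex.im h
  simp only [sub_im, add_im, smul_eq_mul, mul_im, I_re, I_im, zero_mul, one_mul, zero_add,
    zero_im] at him
  rw [r2, r3, r4]
  linarith

/-- The first moment of `Σ_a`, uniformly for bounded `a`. -/
theorem exists_abs_integral_sigmaSum_sub_le (hRH : RiemannHypothesis) :
    ∃ K : ℝ, 0 ≤ K ∧ ∀ a T : ℝ, 0 < a → a ≤ 3 / 2 → 3 ≤ T →
      |(∫ t in (0 : ℝ)..T, sigmaSum a t)
        - 1 / (2 * a) * (T * Real.log (T / (2 * Real.pi)) - T)| ≤ K * Real.log T / a := by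
  obtain ⟨K₁, hK₁, h₁⟩ := exists_abs_integral_re_logDeriv_xiFun_two_sub_le hRH
  obtain ⟨K₂, hK₂, h₂⟩ := exists_abs_integral_im_logDeriv_xiFun_le hRH
  refine ⟨K₁ + K₂, by positivity, fun a T ha ha2 hT => ?_⟩
  have e := integral_re_logDeriv_xiFun_eq hRH (σ := 1 / 2 + a) (T := T) (by linarith)
    (by linarith)
  have e2 : ∫ t in (0 : ℝ)..T, sigmaSum a t
      = (∫ t in (0 : ℝ)..T, (logDeriv xiFun ((1 / 2 + a : ℝ) + t * I)).re) / a := by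
    rw [← intervalIntegral.integral_div]
    exact intervalIntegral.integral_congr fun t _ => sigmaSum_eq hRH ha t
  have b1 := h₁ T hT
  have b2 := h₂ (1 / 2 + a) T (by linarith) (by linarith) hT
  rw [e2, e, le_div_iff₀ ha]
  set X := ∫ t in (0 : ℝ)..T, (logDeriv xiFun (2 + t * I)).re
  set Y := ∫ x in (1 / 2 + a)..2, (logDeriv xiFun (x + T * I)).im
  have e3 : |(X - Y) / a - 1 / (2 * a) * (T * Real.log (T / (2 * Real.pi)) - T)| * a
      = |X - (T * Real.log (T / (2 * Real.pi)) - T) / 2 - Y| := by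
    rw [← abs_of_pos ha, ← abs_mul, abs_of_pos ha]
    congr 1
    field_simp
    ring
  rw [e3, add_mul]
  exact (abs_sub _ _).trans (add_le_add b1 b2)

end SigmaSum

/-! ### Powers of finite sums split by coincidences of indices -/

section FiniteSums

open MeasureTheory

/-- The zeros with ordinate in `(0, T)`. -/
noncomputable def zerosBelow (T : ℝ) : Finset ZetaZeroIndex :=
  ((ZetaZeroIndex.finite_abs_ordinate_le T).subset
    (fun j (hj : 0 < j.ordinate ∧ j.ordinate < T) => by
      show |j.ordinate| ≤ T
      rw [abs_of_pos hj.1]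
      exact hj.2.le) : {j : ZetaZeroIndex | 0 < j.ordinate ∧ j.ordinate < T}.Finite).toFinset

theorem mem_zerosBelow {T : ℝ} {j : ZetaZeroIndex} :
    j ∈ zerosBelow T ↔ 0 < j.ordinate ∧ j.ordinate < T := by
  simp [zerosBelow]

/-- The ordinate rescaled to unit mean density at height `T`. -/
noncomputable def scaledOrdinate (T : ℝ) (j : ZetaZeroIndex) : ℝ :=
  Real.log T / (2 * Real.pi) * j.ordinate

open Classical in
theorem correlationSum_eq_sum {n : ℕ} (T : ℝ) (f : (Fin n → ℝ) → ℝ) :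
    correlationSum T f = ∑ p : Fin n → zerosBelow T,
      if Function.Injective p then f (fun i => scaledOrdinate T (p i)) else 0 := by
  let e : {p : Fin n → ZetaZeroIndex //
      Function.Injective p ∧ ∀ i, 0 < (p i).ordinate ∧ (p i).ordinate < T} ≃
      {p : Fin n → zerosBelow T // Function.Injective p} :=
    { toFun := fun p => ⟨fun i => ⟨p.1 i, mem_zerosBelow.2 (p.2.2 i)⟩, fun i k h =>
        p.2.1 (congrArg Subtype.val h)⟩
      invFun := fun p => ⟨fun i => p.1 i, fun i k h => p.2 (Subtype.ext h), fun i =>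
        mem_zerosBelow.1 (p.1 i).2⟩
      left_inv := fun p => rfl
      right_inv := fun p => rfl }
  have h1 : correlationSum T f = ∑' p : {p : Fin n → zerosBelow T // Function.Injective p},
      f (fun i => scaledOrdinate T (p.1 i)) := by
    unfold correlationSum
    exact Equiv.tsum_eq e (fun p : {p : Fin n → zerosBelow T // Function.Injective p} =>
      f (fun i => scaledOrdinate T (p.1 i)))
  rw [h1, tsum_fintype, ← Finset.sum_filter]
  exact (Finset.sum_subtype (Finset.univ.filter fun p : Fin n → zerosBelow T =>
    Function.Injective p) (by simp) (fun p => f (fun i => scaledOrdinate T (p i)))).symm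

variable {ι : Type*} [Fintype ι]

theorem sum_fin_two_arrow (F : (Fin 2 → ι) → ℝ) :
    ∑ p : Fin 2 → ι, F p = ∑ i, ∑ j, F ![i, j] := by
  rw [← Fintype.sum_prod_type', ← Equiv.sum_comp (finTwoArrowEquiv ι).symm]
  rfl

theorem sum_fin_three_arrow (F : (Fin 3 → ι) → ℝ) :
    ∑ p : Fin 3 → ι, F p = ∑ i, ∑ j, ∑ k, F ![i, j, k] := by
  rw [← Equiv.sum_comp (Fin.consEquiv (fun _ : Fin 3 => ι)), Fintype.sum_prod_type]
  refine Finset.sum_congr rfl fun i _ => ?_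
  rw [sum_fin_two_arrow]
  rfl

open Classical in
theorem sq_sum_eq_diagonal_add (β : ι → ℝ) :
    (∑ i, β i) ^ 2 = ∑ i, β i ^ 2 + ∑ p : Fin 2 → ι,
      if Function.Injective p then β (p 0) * β (p 1) else 0 := by
  rw [sum_fin_two_arrow, pow_two, Finset.sum_mul_sum, ← Finset.sum_add_distrib]
  refine Finset.sum_congr rfl fun i _ => ?_
  have h : ∀ j, β i * β j = (if i = j then β i ^ 2 else 0)
      + if Function.Injective ![i, j] then β i * β j else 0 := by
    intro j
    have hinj : Function.Injective ![i, j] ↔ i ≠ j := by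
      constructor
      · intro h hij
        have := @h 0 1 (by simpa using hij)
        simp at this
      · intro hij a b hab
        fin_cases a <;> fin_cases b <;> simp_all
    by_cases hij : i = j
    · rw [if_pos hij, if_neg (by rw [hinj]; exact not_not.2 hij), hij]; ring
    · rw [if_neg hij, if_pos (hinj.2 hij)]; ring
  rw [Finset.sum_congr rfl fun j _ => h j, Finset.sum_add_distrib]
  simp

open Classical in
-- The pattern with two equal indices occurs three times. Its summand is symmetrised, because the
-- correlation hypothesis takes symmetric test functions only, and this turns 3 into 3/2.
theorem cube_sum_eq_diagonal_add (β : ι → ℝ) :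
    (∑ i, β i) ^ 3 = ∑ i, β i ^ 3
      + 3 / 2 * (∑ p : Fin 2 → ι, if Function.Injective p then
          (β (p 0) ^ 2 * β (p 1) + β (p 0) * β (p 1) ^ 2) else 0)
      + ∑ p : Fin 3 → ι, if Function.Injective p then β (p 0) * β (p 1) * β (p 2) else 0 := by
  have hinj2 : ∀ i j : ι, Function.Injective ![i, j] ↔ i ≠ j := by
    intro i j
    constructor
    · intro h hij
      have := @h 0 1 (by simpa using hij)
      simp at this
    · intro hij a b hab
      fin_cases a <;> fin_cases b <;> simp_all
  have hinj3 : ∀ i j k : ι, Function.Injective ![i, j, k] ↔ i ≠ j ∧ i ≠ k ∧ j ≠ k := by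
    intro i j k
    constructor
    · intro h
      refine ⟨fun e => ?_, fun e => ?_, fun e => ?_⟩
      · have := @h 0 1 (by simpa using e)
        simp at this
      · have := @h 0 2 (by simpa using e)
        simp at this
      · have := @h 1 2 (by simpa using e)
        simp at this
    · rintro ⟨h1, h2, h3⟩ a b hab
      fin_cases a <;> fin_cases b <;> simp_all
  rw [sum_fin_two_arrow, sum_fin_three_arrow]
  simp only [hinj2, hinj3, Matrix.cons_val_zero, Matrix.cons_val_one, Matrix.cons_val]
  have hterm : ∀ i j k : ι, (if i ≠ j ∧ i ≠ k ∧ j ≠ k then β i * β j * β k else 0) =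
      β i * β j * β k - (if i = j then β i ^ 2 * β k else 0) - (if i = k then β i ^ 2 * β j else 0)
        - (if j = k then β i * β j ^ 2 else 0)
        + (if i = j then (if j = k then 2 * β i ^ 3 else 0) else 0) := by
    intro i j k
    by_cases h1 : i = j <;> by_cases h2 : j = k
    · subst h1; subst h2; simp; ring
    · subst h1; simp [h2]; ring
    · subst h2; simp [h1]; ring
    · by_cases h3 : i = k
      · subst h3; simp [h1, h2]; ring
      · simp [h1, h2, h3]
  have hterm2 : ∀ i j : ι, (if i ≠ j then β i ^ 2 * β j + β i * β j ^ 2 else 0) =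
      β i ^ 2 * β j + β i * β j ^ 2 - (if i = j then 2 * β i ^ 3 else 0) := by
    intro i j
    by_cases h1 : i = j
    · subst h1; simp; ring
    · simp [h1]
  have hcube : (∑ i, β i) ^ 3 = ∑ i, ∑ j, ∑ k, β i * β j * β k := by
    rw [pow_succ, pow_two, Finset.sum_mul_sum, Finset.sum_mul]
    refine Finset.sum_congr rfl fun i _ => ?_
    rw [Finset.sum_mul]
    refine Finset.sum_congr rfl fun j _ => ?_
    rw [Finset.mul_sum]
  rw [hcube]
  simp only [hterm, hterm2, Finset.sum_add_distrib, Finset.sum_sub_distrib]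
  have hA : ∑ i, ∑ j, ∑ k, (if i = j then β i ^ 2 * β k else 0) = ∑ i, ∑ k, β i ^ 2 * β k := by
    refine Finset.sum_congr rfl fun i _ => ?_
    rw [Finset.sum_comm]
    simp
  have hB : ∑ i, ∑ j, ∑ k, (if i = k then β i ^ 2 * β j else 0) = ∑ i, ∑ j, β i ^ 2 * β j := by
    simp
  have hC : ∑ i, ∑ j, ∑ k, (if j = k then β i * β j ^ 2 else 0) = ∑ i, ∑ j, β i * β j ^ 2 := by
    simp
  have hD : ∑ i, ∑ j, ∑ k, (if i = j then (if j = k then 2 * β i ^ 3 else 0) else 0)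
      = 2 * ∑ i, β i ^ 3 := by
    rw [Finset.mul_sum]
    refine Finset.sum_congr rfl fun i _ => ?_
    rw [Finset.sum_comm]
    simp
  have hE : ∑ i, ∑ j, (if i = j then 2 * β i ^ 3 else 0) = 2 * ∑ i, β i ^ 3 := by
    simp [Finset.mul_sum]
  have hF : ∑ i, ∑ j, β i * β j ^ 2 = ∑ i, ∑ j, β i ^ 2 * β j := by
    rw [Finset.sum_comm]
    simp_rw [mul_comm]
  rw [hA, hB, hC, hD, hE, hF]
  ring

end FiniteSums

/-! ### From compactly supported functions to translation-invariant test functions -/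

section DiagAverage

open MeasureTheory

/-- The average of `B` over the diagonal translates of `-x`. -/
noncomputable def diagAverage {n : ℕ} (B : (Fin n → ℝ) → ℝ) (x : Fin n → ℝ) : ℝ :=
  ∫ y : ℝ, B (fun i => y - x i)

theorem HasCompactSupport.exists_norm_le {E : Type*} [NormedAddCommGroup E] {B : E → ℝ}
    (hB : HasCompactSupport B) : ∃ R : ℝ, 0 ≤ R ∧ ∀ u, B u ≠ 0 → ‖u‖ ≤ R := by
  obtain ⟨R, hR⟩ := hB.isBounded.exists_norm_le
  exact ⟨max R 0, le_max_right _ _, fun u hu => (hR u (subset_tsupport _ hu)).trans (le_max_left _ _)⟩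

/-- The average is the convolution of z ↦ B(-z) with the image of Lebesgue measure on the diagonal.
That measure is locally finite, since a single coordinate already confines the parameter, so
smoothness of convolutions applies. -/
theorem contDiff_diagAverage {m : ℕ} {B : (Fin (m + 1) → ℝ) → ℝ}
    (hB : ContDiff ℝ ((⊤ : ℕ∞) : WithTop ℕ∞) B) (hc : HasCompactSupport B) :
    ContDiff ℝ ((⊤ : ℕ∞) : WithTop ℕ∞) (diagAverage B) := by
  set δ : ℝ → (Fin (m + 1) → ℝ) := fun y _ => y with hδ
  have hδc : Continuous δ := by fun_prop
  set μ : Measure (Fin (m + 1) → ℝ) := Measure.map δ volume with hμ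
  have hloc : IsLocallyFiniteMeasure μ := by
    refine ⟨fun x => ⟨Metric.ball x 1, Metric.ball_mem_nhds x one_pos, ?_⟩⟩
    rw [hμ, Measure.map_apply hδc.measurable Metric.isOpen_ball.measurableSet]
    refine lt_of_le_of_lt (measure_mono (t := Metric.ball (x 0) 1) fun y hy => ?_)
      measure_ball_lt_top
    have hy' : dist (δ y) x < 1 := hy
    exact (dist_le_pi_dist (δ y) x 0).trans_lt hy'
  have hg : ContDiff ℝ ((⊤ : ℕ∞) : WithTop ℕ∞) (fun z => B (-z)) := hB.comp contDiff_neg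
  have hgc : HasCompactSupport (fun z => B (-z)) := hc.comp_homeomorph (Homeomorph.neg _)
  have hconv := hgc.contDiff_convolution_right (μ := μ) (ContinuousLinearMap.mul ℝ ℝ)
    (f := fun _ => (1 : ℝ)) (locallyIntegrable_const 1) hg
  convert! hconv using 1
  ext x
  rw [convolution_def, hμ, integral_map hδc.measurable.aemeasurable]
  · simp only [ContinuousLinearMap.mul_apply', one_mul, neg_sub, diagAverage]
    rfl
  · refine Continuous.aestronglyMeasurable ?_
    have := hg.continuous
    simp only [ContinuousLinearMap.mul_apply', one_mul]
    fun_prop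

theorem isCorrelationTest_diagAverage {m : ℕ} {B : (Fin (m + 1) → ℝ) → ℝ}
    (hB : ContDiff ℝ ((⊤ : ℕ∞) : WithTop ℕ∞) B) (hc : HasCompactSupport B)
    (hsymm : ∀ (σ : Equiv.Perm (Fin (m + 1))) (x : Fin (m + 1) → ℝ),
      B (fun i => x (σ i)) = B x) : IsCorrelationTest (diagAverage B) where
  smooth := contDiff_diagAverage hB hc
  symm σ x := by
    unfold diagAverage
    exact integral_congr_ae (Eventually.of_forall fun y => hsymm σ (fun i => y - x i))
  translate x t := by
    unfold diagAverage
    rw [← integral_sub_right_eq_self (fun y => B (fun i => y - x i)) t]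
    refine integral_congr_ae (Eventually.of_forall fun y => ?_)
    simp only
    congr 1
    ext i
    ring
  decay k := by
    obtain ⟨R, hR0, hR⟩ := hc.exists_norm_le
    have hcont := (contDiff_diagAverage hB hc).continuous
    obtain ⟨C, hC⟩ := (isCompact_closedBall (0 : Fin (m + 1) → ℝ) (2 * R)).exists_bound_of_continuousOn
      hcont.continuousOn
    refine ⟨(2 * R) ^ k * max C 0, fun x hx => ?_⟩
    by_cases h0 : diagAverage B x = 0
    · rw [h0, abs_zero, mul_zero]; positivity
    · have hy : ∃ y, B (fun i => y - x i) ≠ 0 := by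
        by_contra! hne
        exact h0 (by simp [diagAverage, hne])
      obtain ⟨y, hy⟩ := hy
      have hb := hR _ hy
      have hi : ∀ i, |y - x i| ≤ R := fun i => by
        have := norm_le_pi_norm (fun i => y - x i) i
        exact this.trans hb
      -- On the hyperplane, y is the mean of the coordinates y - x i. So the support of `B` bounds y
      -- and then x: the average vanishes on the hyperplane outside a ball, and every power is
      -- allowed.
      have hyb : |y| ≤ R := by
        have h1 : ∑ i : Fin (m + 1), (y - x i) = (m + 1) * y := by
          rw [Finset.sum_sub_distrib, hx]
          simp
        have h2 : |∑ i : Fin (m + 1), (y - x i)| ≤ (m + 1) * R := by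
          refine (Finset.abs_sum_le_sum_abs _ _).trans ((Finset.sum_le_sum fun i _ => hi i).trans ?_)
          simp
        rw [h1, abs_mul, abs_of_pos (by positivity : (0 : ℝ) < m + 1)] at h2
        exact le_of_mul_le_mul_left h2 (by positivity)
      have hxn : ‖x‖ ≤ 2 * R := by
        rw [pi_norm_le_iff_of_nonneg (by positivity)]
        intro i
        rw [Real.norm_eq_abs]
        have := abs_sub y (y - x i)
        rw [sub_sub_cancel] at this
        linarith [hi i]
      have hv := hC x (by simpa using hxn)
      rw [Real.norm_eq_abs] at hv
      have := hv.trans (le_max_left C 0)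
      gcongr

theorem gueDensity_const_sub {n : ℕ} (x : Fin n → ℝ) (y : ℝ) :
    gueDensity (fun i => y - x i) = gueDensity x := by
  unfold gueDensity
  congr 1
  ext i j
  simp only [Matrix.of_apply]
  rw [← Real.sinc_neg]
  congr 1
  ring

theorem gueDensity_add_const {n : ℕ} (x : Fin n → ℝ) (t : ℝ) :
    gueDensity (fun i => x i + t) = gueDensity x := by
  unfold gueDensity
  simp

theorem continuous_gueDensity {n : ℕ} : Continuous (gueDensity (n := n)) := by
  unfold gueDensity
  refine Continuous.matrix_det ?_
  refine continuous_matrix fun i j => ?_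
  simp only [Matrix.of_apply]
  exact Real.continuous_sinc.comp (by fun_prop)

theorem abs_gueDensity_le {n : ℕ} (x : Fin n → ℝ) : |gueDensity x| ≤ n.factorial := by
  have h := Matrix.det_le (A := Matrix.of fun i j : Fin n => Real.sinc (Real.pi * (x i - x j)))
    (abv := AbsoluteValue.abs) (x := 1) (fun i j => Real.abs_sinc_le_one _)
  simpa [gueDensity] using h

/-- Translating the last coordinate to 0 is the substitution y ↦ y + (∑ y)(1,…,1), a rank-one
perturbation of the identity. Its determinant m+1 cancels the factor in front of the integral. -/
theorem deltaMeanIntegral_eq_integral_snoc_zero {m : ℕ} {g : (Fin (m + 1) → ℝ) → ℝ}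
    (hg : Continuous g) (ht : ∀ x t, g (fun i => x i + t) = g x) :
    deltaMeanIntegral g = ∫ z : Fin m → ℝ, g (Fin.snoc (α := fun _ => ℝ) z 0) := by
  set M : Matrix (Fin m) (Fin m) ℝ := 1 + Matrix.replicateCol Unit (fun _ : Fin m => (1 : ℝ)) *
    Matrix.replicateRow Unit (fun _ : Fin m => (1 : ℝ)) with hM
  have hdet : M.det = (m : ℝ) + 1 := by
    rw [hM, Matrix.det_one_add_replicateCol_mul_replicateRow]
    simp [dotProduct]
    ring
  have hpos : (0 : ℝ) < m + 1 := by positivity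
  have hmap := Real.map_matrix_volume_pi_eq_smul_volume_pi (M := M) (by rw [hdet]; exact hpos.ne')
  have hMapply : ∀ (y : Fin m → ℝ) i, Matrix.toLin' M y i = y i + ∑ k, y k := by
    intro y i
    rw [Matrix.toLin'_apply, hM, Matrix.add_mulVec, Matrix.one_mulVec]
    simp [Matrix.mulVec, dotProduct, Matrix.mul_apply]
  have hgy : ∀ y : Fin m → ℝ, g (Fin.snoc (α := fun _ => ℝ) y (-∑ i, y i))
      = g (Fin.snoc (α := fun _ => ℝ) (Matrix.toLin' M y) 0) := by
    intro y
    rw [← ht _ (∑ i, y i)]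
    congr 1
    ext i
    refine Fin.lastCases ?_ (fun i => ?_) i
    · simp
    · simp only [Fin.snoc_castSucc]
      exact (hMapply y i).symm
  have hsn : Continuous (fun z : Fin m → ℝ => g (Fin.snoc (α := fun _ => ℝ) z 0)) :=
    hg.comp (Continuous.finSnoc (n := m) (A := fun _ => ℝ) continuous_id continuous_const)
  have hcont : Continuous (Matrix.toLin' M) := LinearMap.continuous_of_finiteDimensional _
  unfold deltaMeanIntegral
  simp_rw [hgy]
  have hint := integral_map (μ := (volume : Measure (Fin m → ℝ))) hcont.measurable.aemeasurable
    (f := fun z : Fin m → ℝ => g (Fin.snoc (α := fun _ => ℝ) z 0)) hsn.aestronglyMeasurable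
  rw [hmap, integral_smul_measure, hdet] at hint
  rw [← hint, abs_of_pos (by positivity), ENNReal.toReal_ofReal (by positivity), smul_eq_mul,
    ← mul_assoc, mul_inv_cancel₀ hpos.ne', one_mul]

theorem integral_integral_snoc {m : ℕ} {H : (Fin (m + 1) → ℝ) → ℝ} (hH : Integrable H) :
    ∫ y : ℝ, ∫ z : Fin m → ℝ, H (Fin.snoc (α := fun _ => ℝ) z y) = ∫ x, H x := by
  have hmp := (volume_preserving_piFinSuccAbove (fun _ : Fin (m + 1) => ℝ) (Fin.last m)).symm
  have h1 := hmp.integral_comp' H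
  have hint : Integrable (fun p : ℝ × (Fin m → ℝ) => H ((MeasurableEquiv.piFinSuccAbove
      (fun _ : Fin (m + 1) => ℝ) (Fin.last m)).symm p)) :=
    (hmp.integrable_comp_emb (MeasurableEquiv.measurableEmbedding _)).2 hH
  rw [← h1, Measure.volume_eq_prod, integral_prod _ hint]
  refine integral_congr_ae (Eventually.of_forall fun y => integral_congr_ae
    (Eventually.of_forall fun z => ?_))
  simp only
  congr 1
  exact (Fin.insertNth_last' y z).symm

/-- The GUE prediction for an averaged test function is the integral against the density. -/
theorem deltaMeanIntegral_diagAverage {m : ℕ} {B : (Fin (m + 1) → ℝ) → ℝ}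
    (hB : ContDiff ℝ ((⊤ : ℕ∞) : WithTop ℕ∞) B) (hc : HasCompactSupport B) :
    (deltaMeanIntegral fun x => diagAverage B x * gueDensity x) = ∫ x, B x * gueDensity x := by
  have hcont : Continuous (fun x => diagAverage B x * gueDensity x) :=
    (contDiff_diagAverage hB hc).continuous.mul continuous_gueDensity
  have htr : ∀ x t, diagAverage B (fun i => x i + t) = diagAverage B x := by
    intro x t
    unfold diagAverage
    rw [← integral_sub_right_eq_self (fun y => B (fun i => y - x i)) t]
    refine integral_congr_ae (Eventually.of_forall fun y => ?_)
    simp only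
    congr 1
    ext i
    ring
  rw [deltaMeanIntegral_eq_integral_snoc_zero hcont
    (fun x t => by rw [htr, gueDensity_add_const])]
  set H : (Fin (m + 1) → ℝ) → ℝ := fun x => B x * gueDensity x with hHdef
  have hHc : Continuous H := hB.continuous.mul continuous_gueDensity
  have hHs : HasCompactSupport H := hc.mul_right
  have hHi : Integrable H := hHc.integrable_of_hasCompactSupport hHs
  -- The density is invariant under x ↦ y - x, so it may be moved inside the integral over y and
  -- evaluated at the same point as `B`. The iterated integral then covers the full space.
  have h1 : ∀ z : Fin m → ℝ, diagAverage B (Fin.snoc (α := fun _ => ℝ) z 0)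
      * gueDensity (Fin.snoc (α := fun _ => ℝ) z 0)
      = ∫ y : ℝ, H (Fin.snoc (α := fun _ => ℝ) ((fun _ => y) - z) y) := by
    intro z
    unfold diagAverage
    rw [← integral_mul_const]
    refine integral_congr_ae (Eventually.of_forall fun y => ?_)
    have e : (Fin.snoc (α := fun _ => ℝ) ((fun _ => y) - z) y : Fin (m + 1) → ℝ)
        = fun i => y - (Fin.snoc (α := fun _ => ℝ) z 0 : Fin (m + 1) → ℝ) i := by
      ext i
      refine Fin.lastCases ?_ (fun i => ?_) i <;> simp
    simp only [hHdef]
    rw [e, gueDensity_const_sub]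
  simp_rw [h1]
  have hswap : Integrable (Function.uncurry fun (z : Fin m → ℝ) (y : ℝ) =>
      H (Fin.snoc (α := fun _ => ℝ) ((fun _ => y) - z) y)) (volume.prod volume) := by
    obtain ⟨R, hR0, hR⟩ := hHs.exists_norm_le
    refine Continuous.integrable_of_hasCompactSupport ?_ ?_
    · refine hHc.comp ?_
      exact Continuous.finSnoc (A := fun _ => ℝ) (by fun_prop) continuous_snd
    · refine HasCompactSupport.intro
        (isCompact_closedBall (0 : (Fin m → ℝ) × ℝ) (2 * R)) fun p hp => ?_
      by_contra hne
      have hb := hR _ hne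
      apply hp
      have hlast : |p.2| ≤ R := by
        have := norm_le_pi_norm (Fin.snoc (α := fun _ => ℝ) ((fun _ => p.2) - p.1) p.2 :
          Fin (m + 1) → ℝ) (Fin.last m)
        rw [Fin.snoc_last, Real.norm_eq_abs] at this
        exact this.trans hb
      rw [mem_closedBall_zero_iff, Prod.norm_def]
      refine max_le ?_ (by rw [Real.norm_eq_abs]; linarith)
      rw [pi_norm_le_iff_of_nonneg (by positivity)]
      intro i
      have h2 : |p.2 - p.1 i| ≤ R := by
        have := norm_le_pi_norm (Fin.snoc (α := fun _ => ℝ) ((fun _ => p.2) - p.1) p.2 :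
          Fin (m + 1) → ℝ) i.castSucc
        rw [Fin.snoc_castSucc, Real.norm_eq_abs] at this
        exact this.trans hb
      have h3 := abs_sub p.2 (p.2 - p.1 i)
      rw [sub_sub_cancel] at h3
      rw [Real.norm_eq_abs]
      linarith
  rw [integral_integral_swap hswap, ← integral_integral_snoc hHi]
  refine integral_congr_ae (Eventually.of_forall fun y => ?_)
  exact integral_sub_left_eq_self (fun z : Fin m → ℝ => H (Fin.snoc (α := fun _ => ℝ) z y)) volume
    (fun _ => y)

/-- Sums of `B` over distinct zeros, integrated over the shift. -/
theorem tendsto_integral_sum_injective {m : ℕ} (hGUE : GUECorrelation m)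
    {B : (Fin (m + 1) → ℝ) → ℝ}
    (hB : ContDiff ℝ ((⊤ : ℕ∞) : WithTop ℕ∞) B) (hc : HasCompactSupport B)
    (hsymm : ∀ (σ : Equiv.Perm (Fin (m + 1))) (x : Fin (m + 1) → ℝ),
      B (fun i => x (σ i)) = B x) :
    Tendsto (fun T : ℝ => correlationSum T (diagAverage B) / (T * Real.log T)) atTop
      (𝓝 (1 / (2 * Real.pi) * ∫ x, B x * gueDensity x)) := by
  rw [← deltaMeanIntegral_diagAverage hB hc]
  exact hGUE _ (isCorrelationTest_diagAverage hB hc hsymm)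

theorem integrable_diag_of_hasCompactSupport {m : ℕ} {B : (Fin (m + 1) → ℝ) → ℝ}
    (hB : Continuous B) (hc : HasCompactSupport B) (x : Fin (m + 1) → ℝ) :
    Integrable (fun y : ℝ => B (fun i => y - x i)) := by
  obtain ⟨R, hR0, hR⟩ := hc.exists_norm_le
  refine Continuous.integrable_of_hasCompactSupport (hB.comp (by fun_prop)) ?_
  refine HasCompactSupport.intro (isCompact_closedBall (x 0) R) fun y hy => ?_
  by_contra hne
  apply hy
  have := norm_le_pi_norm (fun i => y - x i) 0
  rw [mem_closedBall_iff_norm]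
  exact this.trans (hR _ hne)

open Classical in
-- Integrating the shift out of a sum over distinct zeros is what produces the averaged test
-- function, hence a sum that the correlation hypothesis can evaluate.
theorem integral_sum_injective {m : ℕ} {B : (Fin (m + 1) → ℝ) → ℝ}
    (hB : Continuous B) (hc : HasCompactSupport B) (T : ℝ) :
    Integrable (fun y : ℝ => ∑ p : Fin (m + 1) → zerosBelow T, if Function.Injective p then
      B (fun i => y - scaledOrdinate T (p i)) else 0) ∧
    ∫ y : ℝ, (∑ p : Fin (m + 1) → zerosBelow T, if Function.Injective p then
      B (fun i => y - scaledOrdinate T (p i)) else 0) = correlationSum T (diagAverage B) := by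
  have hi : ∀ p : Fin (m + 1) → zerosBelow T, Integrable (fun y : ℝ =>
      if Function.Injective p then B (fun i => y - scaledOrdinate T (p i)) else 0) := by
    intro p
    split_ifs
    · exact integrable_diag_of_hasCompactSupport hB hc _
    · exact integrable_zero _ _ _
  refine ⟨integrable_finsetSum _ fun p _ => hi p, ?_⟩
  rw [integral_finsetSum _ fun p _ => hi p, correlationSum_eq_sum]
  refine Finset.sum_congr rfl fun p _ => ?_
  split_ifs
  · rfl
  · simp

end DiagAverage

/-! ### Zeros in (0,T) against all zeros -/

section Truncation

open MeasureTheory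

/-- The part of `Σ_a(t)` that comes from the zeros with ordinate in `(0, T)`. -/
noncomputable def zeroSum (T a t : ℝ) : ℝ :=
  ∑ j ∈ zerosBelow T, 1 / (a ^ 2 + (t - j.ordinate) ^ 2)

theorem zeroSum_nonneg (T a t : ℝ) : 0 ≤ zeroSum T a t :=
  Finset.sum_nonneg fun _ _ => by positivity

theorem zeroSum_le_sigmaSum (hRH : RiemannHypothesis) {a : ℝ} (ha : 0 < a) (T t : ℝ) :
    zeroSum T a t ≤ sigmaSum a t :=
  (summable_one_div_sq_add_sq hRH ha t).sum_le_tsum _ fun _ _ => by positivity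

theorem continuous_zeroSum {a : ℝ} (ha : 0 < a) (T : ℝ) : Continuous (zeroSum T a) := by
  unfold zeroSum
  refine continuous_finsetSum _ fun j _ => ?_
  refine continuous_const.div (by fun_prop) fun t => ?_
  positivity

theorem one_div_sq_add_sq_le {a u : ℝ} (hu : 3 / 2 ≤ |u|) :
    1 / (a ^ 2 + u ^ 2) ≤ 2 * (1 / ((3 / 2) ^ 2 + u ^ 2)) := by
  have h1 : (3 / 2 : ℝ) ^ 2 ≤ u ^ 2 := by
    rw [← sq_abs u]
    gcongr
  have h2 : 0 ≤ a ^ 2 := sq_nonneg a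
  rw [mul_one_div, div_le_div_iff₀ (by nlinarith) (by nlinarith)]
  nlinarith

/-- The omitted zeros lie at distance at least 3/2 from t, where 1/(a²+u²) is comparable with the
term for a = 3/2. The bound is therefore free of a. -/
theorem sigmaSum_sub_zeroSum_le (hRH : RiemannHypothesis) {a T t : ℝ} (ha : 0 < a)
    (h0 : 3 / 2 ≤ t) (h1 : t ≤ T - 3 / 2) :
    sigmaSum a t - zeroSum T a t ≤ 2 * sigmaSum (3 / 2) t := by
  classical
  rw [sub_le_iff_le_add']
  have hs := summable_one_div_sq_add_sq hRH ha t
  have hs' := (summable_one_div_sq_add_sq hRH (by norm_num : (0 : ℝ) < 3 / 2) t).mul_left 2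
  have hfin : HasSum (fun j : ZetaZeroIndex => if j ∈ zerosBelow T then
      1 / (a ^ 2 + (t - j.ordinate) ^ 2) else 0) (zeroSum T a t) := by
    have := hasSum_sum_of_ne_finset_zero (L := .unconditional ZetaZeroIndex) (s := zerosBelow T)
      (f := fun j : ZetaZeroIndex => if j ∈ zerosBelow T then
      1 / (a ^ 2 + (t - j.ordinate) ^ 2) else 0) (fun j hj => if_neg hj)
    convert! this using 1
    exact Finset.sum_congr rfl fun j hj => (if_pos hj).symm
  unfold sigmaSum
  rw [← hfin.tsum_eq, ← tsum_mul_left, ← hfin.summable.tsum_add hs']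
  refine hs.tsum_le_tsum (fun j => ?_) (hfin.summable.add hs')
  split_ifs with hj
  · have : (0 : ℝ) ≤ 2 * (1 / ((3 / 2) ^ 2 + (t - j.ordinate) ^ 2)) := by positivity
    linarith
  · rw [zero_add]
    refine one_div_sq_add_sq_le ?_
    rw [mem_zerosBelow, not_and_or, not_lt, not_lt] at hj
    rcases hj with hj | hj
    · exact le_trans (by linarith) (le_abs_self _)
    · exact le_trans (by linarith) (neg_le_abs _)

theorem zeroSum_le_two_mul {a T t : ℝ} (ht : t ≤ -(3 / 2) ∨ T + 3 / 2 ≤ t) :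
    zeroSum T a t ≤ 2 * zeroSum T (3 / 2) t := by
  unfold zeroSum
  rw [Finset.mul_sum]
  refine Finset.sum_le_sum fun j hj => one_div_sq_add_sq_le ?_
  rw [mem_zerosBelow] at hj
  rcases ht with ht | ht
  · exact le_trans (by linarith) (neg_le_abs _)
  · exact le_trans (by linarith) (le_abs_self _)

theorem zeroSum_le_zero {a T t : ℝ} (ha : 0 < a) (ht : t ≤ 0) :
    zeroSum T a t ≤ zeroSum T a 0 := by
  unfold zeroSum
  refine Finset.sum_le_sum fun j hj => one_div_le_one_div_of_le (by positivity) ?_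
  rw [mem_zerosBelow] at hj
  nlinarith

theorem zeroSum_le_self {a T t : ℝ} (ha : 0 < a) (ht : T ≤ t) :
    zeroSum T a t ≤ zeroSum T a T := by
  unfold zeroSum
  refine Finset.sum_le_sum fun j hj => one_div_le_one_div_of_le (by positivity) ?_
  rw [mem_zerosBelow] at hj
  nlinarith

theorem integrable_one_div_sq_add_sq {a : ℝ} (ha : 0 < a) (γ : ℝ) :
    Integrable (fun t : ℝ => 1 / (a ^ 2 + (t - γ) ^ 2)) ∧
      ∫ t : ℝ, 1 / (a ^ 2 + (t - γ) ^ 2) = Real.pi / a := by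
  have h0 : ∀ t : ℝ, 1 / (a ^ 2 + (t - γ) ^ 2) = 1 / a ^ 2 * (1 + (a⁻¹ * (t - γ)) ^ 2)⁻¹ := by
    intro t
    have : 0 < a ^ 2 + (t - γ) ^ 2 := by positivity
    field_simp
  simp_rw [h0]
  constructor
  · exact (((integrable_inv_one_add_sq.comp_mul_left' (inv_ne_zero ha.ne')).comp_sub_right γ).const_mul _)
  · rw [integral_const_mul, integral_sub_right_eq_self (fun t => (1 + (a⁻¹ * t) ^ 2)⁻¹) γ,
      Measure.integral_comp_mul_left (fun t => (1 + t ^ 2)⁻¹), integral_univ_inv_one_add_sq]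
    rw [inv_inv, abs_of_pos ha, smul_eq_mul]
    field_simp

theorem integrable_zeroSum {a : ℝ} (ha : 0 < a) (T : ℝ) : Integrable (zeroSum T a) :=
  integrable_finsetSum _ fun j _ => (integrable_one_div_sq_add_sq ha j.ordinate).1

theorem integral_zeroSum {a : ℝ} (ha : 0 < a) (T : ℝ) :
    ∫ t, zeroSum T a t = Real.pi / a * (zerosBelow T).card := by
  unfold zeroSum
  rw [integral_finsetSum _ fun j _ => (integrable_one_div_sq_add_sq ha j.ordinate).1]
  simp_rw [(integrable_one_div_sq_add_sq ha _).2]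
  rw [Finset.sum_const, nsmul_eq_mul, mul_comm]

theorem log_add_four_le {T : ℝ} (hT : 3 ≤ T) : Real.log (T + 4) ≤ 2 * Real.log T := by
  rw [← Real.log_rpow (by linarith)]
  refine Real.log_le_log (by linarith) ?_
  norm_num
  nlinarith

/-- Bounds for `Σ_a` near and inside `[0, T]`. -/
theorem exists_sigmaSum_bounds (hRH : RiemannHypothesis) : ∃ K : ℝ, 0 < K ∧ ∀ a T t : ℝ,
    0 < a → a ≤ 3 / 2 → 3 ≤ T → |t| ≤ T + 2 →
    sigmaSum (3 / 2) t ≤ K * Real.log T ∧ sigmaSum a t ≤ K * (Real.log T / a ^ 2) := by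
  obtain ⟨K, hK, h⟩ := exists_sigmaSum_le hRH (3 / 2)
  refine ⟨2 * K, by positivity, fun a T t ha ha' hT ht => ?_⟩
  have hlog : Real.log (|t| + 2) ≤ 2 * Real.log T :=
    (Real.log_le_log (by positivity) (by linarith)).trans (log_add_four_le hT)
  have hLpos : 0 < Real.log T := Real.log_pos (by linarith)
  constructor
  · refine (h (3 / 2) (by norm_num) le_rfl t).trans ?_
    have : Real.log (|t| + 2) / (3 / 2) ^ 2 ≤ 2 * Real.log T := by
      rw [div_le_iff₀ (by norm_num)]
      nlinarith
    calc K * (Real.log (|t| + 2) / (3 / 2) ^ 2) ≤ K * (2 * Real.log T) := by gcongr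
      _ = 2 * K * Real.log T := by ring
  · refine (h a ha ha' t).trans ?_
    calc K * (Real.log (|t| + 2) / a ^ 2) ≤ K * (2 * Real.log T / a ^ 2) := by gcongr
      _ = 2 * K * (Real.log T / a ^ 2) := by ring

/-- The zeros outside `(0, T)` contribute little to `Σ_a` on `(0, T]`. -/
theorem exists_integral_sub_zeroSum_pow_le (hRH : RiemannHypothesis) (k : ℕ) (hk : k ≠ 0) :
    ∃ K : ℝ, 0 < K ∧ ∀ a T : ℝ, 0 < a → a ≤ 3 / 2 → 3 ≤ T →
    ∫ t, (Set.Ioc 0 T).indicator (fun t => sigmaSum a t - zeroSum T a t) t ^ k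
      ≤ K * (T * Real.log T ^ k + (Real.log T / a ^ 2) ^ k) := by
  obtain ⟨K, hK, h⟩ := exists_sigmaSum_bounds hRH
  refine ⟨(2 * K) ^ k + 3 * K ^ k, by positivity, fun a T ha ha' hT => ?_⟩
  have hLpos : 0 < Real.log T := Real.log_pos (by linarith)
  set A := (2 * K * Real.log T) ^ k with hA
  set B := (K * (Real.log T / a ^ 2)) ^ k with hB
  have hA0 : 0 ≤ A := by positivity
  have hB0 : 0 ≤ B := by positivity
  -- A majorant: `A` in the bulk, where omitted zeros are far, and the crude pointwise bound `B`
  -- within 3/2 of the two endpoints.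
  set g : ℝ → ℝ := (Set.Ioc 0 T).indicator (fun _ => A)
    + (Set.Ioc (0 : ℝ) (3 / 2)).indicator (fun _ => B)
    + (Set.Ioc (T - 3 / 2) T).indicator (fun _ => B) with hg
  have hgi : ∀ (u v c : ℝ), Integrable ((Set.Ioc u v).indicator (fun _ => c)) := fun u v c =>
    (integrable_indicator_iff measurableSet_Ioc).2 (integrableOn_const (by simp))
  have hD0 : ∀ t, 0 ≤ sigmaSum a t - zeroSum T a t := fun t =>
    sub_nonneg.2 (zeroSum_le_sigmaSum hRH ha T t)
  have hmono : ∫ t, (Set.Ioc 0 T).indicator (fun t => sigmaSum a t - zeroSum T a t) t ^ k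
      ≤ ∫ t, g t := by
    refine integral_mono_of_nonneg (Eventually.of_forall fun t => ?_)
      (((hgi _ _ _).add (hgi _ _ _)).add (hgi _ _ _)) (Eventually.of_forall fun t => ?_)
    · exact pow_nonneg (Set.indicator_nonneg (fun t _ => hD0 t) t) k
    · simp only [hg, Pi.add_apply]
      have n1 : 0 ≤ (Set.Ioc (0 : ℝ) (3 / 2)).indicator (fun _ => B) t :=
        Set.indicator_nonneg (fun _ _ => hB0) t
      have n2 : 0 ≤ (Set.Ioc (T - 3 / 2) T).indicator (fun _ => B) t :=
        Set.indicator_nonneg (fun _ _ => hB0) t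
      have n3 : 0 ≤ (Set.Ioc 0 T).indicator (fun _ => A) t :=
        Set.indicator_nonneg (fun _ _ => hA0) t
      by_cases ht : t ∈ Set.Ioc 0 T
      · rw [Set.indicator_of_mem ht]
        obtain ⟨ht0, htT⟩ := ht
        obtain ⟨h1, h2⟩ := h a T t ha ha' hT (by rw [abs_of_pos ht0]; linarith)
        have hDle : (sigmaSum a t - zeroSum T a t) ^ k ≤ B := by
          refine pow_le_pow_left₀ (hD0 t) ?_ k
          linarith [zeroSum_nonneg T a t]
        by_cases c1 : t ≤ 3 / 2
        · have : (Set.Ioc (0 : ℝ) (3 / 2)).indicator (fun _ => B) t = B :=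
            Set.indicator_of_mem (Set.mem_Ioc.2 ⟨ht0, c1⟩) _
          linarith
        by_cases c2 : T - 3 / 2 < t
        · have : (Set.Ioc (T - 3 / 2) T).indicator (fun _ => B) t = B :=
            Set.indicator_of_mem (Set.mem_Ioc.2 ⟨c2, htT⟩) _
          linarith
        have : (Set.Ioc 0 T).indicator (fun _ => A) t = A := Set.indicator_of_mem (Set.mem_Ioc.2 ⟨ht0, htT⟩) _
        have : (sigmaSum a t - zeroSum T a t) ^ k ≤ A := by
          refine pow_le_pow_left₀ (hD0 t) ?_ k
          have := sigmaSum_sub_zeroSum_le hRH ha (le_of_not_ge c1) (not_lt.1 c2)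
          linarith
        linarith
      · rw [Set.indicator_of_notMem ht, zero_pow hk]
        linarith
  have hint : ∫ t, g t = T * A + 3 * B := by
    have hv : ∀ (u v c : ℝ), u ≤ v → ∫ t, (Set.Ioc u v).indicator (fun _ => c) t = (v - u) * c := by
      intro u v c huv
      rw [integral_indicator measurableSet_Ioc, setIntegral_const, smul_eq_mul,
        Real.volume_real_Ioc_of_le huv]
    rw [hg, integral_add' ((hgi _ _ _).add (hgi _ _ _)) (hgi _ _ _),
      integral_add' (hgi _ _ _) (hgi _ _ _), hv _ _ _ (by linarith), hv _ _ _ (by norm_num),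
      hv _ _ _ (by linarith)]
    ring
  refine hmono.trans (hint.le.trans ?_)
  have e1 : A = (2 * K) ^ k * Real.log T ^ k := by rw [hA, mul_pow]
  have e2 : B = K ^ k * (Real.log T / a ^ 2) ^ k := by rw [hB, mul_pow]
  rw [e1, e2]
  have p1 : 0 ≤ (2 * K) ^ k := by positivity
  have p2 : 0 ≤ K ^ k := by positivity
  have p3 : 0 ≤ T * Real.log T ^ k := by positivity
  have p4 : 0 ≤ (Real.log T / a ^ 2) ^ k := by positivity
  nlinarith [mul_nonneg p1 p4, mul_nonneg p2 p3]

/-- The zeros in `(0, T)` contribute little outside `(0, T]`. -/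
theorem exists_integral_compl_zeroSum_pow_le (hRH : RiemannHypothesis) (k : ℕ) :
    ∃ K : ℝ, 0 < K ∧ ∀ a T : ℝ, 0 < a → a ≤ 3 / 2 → 3 ≤ T →
    ∫ t, (Set.Ioc 0 T)ᶜ.indicator (zeroSum T a) t ^ (k + 1)
      ≤ K * ((zerosBelow T).card * Real.log T ^ k + (Real.log T / a ^ 2) ^ (k + 1)) := by
  obtain ⟨K, hK, h⟩ := exists_sigmaSum_bounds hRH
  refine ⟨2 * (2 * K) ^ k * (Real.pi / (3 / 2)) + 3 * K ^ (k + 1), by positivity,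
    fun a T ha ha' hT => ?_⟩
  have hLpos : 0 < Real.log T := Real.log_pos (by linarith)
  set A := 2 * (2 * K * Real.log T) ^ k with hA
  set B := (K * (Real.log T / a ^ 2)) ^ (k + 1) with hB
  have hA0 : 0 ≤ A := by positivity
  have hB0 : 0 ≤ B := by positivity
  -- At distance 3/2 or more from [0,T], k of the k+1 factors are bounded by multiples of log T; one
  -- is kept so that the majorant is integrable. The two short intervals next to the endpoints use
  -- the crude bound `B`.
  set g : ℝ → ℝ := (fun t => A * zeroSum T (3 / 2) t)
    + (Set.Icc (-(3 / 2) : ℝ) 0).indicator (fun _ => B)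
    + (Set.Icc T (T + 3 / 2)).indicator (fun _ => B) with hg
  have hgi : ∀ (u v c : ℝ), Integrable ((Set.Icc u v).indicator (fun _ => c)) := fun u v c =>
    (integrable_indicator_iff measurableSet_Icc).2 (integrableOn_const (by simp))
  have hZi := (integrable_zeroSum (by norm_num : (0 : ℝ) < 3 / 2) T).const_mul A
  have hmono : ∫ t, (Set.Ioc 0 T)ᶜ.indicator (zeroSum T a) t ^ (k + 1) ≤ ∫ t, g t := by
    refine integral_mono_of_nonneg (Eventually.of_forall fun t => ?_)
      ((hZi.add (hgi _ _ _)).add (hgi _ _ _)) (Eventually.of_forall fun t => ?_)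
    · exact pow_nonneg (Set.indicator_nonneg (fun t _ => zeroSum_nonneg T a t) t) _
    · simp only [hg, Pi.add_apply]
      have n1 : 0 ≤ (Set.Icc (-(3 / 2) : ℝ) 0).indicator (fun _ => B) t :=
        Set.indicator_nonneg (fun _ _ => hB0) t
      have n2 : 0 ≤ (Set.Icc T (T + 3 / 2)).indicator (fun _ => B) t :=
        Set.indicator_nonneg (fun _ _ => hB0) t
      have n3 : 0 ≤ A * zeroSum T (3 / 2) t := mul_nonneg hA0 (zeroSum_nonneg _ _ _)
      by_cases ht : t ∈ Set.Ioc 0 T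
      · rw [Set.indicator_of_notMem (by simpa using ht), zero_pow (by omega)]
        linarith
      · rw [Set.indicator_of_mem (by simpa using ht)]
        have hnear : |t| ≤ T + 2 → zeroSum T a t ^ (k + 1) ≤ B := fun hb =>
          pow_le_pow_left₀ (zeroSum_nonneg T a t)
            ((zeroSum_le_sigmaSum hRH ha T t).trans (h a T t ha ha' hT hb).2) _
        have hfar : (t ≤ -(3 / 2) ∨ T + 3 / 2 ≤ t) → zeroSum T a t ^ (k + 1)
            ≤ A * zeroSum T (3 / 2) t := by
          intro hf
          have h1 := zeroSum_le_two_mul (a := a) hf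
          have h2 : zeroSum T (3 / 2) t ≤ K * Real.log T := by
            rcases hf with hf | hf
            · refine (zeroSum_le_zero (by norm_num) (by linarith)).trans
                ((zeroSum_le_sigmaSum hRH (by norm_num) T 0).trans
                (h a T 0 ha ha' hT (by simp; linarith)).1)
            · refine (zeroSum_le_self (by norm_num) (by linarith)).trans
                ((zeroSum_le_sigmaSum hRH (by norm_num) T T).trans
                (h a T T ha ha' hT (by rw [abs_of_pos] <;> linarith)).1)
          have h3 := zeroSum_nonneg T (3 / 2) t
          calc zeroSum T a t ^ (k + 1) ≤ (2 * zeroSum T (3 / 2) t) ^ (k + 1) :=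
                pow_le_pow_left₀ (zeroSum_nonneg T a t) h1 _
            _ = 2 * (2 * zeroSum T (3 / 2) t) ^ k * zeroSum T (3 / 2) t := by ring
            _ ≤ 2 * (2 * (K * Real.log T)) ^ k * zeroSum T (3 / 2) t := by gcongr
            _ = A * zeroSum T (3 / 2) t := by rw [hA, mul_assoc 2 K]
        rw [Set.mem_Ioc, not_and_or, not_lt, not_le] at ht
        rcases ht with ht | ht
        · by_cases c : t ≤ -(3 / 2)
          · linarith [hfar (Or.inl c)]
          · have : (Set.Icc (-(3 / 2) : ℝ) 0).indicator (fun _ => B) t = B :=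
              Set.indicator_of_mem (Set.mem_Icc.2 ⟨(not_le.1 c).le, ht⟩) _
            linarith [hnear (by rw [abs_of_nonpos ht]; linarith)]
        · by_cases c : T + 3 / 2 ≤ t
          · linarith [hfar (Or.inr c)]
          · have : (Set.Icc T (T + 3 / 2)).indicator (fun _ => B) t = B :=
              Set.indicator_of_mem (Set.mem_Icc.2 ⟨ht.le, (not_le.1 c).le⟩) _
            linarith [hnear (by rw [abs_of_pos (by linarith)]; linarith)]
  have hint : ∫ t, g t = A * (Real.pi / (3 / 2) * (zerosBelow T).card) + 3 * B := by
    have hv : ∀ (u v c : ℝ), u ≤ v → ∫ t, (Set.Icc u v).indicator (fun _ => c) t = (v - u) * c := by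
      intro u v c huv
      rw [integral_indicator measurableSet_Icc, setIntegral_const, smul_eq_mul,
        Real.volume_real_Icc_of_le huv]
    rw [hg, integral_add' (hZi.add (hgi _ _ _)) (hgi _ _ _),
      integral_add' hZi (hgi _ _ _), hv _ _ _ (by norm_num), hv _ _ _ (by linarith),
      integral_const_mul, integral_zeroSum (by norm_num)]
    ring
  refine hmono.trans (hint.le.trans ?_)
  have e1 : A = 2 * (2 * K) ^ k * Real.log T ^ k := by rw [hA, mul_pow]; ring
  have e2 : B = K ^ (k + 1) * (Real.log T / a ^ 2) ^ (k + 1) := by rw [hB, mul_pow]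
  rw [e1, e2]
  set q := Real.pi / (3 / 2) with hq
  have hq0 : 0 < q := by positivity
  have p1 : 0 ≤ 2 * (2 * K) ^ k * q := by positivity
  have p2 : 0 ≤ K ^ (k + 1) := by positivity
  have p3 : 0 ≤ (zerosBelow T).card * Real.log T ^ k := by positivity
  have p4 : 0 ≤ (Real.log T / a ^ 2) ^ (k + 1) := by positivity
  nlinarith [mul_nonneg p1 p4, mul_nonneg p2 p3]

end Truncation

/-! ### Comparison of k-th moments by Minkowski's inequality -/

section Norms

open MeasureTheory ENNReal

/-- The `Lᵏ` norm of `f`, divided by `S^{1/k}`. -/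
noncomputable def scaledNorm (k : ℕ) (S : ℝ) (f : ℝ → ℝ) : ℝ :=
  lpNorm f (k : ℝ≥0∞) volume / S ^ (1 / (k : ℝ))

theorem scaledNorm_nonneg {k : ℕ} {S : ℝ} (hS : 0 ≤ S) (f : ℝ → ℝ) : 0 ≤ scaledNorm k S f :=
  div_nonneg lpNorm_nonneg (Real.rpow_nonneg hS _)

theorem scaledNorm_pow {k : ℕ} (hk : k ≠ 0) {S : ℝ} (hS : 0 ≤ S) {f : ℝ → ℝ}
    (hf : AEStronglyMeasurable f) (hf0 : ∀ t, 0 ≤ f t) :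
    scaledNorm k S f ^ k = (∫ t, f t ^ k) / S := by
  have hk' : (k : ℝ) ≠ 0 := Nat.cast_ne_zero.2 hk
  unfold scaledNorm
  rw [lpNorm_eq_integral_norm_rpow_toReal (by exact_mod_cast hk) (by simp) hf, div_pow,
    ← Real.rpow_natCast, ← Real.rpow_natCast, ← Real.rpow_mul (integral_nonneg fun _ => by positivity),
    ← Real.rpow_mul hS]
  simp only [ENNReal.toReal_natCast, Real.rpow_natCast, Real.norm_eq_abs, abs_of_nonneg (hf0 _),
    inv_mul_cancel₀ hk', one_div, Real.rpow_one]

theorem memLp_of_integrable_pow {k : ℕ} (hk : k ≠ 0) {f : ℝ → ℝ}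
    (hf : AEStronglyMeasurable f) (hf0 : ∀ t, 0 ≤ f t) (hi : Integrable fun t => f t ^ k) :
    MemLp f (k : ℝ≥0∞) := by
  rw [← integrable_norm_rpow_iff hf (by exact_mod_cast hk) (by simp)]
  simpa only [ENNReal.toReal_natCast, Real.rpow_natCast, Real.norm_eq_abs, abs_of_nonneg (hf0 _)]

/-- Reverse triangle inequality in Lᵏ. Working with norms in place of integrals of powers makes
small perturbations additive for every k at once. -/
theorem abs_scaledNorm_sub_le {k : ℕ} (hk : k ≠ 0) {S : ℝ} (hS : 0 ≤ S) {f g d : ℝ → ℝ}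
    (hf : MemLp f (k : ℝ≥0∞)) (hg : MemLp g (k : ℝ≥0∞)) (hd : MemLp d (k : ℝ≥0∞))
    (h : ∀ t, |f t - g t| ≤ d t) :
    |scaledNorm k S f - scaledNorm k S g| ≤ scaledNorm k S d := by
  have hk1 : (1 : ℝ≥0∞) ≤ k := by exact_mod_cast Nat.one_le_iff_ne_zero.2 hk
  have hS' : 0 ≤ S ^ (1 / (k : ℝ)) := Real.rpow_nonneg hS _
  have h0 : lpNorm (f - g) k volume ≤ lpNorm d k volume :=
    lpNorm_mono_real hd fun t => by simpa using h t
  have h1 : lpNorm f k volume ≤ lpNorm g k volume + lpNorm (f - g) k volume :=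
    lpNorm_le_lpNorm_add_lpNorm_sub' hg hk1
  have h2 : lpNorm g k volume ≤ lpNorm f k volume + lpNorm (f - g) k volume := by
    rw [lpNorm_sub_comm]
    exact lpNorm_le_lpNorm_add_lpNorm_sub' hf hk1
  unfold scaledNorm
  rw [← sub_div, abs_div, abs_of_nonneg hS']
  gcongr
  rw [abs_le]
  constructor <;> linarith

theorem tendsto_of_tendsto_pow {ι : Type*} {l : Filter ι} {k : ℕ} (hk : k ≠ 0) {r : ι → ℝ}
    {x : ℝ} (hr : ∀ᶠ i in l, 0 ≤ r i) (h : Tendsto (fun i => r i ^ k) l (𝓝 x)) :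
    Tendsto r l (𝓝 (x ^ (1 / (k : ℝ)))) := by
  have h1 := h.rpow_const (p := 1 / (k : ℝ)) (Or.inr (by positivity))
  refine h1.congr' ?_
  filter_upwards [hr] with i hi
  rw [one_div, Real.pow_rpow_inv_natCast hi hk]

/-- Asymptotics of `k`-th moments are insensitive to changes that are small in `k`-th mean. -/
theorem tendsto_integral_pow_of_abs_sub_le {k : ℕ} (hk : k ≠ 0) {f g d : ℝ → ℝ → ℝ} {S : ℝ → ℝ}
    {x : ℝ} (hx : 0 ≤ x) (hS : ∀ᶠ T in atTop, 0 < S T)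
    (hf : ∀ᶠ T in atTop, MemLp (f T) (k : ℝ≥0∞) ∧ ∀ t, 0 ≤ f T t)
    (hg : ∀ᶠ T in atTop, MemLp (g T) (k : ℝ≥0∞) ∧ ∀ t, 0 ≤ g T t)
    (hd : ∀ᶠ T in atTop, MemLp (d T) (k : ℝ≥0∞) ∧ ∀ t, |f T t - g T t| ≤ d T t)
    (hgl : Tendsto (fun T => (∫ t, g T t ^ k) / S T) atTop (𝓝 x))
    (hdl : Tendsto (fun T => (∫ t, d T t ^ k) / S T) atTop (𝓝 0)) :
    Tendsto (fun T => (∫ t, f T t ^ k) / S T) atTop (𝓝 x) := by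
  have hkinv : (1 / (k : ℝ)) ≠ 0 := by positivity
  have hGn : Tendsto (fun T => scaledNorm k (S T) (g T)) atTop (𝓝 (x ^ (1 / (k : ℝ)))) := by
    refine tendsto_of_tendsto_pow hk ?_ (hgl.congr' ?_)
    · filter_upwards [hS] with T hT using scaledNorm_nonneg hT.le _
    · filter_upwards [hS, hg] with T hT hg'
      exact (scaledNorm_pow hk hT.le hg'.1.1 hg'.2).symm
  have hDn : Tendsto (fun T => scaledNorm k (S T) (d T)) atTop (𝓝 0) := by
    rw [← Real.zero_rpow hkinv]
    refine tendsto_of_tendsto_pow hk ?_ (hdl.congr' ?_)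
    · filter_upwards [hS] with T hT using scaledNorm_nonneg hT.le _
    · filter_upwards [hS, hd] with T hT hd'
      exact (scaledNorm_pow hk hT.le hd'.1.1 fun t => (abs_nonneg _).trans (hd'.2 t)).symm
  have hFn : Tendsto (fun T => scaledNorm k (S T) (f T)) atTop (𝓝 (x ^ (1 / (k : ℝ)))) := by
    have hsub : Tendsto (fun T => scaledNorm k (S T) (f T) - scaledNorm k (S T) (g T)) atTop
        (𝓝 0) := by
      refine squeeze_zero_norm' ?_ hDn
      filter_upwards [hS, hf, hg, hd] with T hT hf' hg' hd'
      exact abs_scaledNorm_sub_le hk hT.le hf'.1 hg'.1 hd'.1 hd'.2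
    simpa using hsub.add hGn
  have := hFn.pow k
  rw [one_div, Real.rpow_inv_natCast_pow hx hk] at this
  refine this.congr' ?_
  filter_upwards [hS, hf] with T hT hf'
  exact scaledNorm_pow hk hT.le hf'.1.1 hf'.2

end Norms

/-! ### Negligible boundary effects and the number of zeros -/

section Boundary

open MeasureTheory ENNReal

theorem integrable_zeroSum_pow {a : ℝ} (ha : 0 < a) (T : ℝ) {k : ℕ} (hk : k ≠ 0) :
    Integrable fun t => zeroSum T a t ^ k := by
  obtain ⟨k, rfl⟩ := Nat.exists_eq_succ_of_ne_zero hk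
  have hb : ∀ t, zeroSum T a t ≤ (zerosBelow T).card * (1 / a ^ 2) := by
    intro t
    unfold zeroSum
    rw [← nsmul_eq_mul]
    refine Finset.sum_le_card_nsmul _ _ _ fun j _ => ?_
    exact one_div_le_one_div_of_le (by positivity) (by nlinarith [sq_nonneg (t - j.ordinate)])
  simp_rw [pow_succ]
  refine (integrable_zeroSum ha T).bdd_mul (c := ((zerosBelow T).card * (1 / a ^ 2)) ^ k)
    (((continuous_zeroSum ha T).pow k).aestronglyMeasurable) (Eventually.of_forall fun t => ?_)
  rw [Real.norm_eq_abs, abs_of_nonneg (pow_nonneg (zeroSum_nonneg T a t) k)]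
  exact pow_le_pow_left₀ (zeroSum_nonneg T a t) (hb t) k

theorem integrable_indicator_sigmaSum_pow (hRH : RiemannHypothesis) {a : ℝ} (ha : 0 < a) (T : ℝ)
    {k : ℕ} (hk : k ≠ 0) :
    Integrable fun t => (Set.Ioc 0 T).indicator (sigmaSum a) t ^ k := by
  have : (fun t => (Set.Ioc 0 T).indicator (sigmaSum a) t ^ k)
      = (Set.Ioc 0 T).indicator (fun t => sigmaSum a t ^ k) := by
    ext t
    by_cases ht : t ∈ Set.Ioc 0 T
    · simp [ht]
    · simp [ht, hk]
  rw [this, integrable_indicator_iff measurableSet_Ioc]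
  exact (((continuous_sigmaSum hRH ha).pow k).integrableOn_Icc).mono_set Set.Ioc_subset_Icc_self

theorem abs_indicator_sigmaSum_sub_zeroSum (hRH : RiemannHypothesis) {a : ℝ} (ha : 0 < a)
    (T t : ℝ) : |(Set.Ioc 0 T).indicator (sigmaSum a) t - zeroSum T a t|
      = (Set.Ioc 0 T).indicator (fun t => sigmaSum a t - zeroSum T a t) t
        + (Set.Ioc 0 T)ᶜ.indicator (zeroSum T a) t := by
  by_cases ht : t ∈ Set.Ioc 0 T
  · rw [Set.indicator_of_mem ht, Set.indicator_of_mem ht, Set.indicator_of_notMem (by simpa using ht),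
      add_zero, abs_of_nonneg (sub_nonneg.2 (zeroSum_le_sigmaSum hRH ha T t))]
  · rw [Set.indicator_of_notMem ht, Set.indicator_of_notMem ht,
      Set.indicator_of_mem (by simpa using ht), zero_add, zero_sub, abs_neg,
      abs_of_nonneg (zeroSum_nonneg T a t)]

/-- The error on (0,T] comes from omitted zeros and the error off it from included ones. The two
pieces have disjoint supports, so their k-th powers add without cross terms. -/
theorem exists_integral_abs_sub_pow_le (hRH : RiemannHypothesis) {k : ℕ} (hk : k ≠ 0) :
    ∃ K : ℝ, 0 < K ∧ ∀ a T : ℝ, 0 < a → a ≤ 3 / 2 → 3 ≤ T →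
      (Integrable fun t => |(Set.Ioc 0 T).indicator (sigmaSum a) t - zeroSum T a t| ^ k) ∧
      ∫ t, |(Set.Ioc 0 T).indicator (sigmaSum a) t - zeroSum T a t| ^ k
      ≤ K * (T * Real.log T ^ k + (zerosBelow T).card * Real.log T ^ (k - 1)
        + (Real.log T / a ^ 2) ^ k) := by
  obtain ⟨K₁, hK₁, h₁⟩ := exists_integral_sub_zeroSum_pow_le hRH k hk
  obtain ⟨k, rfl⟩ := Nat.exists_eq_succ_of_ne_zero hk
  obtain ⟨K₂, hK₂, h₂⟩ := exists_integral_compl_zeroSum_pow_le hRH k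
  refine ⟨K₁ + K₂, by positivity, fun a T ha ha' hT => ?_⟩
  have hL : 0 < Real.log T := Real.log_pos (by linarith)
  have e : ∀ t, |(Set.Ioc 0 T).indicator (sigmaSum a) t - zeroSum T a t| ^ (k + 1)
      = (Set.Ioc 0 T).indicator (fun t => sigmaSum a t - zeroSum T a t) t ^ (k + 1)
        + (Set.Ioc 0 T)ᶜ.indicator (zeroSum T a) t ^ (k + 1) := by
    intro t
    rw [abs_indicator_sigmaSum_sub_zeroSum hRH ha]
    by_cases ht : t ∈ Set.Ioc 0 T
    · simp [ht]
    · simp [ht]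
  have i1 : Integrable fun t => (Set.Ioc 0 T).indicator
      (fun t => sigmaSum a t - zeroSum T a t) t ^ (k + 1) := by
    have : (fun t => (Set.Ioc 0 T).indicator (fun t => sigmaSum a t - zeroSum T a t) t ^ (k + 1))
        = (Set.Ioc 0 T).indicator (fun t => (sigmaSum a t - zeroSum T a t) ^ (k + 1)) := by
      ext t
      by_cases ht : t ∈ Set.Ioc 0 T <;> simp [ht]
    rw [this, integrable_indicator_iff measurableSet_Ioc]
    exact ((((continuous_sigmaSum hRH ha).sub (continuous_zeroSum ha T)).pow
      (k + 1)).integrableOn_Icc).mono_set Set.Ioc_subset_Icc_self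
  have i2 : Integrable fun t => (Set.Ioc 0 T)ᶜ.indicator (zeroSum T a) t ^ (k + 1) := by
    have : (fun t => (Set.Ioc 0 T)ᶜ.indicator (zeroSum T a) t ^ (k + 1))
        = (Set.Ioc 0 T)ᶜ.indicator (fun t => zeroSum T a t ^ (k + 1)) := by
      ext t
      by_cases ht : t ∈ Set.Ioc 0 T <;> simp [ht]
    rw [this]
    exact (integrable_zeroSum_pow ha T hk).indicator measurableSet_Ioc.compl
  simp_rw [Nat.succ_eq_add_one, e]
  refine ⟨i1.add i2, ?_⟩
  rw [integral_add i1 i2]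
  have b1 := h₁ a T ha ha' hT
  have b2 := h₂ a T ha ha' hT
  have p1 : 0 ≤ T * Real.log T ^ (k + 1) := by positivity
  have p2 : 0 ≤ (zerosBelow T).card * Real.log T ^ k := by positivity
  have p3 : 0 ≤ (Real.log T / a ^ 2) ^ (k + 1) := by positivity
  simp only [Nat.succ_eq_add_one, add_tsub_cancel_right] at b1 b2 ⊢
  nlinarith [mul_nonneg hK₁.le p2, mul_nonneg hK₂.le p1]

theorem integral_indicator_sigmaSum_pow {a T : ℝ} (hT : 0 ≤ T) {k : ℕ} (hk : k ≠ 0) :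
    ∫ t, (Set.Ioc 0 T).indicator (sigmaSum a) t ^ k = ∫ t in (0 : ℝ)..T, sigmaSum a t ^ k := by
  rw [intervalIntegral.integral_of_le hT, ← integral_indicator measurableSet_Ioc]
  congr 1
  ext t
  by_cases ht : t ∈ Set.Ioc 0 T <;> simp [ht, hk]

theorem tendsto_pow_log_div_self (n : ℕ) :
    Tendsto (fun T : ℝ => Real.log T ^ n / T) atTop (𝓝 0) := by
  have := isLittleO_log_rpow_rpow_atTop (s := 1) (n : ℝ) one_pos
  simpa using this.tendsto_div_nhds_zero

/-- The main term of the Riemann–von Mangoldt formula. -/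
theorem tendsto_card_zerosBelow (hRH : RiemannHypothesis) :
    Tendsto (fun T : ℝ => ((zerosBelow T).card : ℝ) / (T * Real.log T)) atTop
      (𝓝 (1 / (2 * Real.pi))) := by
  obtain ⟨K₁, hK₁, h₁⟩ := exists_integral_abs_sub_pow_le hRH (k := 1) one_ne_zero
  obtain ⟨K₂, hK₂, h₂⟩ := exists_abs_integral_sigmaSum_sub_le hRH
  have hlog1 : ∀ᶠ T : ℝ in atTop, 1 ≤ Real.log T := Real.tendsto_log_atTop.eventually_ge_atTop 1
  have hmain : ∀ᶠ T : ℝ in atTop, |Real.pi * (((zerosBelow T).card : ℝ) / (T * Real.log T)) - 1 / 2|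
      ≤ (3 * K₁ + K₂ + (Real.log (2 * Real.pi) + 1)) *
        ((1 + ((zerosBelow T).card : ℝ) / (T * Real.log T)) / Real.log T + Real.log T ^ 1 / T) := by
    filter_upwards [eventually_ge_atTop 3, hlog1] with T hT hL
    set L := Real.log T with hLdef
    set N : ℝ := ((zerosBelow T).card : ℝ) with hN
    have hN0 : 0 ≤ N := Nat.cast_nonneg _
    -- With a = 1/L the sum over zeros in (0,T) has total mass πL·N, while the first moment of Σ_a
    -- is TL²/2 up to lower order. The errors T·L, N and L³ are all of smaller order once N is known
    -- to be O(T·L).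
    have ha : 0 < 1 / L := by positivity
    have ha' : 1 / L ≤ 3 / 2 := by
      rw [div_le_iff₀ (by positivity)]; linarith
    obtain ⟨i1, b1⟩ := h₁ (1 / L) T ha ha' hT
    have b2 := h₂ (1 / L) T ha ha' hT
    have hX := integral_zeroSum ha T
    have hiS := integrable_indicator_sigmaSum_pow hRH ha T one_ne_zero
    have hSi := integral_indicator_sigmaSum_pow (a := 1 / L) (T := T) (by linarith) one_ne_zero
    simp only [pow_one] at i1 b1 hiS hSi
    have b3 : |(∫ t in (0 : ℝ)..T, sigmaSum (1 / L) t) - Real.pi / (1 / L) * N|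
        ≤ K₁ * (T * L + N * L ^ (1 - 1) + L / (1 / L) ^ 2) := by
      rw [← hX, ← hSi, ← integral_sub hiS (integrable_zeroSum ha T)]
      exact (abs_integral_le_integral_abs).trans b1
    have hlog : Real.log (T / (2 * Real.pi)) = L - Real.log (2 * Real.pi) :=
      Real.log_div (by positivity) (by positivity)
    rw [hlog] at b2
    have hT0 : 0 < T := by linarith
    have hq : 0 ≤ Real.log (2 * Real.pi) := Real.log_nonneg (by linarith [Real.pi_gt_three])
    set q := Real.log (2 * Real.pi) with hqdef
    have e1 : Real.pi / (1 / L) * N = Real.pi * L * N := by field_simp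
    have e2 : 1 / (2 * (1 / L)) * (T * (L - q) - T) = T * L ^ 2 / 2 - (q + 1) * (T * L) / 2 := by
      field_simp
      ring
    have e3 : L / (1 / L) ^ 2 = L ^ 3 := by field_simp
    have e4 : K₂ * L / (1 / L) = K₂ * L ^ 2 := by field_simp
    rw [e1, e3, Nat.sub_self, pow_zero, mul_one] at b3
    rw [e2, e4] at b2
    have b4 : |Real.pi * L * N - T * L ^ 2 / 2| ≤ K₁ * (T * L + N + L ^ 3) + K₂ * L ^ 2
        + (q + 1) * (T * L) / 2 := by
      rw [abs_le] at b2 b3 ⊢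
      have : 0 ≤ (q + 1) * (T * L) / 2 := by positivity
      constructor <;> linarith [b2.1, b2.2, b3.1, b3.2]
    have hpos : 0 < T * L ^ 2 := by positivity
    have e5 : Real.pi * (N / (T * L)) - 1 / 2 = (Real.pi * L * N - T * L ^ 2 / 2) / (T * L ^ 2) := by
      field_simp
    rw [e5, abs_div, abs_of_pos hpos, div_le_iff₀ hpos]
    refine b4.trans ?_
    have e6 : (3 * K₁ + K₂ + (q + 1)) * ((1 + N / (T * L)) / L + L ^ 1 / T) * (T * L ^ 2)
        = (3 * K₁ + K₂ + (q + 1)) * (T * L + N + L ^ 3) := by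
      field_simp
    rw [e6]
    have m1 : 0 ≤ T * L := by positivity
    have m2 : L ^ 2 ≤ L ^ 3 := pow_le_pow_right₀ hL (by norm_num)
    have m3 : 0 ≤ L ^ 3 := by positivity
    have m4 : K₂ * L ^ 2 ≤ K₂ * (T * L + N + L ^ 3) := by
      gcongr; linarith
    have m5 : (q + 1) * (T * L) / 2 ≤ (q + 1) * (T * L + N + L ^ 3) := by
      have := mul_nonneg (by linarith : 0 ≤ q + 1) (by linarith : 0 ≤ T * L + 2 * N + 2 * L ^ 3)
      linarith
    have m6 : 0 ≤ K₁ * (T * L + N + L ^ 3) := by positivity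
    linarith
  set K := 3 * K₁ + K₂ + (Real.log (2 * Real.pi) + 1) with hK
  have hq : 0 ≤ Real.log (2 * Real.pi) := Real.log_nonneg (by linarith [Real.pi_gt_three])
  have hKpos : 0 < K := by positivity
  have hinv : Tendsto (fun T : ℝ => (Real.log T)⁻¹) atTop (𝓝 0) :=
    tendsto_inv_atTop_zero.comp Real.tendsto_log_atTop
  have hsmall : ∀ᶠ T : ℝ in atTop, (Real.log T)⁻¹ < 1 / K := hinv.eventually_lt_const (by positivity)
  have hsmall2 : ∀ᶠ T : ℝ in atTop, Real.log T ^ 1 / T < 1 / K :=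
    (tendsto_pow_log_div_self 1).eventually_lt_const (by positivity)
  -- A bootstrap: the error bound contains the count itself, but divided by log T, so it can be
  -- absorbed into the left side.
  have hbdd : ∀ᶠ T : ℝ in atTop, ((zerosBelow T).card : ℝ) / (T * Real.log T) ≤ 2 := by
    filter_upwards [hmain, hsmall, hsmall2, hlog1, eventually_ge_atTop 3] with T h1 h2 h3 hL hT
    set n := ((zerosBelow T).card : ℝ) / (T * Real.log T) with hn
    have hn0 : 0 ≤ n := by positivity
    have h4 : K * ((1 + n) / Real.log T + Real.log T ^ 1 / T) ≤ K * ((1 + n) * (1 / K) + 1 / K) := by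
      rw [div_eq_mul_inv (1 + n)]
      gcongr
    have h5 : K * ((1 + n) * (1 / K) + 1 / K) = 2 + n := by
      field_simp
      ring
    rw [h5] at h4
    have := (abs_le.1 (h1.trans h4)).2
    nlinarith [Real.pi_gt_three]
  have hlim : Tendsto (fun T : ℝ => K * (3 * (Real.log T)⁻¹ + Real.log T ^ 1 / T)) atTop (𝓝 0) := by
    simpa using ((hinv.const_mul 3).add (tendsto_pow_log_div_self 1)).const_mul K
  have hpi : Tendsto (fun T : ℝ => Real.pi * (((zerosBelow T).card : ℝ) / (T * Real.log T)) - 1 / 2)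
      atTop (𝓝 0) := by
    refine squeeze_zero_norm' ?_ hlim
    filter_upwards [hmain, hbdd, hlog1, eventually_ge_atTop 3] with T h1 h2 hL hT
    refine h1.trans ?_
    rw [div_eq_mul_inv (1 + _)]
    have : 0 ≤ (Real.log T)⁻¹ := by positivity
    gcongr
    linarith
  have := (hpi.add_const (1 / 2)).div_const Real.pi
  have hpi0 := Real.pi_ne_zero
  refine (this.congr fun T => ?_).trans_eq ?_
  · field_simp
    ring
  · congr 1
    field_simp
    ring

/-- The moments of `Σ_a` over `[0, T]` follow from those of the sum over the zeros in `(0, T)`. -/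
theorem tendsto_integral_sigmaSum_pow_of_zeroSum (hRH : RiemannHypothesis) {α : ℝ} (hα : 0 < α)
    {k : ℕ} (hk : k ≠ 0) {x : ℝ} (hx : 0 ≤ x)
    (h : Tendsto (fun T : ℝ => (∫ t, zeroSum T (α / Real.log T) t ^ k) / (T * Real.log T ^ (2 * k)))
      atTop (𝓝 x)) :
    Tendsto (fun T : ℝ => (∫ t in (0 : ℝ)..T, sigmaSum (α / Real.log T) t ^ k)
      / (T * Real.log T ^ (2 * k))) atTop (𝓝 x) := by
  obtain ⟨K, hK, hb⟩ := exists_integral_abs_sub_pow_le hRH hk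
  have hlog1 : ∀ᶠ T : ℝ in atTop, max 1 α ≤ Real.log T :=
    Real.tendsto_log_atTop.eventually_ge_atTop _
  have key := tendsto_integral_pow_of_abs_sub_le hk (S := fun T => T * Real.log T ^ (2 * k))
    (f := fun T => (Set.Ioc 0 T).indicator (sigmaSum (α / Real.log T)))
    (g := fun T => zeroSum T (α / Real.log T))
    (d := fun T t => |(Set.Ioc 0 T).indicator (sigmaSum (α / Real.log T)) t
      - zeroSum T (α / Real.log T) t|) hx ?_ ?_ ?_ ?_ h ?_
  · refine key.congr' ?_
    filter_upwards [eventually_ge_atTop 0] with T hT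
    rw [integral_indicator_sigmaSum_pow hT hk]
  · filter_upwards [hlog1, eventually_ge_atTop 3] with T hL hT
    have : 0 < Real.log T := lt_of_lt_of_le one_pos ((le_max_left _ _).trans hL)
    positivity
  · filter_upwards [hlog1] with T hL
    have hL1 : 0 < Real.log T := lt_of_lt_of_le one_pos ((le_max_left _ _).trans hL)
    have ha : 0 < α / Real.log T := by positivity
    have h0 : ∀ t, 0 ≤ (Set.Ioc 0 T).indicator (sigmaSum (α / Real.log T)) t :=
      fun t => Set.indicator_nonneg (fun t _ => sigmaSum_nonneg _ _) t
    exact ⟨memLp_of_integrable_pow hk (((continuous_sigmaSum hRH ha).measurable.indicator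
      measurableSet_Ioc).aestronglyMeasurable) h0 (integrable_indicator_sigmaSum_pow hRH ha T hk), h0⟩
  · filter_upwards [hlog1] with T hL
    have hL1 : 0 < Real.log T := lt_of_lt_of_le one_pos ((le_max_left _ _).trans hL)
    have ha : 0 < α / Real.log T := by positivity
    exact ⟨memLp_of_integrable_pow hk (continuous_zeroSum ha T).aestronglyMeasurable
      (zeroSum_nonneg _ _) (integrable_zeroSum_pow ha T hk), zeroSum_nonneg _ _⟩
  · filter_upwards [hlog1, eventually_ge_atTop 3] with T hL hT
    have hL1 : 0 < Real.log T := lt_of_lt_of_le one_pos ((le_max_left _ _).trans hL)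
    have ha : 0 < α / Real.log T := by positivity
    have ha' : α / Real.log T ≤ 3 / 2 := by
      rw [div_le_iff₀ hL1]; linarith [(le_max_right 1 α).trans hL]
    refine ⟨memLp_of_integrable_pow hk ?_ (fun t => abs_nonneg _) (hb _ T ha ha' hT).1,
      fun t => le_rfl⟩
    exact ((((continuous_sigmaSum hRH ha).measurable.indicator
      measurableSet_Ioc).sub (continuous_zeroSum ha T).measurable).abs).aestronglyMeasurable
  · have hinv : Tendsto (fun T : ℝ => (Real.log T)⁻¹) atTop (𝓝 0) :=
      tendsto_inv_atTop_zero.comp Real.tendsto_log_atTop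
    -- The three error terms after division by T·L^(2k): bulk, zeros seen from outside, and
    -- endpoints. The second needs the bound for the number of zeros; the third is L^(3k) against
    -- T·L^(2k).
    have hlim : Tendsto (fun T : ℝ => K * ((Real.log T)⁻¹ ^ k
        + ((zerosBelow T).card : ℝ) / (T * Real.log T) * (Real.log T)⁻¹ ^ k
        + (1 / α ^ 2) ^ k * (Real.log T ^ k / T))) atTop (𝓝 0) := by
      have h1 := hinv.pow k
      rw [zero_pow hk] at h1
      have h2 := (tendsto_card_zerosBelow hRH).mul h1
      have h3 := (tendsto_pow_log_div_self k).const_mul ((1 / α ^ 2) ^ k)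
      simpa using ((h1.add h2).add h3).const_mul K
    refine squeeze_zero' ?_ ?_ hlim
    · filter_upwards [hlog1, eventually_ge_atTop 3] with T hL hT
      have hL1 : 0 < Real.log T := lt_of_lt_of_le one_pos ((le_max_left _ _).trans hL)
      exact div_nonneg (integral_nonneg fun t => by positivity) (by positivity)
    · filter_upwards [hlog1, eventually_ge_atTop 3] with T hL hT
      have hL1 : 0 < Real.log T := lt_of_lt_of_le one_pos ((le_max_left _ _).trans hL)
      have ha : 0 < α / Real.log T := by positivity
      have ha' : α / Real.log T ≤ 3 / 2 := by
        rw [div_le_iff₀ hL1]; linarith [(le_max_right 1 α).trans hL]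
      rw [div_le_iff₀ (by positivity)]
      refine (hb _ T ha ha' hT).2.trans (le_of_eq ?_)
      obtain ⟨k, rfl⟩ := Nat.exists_eq_succ_of_ne_zero hk
      have hT0 : T ≠ 0 := by positivity
      simp only [Nat.succ_eq_add_one, add_tsub_cancel_right]
      have e : (Real.log T / (α / Real.log T) ^ 2) = 1 / α ^ 2 * Real.log T ^ 3 := by field_simp
      rw [e, mul_pow]
      set L := Real.log T
      have hL0 : L ≠ 0 := hL1.ne'
      have e2 : L ^ (2 * (k + 1)) = L ^ (k + 1) * L ^ (k + 1) := by ring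
      have e3 : (L ^ 3) ^ (k + 1) = L ^ (k + 1) * L ^ (k + 1) * L ^ (k + 1) := by ring
      rw [e2, e3, inv_pow]
      set P := L ^ (k + 1) with hP
      have hP0 : P ≠ 0 := pow_ne_zero _ hL0
      have e4 : L ^ k = P / L := by rw [hP, pow_succ, mul_div_cancel_right₀ _ hL0]
      rw [e4]
      field_simp

end Boundary

/-! ### Moments of linear statistics with smooth compactly supported weight -/

section CompactMoments

open MeasureTheory

/-- The linear statistic `∑ b(y - x_j)` of the rescaled ordinates in `(0, T)`. -/
noncomputable def linStat (b : ℝ → ℝ) (T y : ℝ) : ℝ :=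
  ∑ j ∈ zerosBelow T, b (y - scaledOrdinate T j)

/-- Second moment of a linear statistic of the sine process. -/
noncomputable def sineMomentTwo (b : ℝ → ℝ) : ℝ :=
  (∫ u, b u ^ 2) + ∫ x : Fin 2 → ℝ, b (x 0) * b (x 1) * gueDensity x

/-- Third moment of a linear statistic of the sine process. -/
noncomputable def sineMomentThree (b : ℝ → ℝ) : ℝ :=
  (∫ u, b u ^ 3)
    + 3 / 2 * (∫ x : Fin 2 → ℝ, (b (x 0) ^ 2 * b (x 1) + b (x 0) * b (x 1) ^ 2) * gueDensity x)
    + ∫ x : Fin 3 → ℝ, b (x 0) * b (x 1) * b (x 2) * gueDensity x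

variable {b : ℝ → ℝ}

theorem hasCompactSupport_of_forall_eq_zero {n : ℕ} (hc : HasCompactSupport b)
    {B : (Fin n → ℝ) → ℝ} (h : ∀ x i, b (x i) = 0 → B x = 0) : HasCompactSupport B := by
  refine HasCompactSupport.intro (isCompact_univ_pi fun _ : Fin n => hc) fun x hx => ?_
  simp only [Set.mem_pi, Set.mem_univ, true_implies, not_forall] at hx
  obtain ⟨i, hi⟩ := hx
  exact h x i (image_eq_zero_of_notMem_tsupport hi)

theorem integrable_pow_comp_sub (hb : Continuous b) (hc : HasCompactSupport b) {k : ℕ} (hk : k ≠ 0)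
    (s : ℝ) : Integrable (fun y => b (y - s) ^ k) := by
  have h1 : Integrable (fun y => b y ^ k) := by
    refine (hb.pow k).integrable_of_hasCompactSupport ?_
    exact hc.comp_left (g := fun z => z ^ k) (zero_pow hk)
  exact h1.comp_sub_right s

theorem integral_diagonal (hb : Continuous b) (hc : HasCompactSupport b) {k : ℕ} (hk : k ≠ 0)
    (T : ℝ) : Integrable (fun y => ∑ j : zerosBelow T, b (y - scaledOrdinate T j) ^ k) ∧
      ∫ y, ∑ j : zerosBelow T, b (y - scaledOrdinate T j) ^ k
        = (zerosBelow T).card * ∫ u, b u ^ k := by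
  have hi : ∀ j : zerosBelow T, Integrable (fun y => b (y - scaledOrdinate T j) ^ k) :=
    fun j => integrable_pow_comp_sub hb hc hk _
  refine ⟨integrable_finsetSum _ fun j _ => hi j, ?_⟩
  rw [integral_finsetSum _ fun j _ => hi j]
  simp_rw [integral_sub_right_eq_self (fun y => b y ^ k)]
  simp

theorem linStat_eq_sum_coe (b : ℝ → ℝ) (T y : ℝ) :
    linStat b T y = ∑ j : zerosBelow T, b (y - scaledOrdinate T j) :=
  (Finset.sum_coe_sort (zerosBelow T) fun j => b (y - scaledOrdinate T j)).symm

theorem symm_two {B : (Fin 2 → ℝ) → ℝ} (h : ∀ u v, B ![u, v] = B ![v, u])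
    (σ : Equiv.Perm (Fin 2)) (x : Fin 2 → ℝ) : B (fun i => x (σ i)) = B x := by
  have hx : ∀ y : Fin 2 → ℝ, y = ![y 0, y 1] := fun y => by ext i; fin_cases i <;> rfl
  rw [hx (fun i => x (σ i)), hx x]
  fin_cases σ
  · rfl
  · exact h _ _

/-- Coinciding indices contribute the number of zeros times ∫b²; distinct ones form a correlation
sum whose limit the hypothesis supplies. -/
theorem tendsto_integral_linStat_sq (hRH : RiemannHypothesis) (hGUE : GUECorrelation 1)
    (hb : ContDiff ℝ ((⊤ : ℕ∞) : WithTop ℕ∞) b) (hc : HasCompactSupport b) :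
    Tendsto (fun T : ℝ => (∫ y, linStat b T y ^ 2) / (T * Real.log T)) atTop
      (𝓝 (1 / (2 * Real.pi) * sineMomentTwo b)) := by
  classical
  set B : (Fin 2 → ℝ) → ℝ := fun x => b (x 0) * b (x 1) with hB
  have hBs : ContDiff ℝ ((⊤ : ℕ∞) : WithTop ℕ∞) B :=
    (hb.comp (contDiff_apply ℝ ℝ 0)).mul (hb.comp (contDiff_apply ℝ ℝ 1))
  have hBc : HasCompactSupport B := hasCompactSupport_of_forall_eq_zero hc fun x i hi => by
    simp only [hB]
    fin_cases i <;> simp_all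
  have hBsymm := symm_two (B := B) fun u v => by simp [hB, mul_comm]
  have h2 := tendsto_integral_sum_injective hGUE hBs hBc hBsymm
  have h1 := (tendsto_card_zerosBelow hRH).mul_const (∫ u, b u ^ 2)
  refine (h1.add h2).congr (fun T => ?_) |>.trans_eq (by rw [sineMomentTwo, mul_add])
  obtain ⟨i1, e1⟩ := integral_diagonal hb.continuous hc two_ne_zero T
  obtain ⟨i2, e2⟩ := integral_sum_injective hBs.continuous hBc T
  have : ∫ y, linStat b T y ^ 2 = (zerosBelow T).card * (∫ u, b u ^ 2)
      + correlationSum T (diagAverage B) := by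
    rw [← e1, ← e2, ← integral_add i1 i2]
    refine integral_congr_ae (Eventually.of_forall fun y => ?_)
    simp only [linStat_eq_sum_coe, sq_sum_eq_diagonal_add, hB]
    congr!
  rw [this, add_div]
  ring

theorem tendsto_integral_linStat_cube (hRH : RiemannHypothesis) (hGUE₁ : GUECorrelation 1)
    (hGUE₂ : GUECorrelation 2)
    (hb : ContDiff ℝ ((⊤ : ℕ∞) : WithTop ℕ∞) b) (hc : HasCompactSupport b) :
    Tendsto (fun T : ℝ => (∫ y, linStat b T y ^ 3) / (T * Real.log T)) atTop
      (𝓝 (1 / (2 * Real.pi) * sineMomentThree b)) := by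
  classical
  set B : (Fin 2 → ℝ) → ℝ := fun x => b (x 0) ^ 2 * b (x 1) + b (x 0) * b (x 1) ^ 2 with hB
  set B' : (Fin 3 → ℝ) → ℝ := fun x => b (x 0) * b (x 1) * b (x 2) with hB'
  have hb2 : ∀ i : Fin 2, ContDiff ℝ ((⊤ : ℕ∞) : WithTop ℕ∞) (fun x : Fin 2 → ℝ => b (x i)) :=
    fun i => hb.comp (contDiff_apply ℝ ℝ i)
  have hb3 : ∀ i : Fin 3, ContDiff ℝ ((⊤ : ℕ∞) : WithTop ℕ∞) (fun x : Fin 3 → ℝ => b (x i)) :=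
    fun i => hb.comp (contDiff_apply ℝ ℝ i)
  have hBs : ContDiff ℝ ((⊤ : ℕ∞) : WithTop ℕ∞) B :=
    (((hb2 0).pow 2).mul (hb2 1)).add ((hb2 0).mul ((hb2 1).pow 2))
  have hBs' : ContDiff ℝ ((⊤ : ℕ∞) : WithTop ℕ∞) B' := ((hb3 0).mul (hb3 1)).mul (hb3 2)
  have hBc : HasCompactSupport B := hasCompactSupport_of_forall_eq_zero hc fun x i hi => by
    simp only [hB]
    fin_cases i <;> simp_all
  have hBc' : HasCompactSupport B' := hasCompactSupport_of_forall_eq_zero hc fun x i hi => by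
    simp only [hB']
    fin_cases i <;> simp_all
  have hBsymm := symm_two (B := B) fun u v => by simp [hB]; ring
  have hBsymm' : ∀ (σ : Equiv.Perm (Fin 3)) (x : Fin 3 → ℝ), B' (fun i => x (σ i)) = B' x := by
    intro σ x
    have h1 : ∀ y : Fin 3 → ℝ, B' y = ∏ i, b (y i) := fun y => by
      simp [hB', Fin.prod_univ_three]
    rw [h1 x, h1 (fun i => x (σ i))]
    exact Equiv.prod_comp σ fun i => b (x i)
  have h2 := (tendsto_integral_sum_injective hGUE₁ hBs hBc hBsymm).const_mul (3 / 2)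
  have h3 := tendsto_integral_sum_injective hGUE₂ hBs' hBc' hBsymm'
  have h1 := (tendsto_card_zerosBelow hRH).mul_const (∫ u, b u ^ 3)
  refine ((h1.add h2).add h3).congr (fun T => ?_) |>.trans_eq
    (by rw [sineMomentThree]; congr 1; ring)
  obtain ⟨i1, e1⟩ := integral_diagonal hb.continuous hc three_ne_zero T
  obtain ⟨i2, e2⟩ := integral_sum_injective hBs.continuous hBc T
  obtain ⟨i3, e3⟩ := integral_sum_injective hBs'.continuous hBc' T
  have : ∫ y, linStat b T y ^ 3 = (zerosBelow T).card * (∫ u, b u ^ 3)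
      + 3 / 2 * correlationSum T (diagAverage B) + correlationSum T (diagAverage B') := by
    have i2' := i2.const_mul (3 / 2)
    have i12 := i1.add i2'
    rw [← e1, ← e2, ← e3, ← integral_const_mul, ← integral_add i1 i2']
    refine Eq.trans ?_ (integral_add i12 i3)
    refine integral_congr_ae (Eventually.of_forall fun y => ?_)
    simp only [linStat_eq_sum_coe, cube_sum_eq_diagonal_add, hB, hB']
    congr!
  rw [this, add_div, add_div]
  ring

end CompactMoments

/-! ### Extension to weights of quadratic decay -/

section Decay

open MeasureTheory ENNReal

/-- A smooth function with values in `[0, 1]`, equal to `1` on `[-1, 1]` and to `0` off `(-2, 2)`. -/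
noncomputable def cutoff : ContDiffBump (0 : ℝ) := ⟨1, 2, one_pos, one_lt_two⟩

theorem cutoff_nonneg (u : ℝ) : 0 ≤ cutoff u := cutoff.nonneg

theorem cutoff_le_one (u : ℝ) : cutoff u ≤ 1 := cutoff.le_one

theorem cutoff_eq_one {u : ℝ} (hu : |u| ≤ 1) : cutoff u = 1 :=
  cutoff.one_of_mem_closedBall (by simpa [cutoff] using hu)

theorem cutoff_eq_zero {u : ℝ} (hu : 2 ≤ |u|) : cutoff u = 0 :=
  cutoff.zero_of_le_dist (by simpa [cutoff] using hu)

theorem contDiff_cutoff : ContDiff ℝ ((⊤ : ℕ∞) : WithTop ℕ∞) (cutoff : ℝ → ℝ) := cutoff.contDiff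

theorem hasCompactSupport_cutoff : HasCompactSupport (cutoff : ℝ → ℝ) := cutoff.hasCompactSupport

/-- `h` cut off at height `R`. -/
noncomputable def truncate (h : ℝ → ℝ) (R u : ℝ) : ℝ := h u * cutoff (u / R)

theorem contDiff_truncate {h : ℝ → ℝ} (hh : ContDiff ℝ ((⊤ : ℕ∞) : WithTop ℕ∞) h) (R : ℝ) :
    ContDiff ℝ ((⊤ : ℕ∞) : WithTop ℕ∞) (truncate h R) :=
  hh.mul (contDiff_cutoff.comp (contDiff_id.div_const R))

theorem hasCompactSupport_truncate (h : ℝ → ℝ) {R : ℝ} (hR : 0 < R) :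
    HasCompactSupport (truncate h R) := by
  refine HasCompactSupport.intro (isCompact_closedBall (0 : ℝ) (2 * R)) fun u hu => ?_
  rw [mem_closedBall_zero_iff, not_le, Real.norm_eq_abs] at hu
  rw [truncate, cutoff_eq_zero, mul_zero]
  rw [abs_div, abs_of_pos hR, le_div_iff₀ hR]
  exact hu.le

theorem truncate_nonneg {h : ℝ → ℝ} (h0 : ∀ u, 0 ≤ h u) (R u : ℝ) : 0 ≤ truncate h R u :=
  mul_nonneg (h0 u) (cutoff_nonneg _)

theorem truncate_le {h : ℝ → ℝ} (h0 : ∀ u, 0 ≤ h u) (R u : ℝ) : truncate h R u ≤ h u :=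
  mul_le_of_le_one_right (h0 u) (cutoff_le_one _)

theorem tendsto_truncate (h : ℝ → ℝ) (u : ℝ) :
    Tendsto (fun R : ℕ => truncate h R u) atTop (𝓝 (h u)) := by
  refine tendsto_const_nhds.congr' ?_
  filter_upwards [eventually_ge_atTop (max 1 ⌈|u|⌉₊)] with R hR
  have h1 : (1 : ℝ) ≤ R := by exact_mod_cast (le_max_left _ _).trans hR
  have h2 : |u| ≤ R := (Nat.le_ceil _).trans (by exact_mod_cast (le_max_right _ _).trans hR)
  rw [truncate, cutoff_eq_one, mul_one]
  rw [abs_div, abs_of_nonneg (by linarith : (0 : ℝ) ≤ R)]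
  exact div_le_one_of_le₀ h2 (by linarith)

variable {h : ℝ → ℝ} {A : ℝ}

/-- Where the truncations differ, m = ⌊|u|⌋ lies between R and 2M. There h is at most A/m², and one
of the bumps centred at m and -m equals 1. -/
theorem abs_truncate_sub_truncate_le (h0 : ∀ u, 0 ≤ h u) (hA : ∀ u, h u ≤ A / (1 + u ^ 2))
    {R M : ℕ} (hR : 1 ≤ R) (hM : R ≤ M) (u : ℝ) :
    |truncate h M u - truncate h R u|
      ≤ ∑ m ∈ Finset.Ioo (R - 1) (2 * M + 1), A * ((m : ℝ) ^ 2)⁻¹ * (cutoff (u - m) + cutoff (u + m)) := by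
  have hA0 : 0 ≤ A := by simpa using (h0 0).trans (hA 0)
  have hnn : ∀ m ∈ Finset.Ioo (R - 1) (2 * M + 1),
      0 ≤ A * ((m : ℝ) ^ 2)⁻¹ * (cutoff (u - m) + cutoff (u + m)) := fun m _ =>
    mul_nonneg (by positivity) (add_nonneg (cutoff_nonneg _) (cutoff_nonneg _))
  have hR' : (0 : ℝ) < R := by exact_mod_cast hR
  have hM' : (R : ℝ) ≤ M := by exact_mod_cast hM
  by_cases c1 : |u| < R
  · have e1 : truncate h R u = h u := by
      rw [truncate, cutoff_eq_one, mul_one]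
      rw [abs_div, abs_of_pos hR']
      exact div_le_one_of_le₀ c1.le hR'.le
    have e2 : truncate h M u = h u := by
      rw [truncate, cutoff_eq_one, mul_one]
      rw [abs_div, abs_of_pos (hR'.trans_le hM')]
      exact div_le_one_of_le₀ (c1.le.trans hM') (hR'.trans_le hM').le
    rw [e1, e2, sub_self, abs_zero]
    exact Finset.sum_nonneg hnn
  by_cases c2 : 2 * (M : ℝ) ≤ |u|
  · have e1 : truncate h R u = 0 := by
      rw [truncate, cutoff_eq_zero, mul_zero]
      rw [abs_div, abs_of_pos hR', le_div_iff₀ hR']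
      linarith
    have e2 : truncate h M u = 0 := by
      rw [truncate, cutoff_eq_zero, mul_zero]
      rw [abs_div, abs_of_pos (hR'.trans_le hM'), le_div_iff₀ (hR'.trans_le hM')]
      linarith
    rw [e1, e2, sub_self, abs_zero]
    exact Finset.sum_nonneg hnn
  rw [not_lt] at c1
  rw [not_le] at c2
  set m := ⌊|u|⌋₊ with hm
  have hm1 : R ≤ m := Nat.le_floor c1
  have hm2 : m < 2 * M := by
    rw [hm, Nat.floor_lt (abs_nonneg u)]
    exact_mod_cast c2
  have hmu : (m : ℝ) ≤ |u| := Nat.floor_le (abs_nonneg u)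
  have hum : |u| < m + 1 := Nat.lt_floor_add_one _
  have hm0 : (0 : ℝ) < m := by exact_mod_cast lt_of_lt_of_le hR hm1
  refine le_trans ?_ (Finset.single_le_sum hnn (Finset.mem_Ioo.2 ⟨by omega, by omega⟩ :
    m ∈ Finset.Ioo (R - 1) (2 * M + 1)))
  have h1 : |truncate h M u - truncate h R u| ≤ h u := by
    rw [abs_le]
    constructor <;> linarith [truncate_nonneg h0 M u, truncate_nonneg h0 R u, truncate_le h0 M u,
      truncate_le h0 R u]
  have h2 : h u ≤ A * ((m : ℝ) ^ 2)⁻¹ := by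
    refine (hA u).trans ?_
    rw [div_eq_mul_inv]
    have : (m : ℝ) ^ 2 ≤ 1 + u ^ 2 := by
      rw [← sq_abs u]
      nlinarith
    gcongr
  have h3 : 1 ≤ cutoff (u - m) + cutoff (u + m) := by
    rcases le_total 0 u with hu | hu
    · rw [abs_of_nonneg hu] at hmu hum
      have := cutoff_eq_one (u := u - m) (by rw [abs_le]; constructor <;> linarith)
      linarith [cutoff_nonneg (u + m)]
    · rw [abs_of_nonpos hu] at hmu hum
      have := cutoff_eq_one (u := u + m) (by rw [abs_le]; constructor <;> linarith)
      linarith [cutoff_nonneg (u - m)]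
  have h4 : 0 ≤ A * ((m : ℝ) ^ 2)⁻¹ := by positivity
  nlinarith

theorem linStat_nonneg {b : ℝ → ℝ} (hb : ∀ u, 0 ≤ b u) (T y : ℝ) : 0 ≤ linStat b T y :=
  Finset.sum_nonneg fun _ _ => hb _

theorem memLp_comp_sub {b : ℝ → ℝ} {p : ℝ≥0∞} (hb : MemLp b p) (s : ℝ) :
    MemLp (fun y => b (y - s)) p :=
  hb.comp_measurePreserving (measurePreserving_sub_right volume s)

theorem memLp_linStat {b : ℝ → ℝ} {p : ℝ≥0∞} (hb : MemLp b p) (T : ℝ) : MemLp (linStat b T) p :=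
  memLp_finsetSum _ fun _ _ => memLp_comp_sub hb _

theorem lpNorm_comp_sub {b : ℝ → ℝ} {p : ℝ≥0∞} (hb : MemLp b p) (s : ℝ) :
    lpNorm (fun y => b (y - s)) p volume = lpNorm b p volume := by
  rw [← toReal_eLpNorm hb.1, ← toReal_eLpNorm (memLp_comp_sub hb s).1]
  congr 1
  exact eLpNorm_comp_measurePreserving hb.1 (measurePreserving_sub_right volume s)

theorem lpNorm_linStat_le {b : ℝ → ℝ} {p : ℝ≥0∞} (hp : 1 ≤ p) (hb : MemLp b p) (T : ℝ) :
    lpNorm (linStat b T) p volume ≤ (zerosBelow T).card * lpNorm b p volume := by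
  have h1 : linStat b T = ∑ j ∈ zerosBelow T, fun y => b (y - scaledOrdinate T j) := by
    ext y
    simp [linStat]
  rw [h1]
  refine (lpNorm_sum_le (fun j _ => memLp_comp_sub hb _) hp).trans ?_
  simp_rw [lpNorm_comp_sub hb]
  simp

/-- Every translate of the statistic of the bump has the same Lᵏ norm on the line, and the weights
1/m² sum to at most 2/R. Thus the tail is O(1/R) relative to one fixed statistic, uniformly in T. -/
theorem lpNorm_linStat_truncate_sub_le {k : ℕ} (hk : k ≠ 0) (h0 : ∀ u, 0 ≤ h u)
    (hA : ∀ u, h u ≤ A / (1 + u ^ 2)) {R M : ℕ} (hR : 1 ≤ R) (hM : R ≤ M) (T : ℝ) :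
    lpNorm (fun y => linStat (truncate h M) T y - linStat (truncate h R) T y) (k : ℝ≥0∞) volume
      ≤ 4 * A / R * lpNorm (linStat cutoff T) (k : ℝ≥0∞) volume := by
  have hA0 : 0 ≤ A := by simpa using (h0 0).trans (hA 0)
  have hk1 : (1 : ℝ≥0∞) ≤ k := by exact_mod_cast Nat.one_le_iff_ne_zero.2 hk
  have hc : MemLp (cutoff : ℝ → ℝ) (k : ℝ≥0∞) :=
    contDiff_cutoff.continuous.memLp_of_hasCompactSupport hasCompactSupport_cutoff
  set F : ℝ → ℝ := linStat cutoff T with hF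
  have hFm : MemLp F (k : ℝ≥0∞) := memLp_linStat hc T
  set G : ℕ → ℝ → ℝ := fun m => (A * ((m : ℝ) ^ 2)⁻¹) • ((fun y => F (y - m)) + fun y => F (y - -m))
    with hG
  have hGm : ∀ m, MemLp (G m) (k : ℝ≥0∞) := fun m =>
    ((memLp_comp_sub hFm _).add (memLp_comp_sub hFm _)).const_smul _
  have hpt : ∀ y, ‖linStat (truncate h M) T y - linStat (truncate h R) T y‖
      ≤ (∑ m ∈ Finset.Ioo (R - 1) (2 * M + 1), G m) y := by
    intro y
    rw [Real.norm_eq_abs, linStat, linStat, ← Finset.sum_sub_distrib]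
    refine (Finset.abs_sum_le_sum_abs _ _).trans ((Finset.sum_le_sum fun j _ =>
      abs_truncate_sub_truncate_le h0 hA hR hM _).trans (le_of_eq ?_))
    rw [Finset.sum_comm, Finset.sum_apply]
    refine Finset.sum_congr rfl fun m _ => ?_
    simp only [hG, hF, Pi.smul_apply, Pi.add_apply, smul_eq_mul, linStat]
    rw [← Finset.mul_sum, Finset.sum_add_distrib]
    congr 2 <;> refine Finset.sum_congr rfl fun j _ => ?_ <;> congr 1 <;> ring
  refine (lpNorm_mono_real (memLp_finsetSum' _ fun m _ => hGm m) hpt).trans ?_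
  refine (lpNorm_sum_le (fun m _ => hGm m) hk1).trans ?_
  have hterm : ∀ m, lpNorm (G m) (k : ℝ≥0∞) volume
      ≤ 2 * A * lpNorm F (k : ℝ≥0∞) volume * ((m : ℝ) ^ 2)⁻¹ := by
    intro m
    simp only [hG]
    rw [lpNorm_const_smul, coe_nnnorm, Real.norm_eq_abs, abs_of_nonneg (by positivity)]
    have h1 := lpNorm_add_le (g := fun y => F (y - -(m : ℝ))) (memLp_comp_sub hFm (m : ℝ)) hk1
    rw [lpNorm_comp_sub hFm, lpNorm_comp_sub hFm] at h1
    have h2 : 0 ≤ A * ((m : ℝ) ^ 2)⁻¹ := by positivity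
    calc _ ≤ A * ((m : ℝ) ^ 2)⁻¹ * (lpNorm F (k : ℝ≥0∞) volume + lpNorm F (k : ℝ≥0∞) volume) := by
          gcongr
      _ = _ := by ring
  refine (Finset.sum_le_sum fun m _ => hterm m).trans ?_
  rw [← Finset.mul_sum]
  have hs := sum_Ioo_inv_sq_le (α := ℝ) (R - 1) (2 * M + 1)
  have hcast : ((R - 1 : ℕ) : ℝ) + 1 = R := by
    rw [Nat.cast_sub hR]; simp
  rw [hcast] at hs
  have hn : 0 ≤ 2 * A * lpNorm F (k : ℝ≥0∞) volume :=
    mul_nonneg (by positivity) lpNorm_nonneg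
  refine (mul_le_mul_of_nonneg_left hs hn).trans (le_of_eq ?_)
  ring

theorem integrable_pow_of_le (hm : Measurable h) (h0 : ∀ u, 0 ≤ h u)
    (hA : ∀ u, h u ≤ A / (1 + u ^ 2)) {k : ℕ} (hk : k ≠ 0) : Integrable fun u => h u ^ k := by
  have hA0 : 0 ≤ A := by simpa using (h0 0).trans (hA 0)
  refine (integrable_inv_one_add_sq.const_mul (A ^ k)).mono' (hm.pow_const k).aestronglyMeasurable
    (Eventually.of_forall fun u => ?_)
  rw [Real.norm_eq_abs, abs_of_nonneg (pow_nonneg (h0 u) k)]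
  refine (pow_le_pow_left₀ (h0 u) (hA u) k).trans ?_
  rw [div_eq_mul_inv, mul_pow]
  gcongr
  refine pow_le_of_le_one (by positivity) ?_ hk
  exact inv_le_one_of_one_le₀ (by nlinarith [sq_nonneg u])

theorem measurable_truncate (hm : Measurable h) (R : ℝ) : Measurable (truncate h R) :=
  hm.mul (contDiff_cutoff.continuous.measurable.comp (measurable_id.div_const R))

theorem tendsto_lpNorm_sub_truncate (hm : Measurable h) (h0 : ∀ u, 0 ≤ h u)
    (hA : ∀ u, h u ≤ A / (1 + u ^ 2)) {k : ℕ} (hk : k ≠ 0) :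
    Tendsto (fun M : ℕ => lpNorm (fun u => h u - truncate h M u) (k : ℝ≥0∞) volume) atTop (𝓝 0) := by
  have h1 : Tendsto (fun M : ℕ => ∫ u, (h u - truncate h M u) ^ k) atTop (𝓝 (∫ u : ℝ, (0 : ℝ))) := by
    refine tendsto_integral_of_dominated_convergence (fun u => h u ^ k)
      (fun M => ((hm.sub (measurable_truncate hm M)).pow_const k).aestronglyMeasurable)
      (integrable_pow_of_le hm h0 hA hk) (fun M => Eventually.of_forall fun u => ?_)
      (Eventually.of_forall fun u => ?_)
    · have := sub_nonneg.2 (truncate_le h0 M u)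
      rw [Real.norm_eq_abs, abs_of_nonneg (pow_nonneg this k)]
      exact pow_le_pow_left₀ this (by linarith [truncate_nonneg h0 M u]) k
    · have := ((tendsto_const_nhds (x := h u)).sub (tendsto_truncate h u)).pow k
      simpa [hk] using this
  rw [integral_zero] at h1
  have h2 : Tendsto (fun M : ℕ => scaledNorm k 1 (fun u => h u - truncate h M u)) atTop
      (𝓝 ((0 : ℝ) ^ (1 / (k : ℝ)))) := by
    refine tendsto_of_tendsto_pow hk (Eventually.of_forall fun M =>
      scaledNorm_nonneg zero_le_one _) (h1.congr fun M => ?_)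
    rw [scaledNorm_pow (f := fun u => h u - truncate h M u) hk zero_le_one
      (hm.sub (measurable_truncate hm M)).aestronglyMeasurable (fun u => sub_nonneg.2 (truncate_le h0 M u)), div_one]
  rw [Real.zero_rpow (by positivity)] at h2
  simpa [scaledNorm] using h2

/-- The outer truncation is removed for fixed T, where only finitely many zeros occur and a bound by
their number suffices. That number does not survive in the limit. -/
theorem lpNorm_linStat_sub_truncate_le (hm : Measurable h) {k : ℕ} (hk : k ≠ 0)
    (h0 : ∀ u, 0 ≤ h u) (hA : ∀ u, h u ≤ A / (1 + u ^ 2)) {R : ℕ} (hR : 1 ≤ R) (T : ℝ) :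
    lpNorm (fun y => linStat h T y - linStat (truncate h R) T y) (k : ℝ≥0∞) volume
      ≤ 4 * A / R * lpNorm (linStat cutoff T) (k : ℝ≥0∞) volume := by
  have hk1 : (1 : ℝ≥0∞) ≤ k := by exact_mod_cast Nat.one_le_iff_ne_zero.2 hk
  have hhm : MemLp h (k : ℝ≥0∞) :=
    memLp_of_integrable_pow hk hm.aestronglyMeasurable h0 (integrable_pow_of_le hm h0 hA hk)
  have htm : ∀ M : ℕ, MemLp (truncate h M) (k : ℝ≥0∞) := fun M => by
    refine memLp_of_integrable_pow hk (measurable_truncate hm M).aestronglyMeasurable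
      (truncate_nonneg h0 M) (integrable_pow_of_le (A := A) (measurable_truncate hm M)
      (truncate_nonneg h0 M) (fun u => (truncate_le h0 M u).trans (hA u)) hk)
  have hlim : Tendsto (fun M : ℕ => 4 * A / R * lpNorm (linStat cutoff T) (k : ℝ≥0∞) volume
      + (zerosBelow T).card * lpNorm (fun u => h u - truncate h M u) (k : ℝ≥0∞) volume) atTop
      (𝓝 (4 * A / R * lpNorm (linStat cutoff T) (k : ℝ≥0∞) volume)) := by
    simpa using ((tendsto_lpNorm_sub_truncate hm h0 hA hk).const_mul
      ((zerosBelow T).card : ℝ)).const_add (4 * A / R * lpNorm (linStat cutoff T) (k : ℝ≥0∞) volume)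
  refine ge_of_tendsto hlim ?_
  filter_upwards [eventually_ge_atTop R] with M hM
  have h1 := lpNorm_linStat_truncate_sub_le hk h0 hA hR hM T
  have h2 := lpNorm_linStat_le hk1 (hhm.sub (htm M)) T
  have h3 := lpNorm_add_le (g := linStat (h - truncate h M) T)
    ((memLp_linStat (htm M) T).sub (memLp_linStat (htm R) T)) hk1
  have e : (linStat (truncate h M) T - linStat (truncate h R) T) + linStat (h - truncate h M) T
      = fun y => linStat h T y - linStat (truncate h R) T y := by
    ext y
    simp [linStat]
  rw [e] at h3
  exact h3.trans (add_le_add h1 h2)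

/-- Moment asymptotics extend from smooth compactly supported functions to smooth nonnegative
functions of quadratic decay. -/
theorem tendsto_integral_linStat_pow_of_decay {k : ℕ} (hk : k ≠ 0) {E : (ℝ → ℝ) → ℝ}
    (hE : ∀ b : ℝ → ℝ, ContDiff ℝ ((⊤ : ℕ∞) : WithTop ℕ∞) b → HasCompactSupport b →
      Tendsto (fun T : ℝ => (∫ y, linStat b T y ^ k) / (T * Real.log T)) atTop (𝓝 (E b)))
    (hh : ContDiff ℝ ((⊤ : ℕ∞) : WithTop ℕ∞) h) (h0 : ∀ u, 0 ≤ h u)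
    (hA : ∀ u, h u ≤ A / (1 + u ^ 2))
    (hlim : Tendsto (fun R : ℕ => E (truncate h R)) atTop (𝓝 (E h))) :
    Tendsto (fun T : ℝ => (∫ y, linStat h T y ^ k) / (T * Real.log T)) atTop (𝓝 (E h)) := by
  have hm : Measurable h := hh.continuous.measurable
  have hA0 : 0 ≤ A := by simpa using (h0 0).trans (hA 0)
  have hhm : MemLp h (k : ℝ≥0∞) :=
    memLp_of_integrable_pow hk hm.aestronglyMeasurable h0 (integrable_pow_of_le hm h0 hA hk)
  set S : ℝ → ℝ := fun T => T * Real.log T with hSdef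
  have hS : ∀ᶠ T in atTop, 0 < S T := by
    filter_upwards [eventually_gt_atTop 1] with T hT
    exact mul_pos (by linarith) (Real.log_pos hT)
  have hnu : ∀ b : ℝ → ℝ, ContDiff ℝ ((⊤ : ℕ∞) : WithTop ℕ∞) b → HasCompactSupport b →
      (∀ u, 0 ≤ b u) →
      Tendsto (fun T => scaledNorm k (S T) (linStat b T)) atTop (𝓝 (E b ^ (1 / (k : ℝ)))) := by
    intro b hb hbc hb0
    refine tendsto_of_tendsto_pow hk ?_ ((hE b hb hbc).congr' ?_)
    · filter_upwards [hS] with T hT using scaledNorm_nonneg hT.le _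
    · filter_upwards [hS] with T hT
      exact (scaledNorm_pow hk hT.le (memLp_linStat (p := (k : ℝ≥0∞))
        (hb.continuous.memLp_of_hasCompactSupport hbc) T).1 (linStat_nonneg hb0 T)).symm
  have hE0 : 0 ≤ E h := by
    refine ge_of_tendsto hlim ?_
    filter_upwards [eventually_ge_atTop 1] with R hR
    refine ge_of_tendsto (hE _ (contDiff_truncate hh R) (hasCompactSupport_truncate h (by
      exact_mod_cast hR))) ?_
    filter_upwards [hS] with T hT
    exact div_nonneg (integral_nonneg fun y =>
      pow_nonneg (linStat_nonneg (truncate_nonneg h0 R) T y) k) hT.le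
  have hcut := hnu cutoff contDiff_cutoff hasCompactSupport_cutoff cutoff_nonneg
  set V := E cutoff ^ (1 / (k : ℝ)) + 1 with hV
  have hV0 : 0 ≤ V := by
    have : 0 ≤ E cutoff ^ (1 / (k : ℝ)) := by
      refine ge_of_tendsto hcut ?_
      filter_upwards [hS] with T hT using scaledNorm_nonneg hT.le _
    positivity
  have hcutle : ∀ᶠ T in atTop, scaledNorm k (S T) (linStat cutoff T) ≤ V :=
    (hcut.eventually_lt_const (by linarith)).mono fun _ h => h.le
  have hlim' : Tendsto (fun R : ℕ => E (truncate h R) ^ (1 / (k : ℝ))) atTop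
      (𝓝 (E h ^ (1 / (k : ℝ)))) := hlim.rpow_const (Or.inr (by positivity))
  have hsmall : Tendsto (fun R : ℕ => 4 * A / R * V) atTop (𝓝 0) := by
    simpa using (tendsto_const_div_atTop_nhds_zero_nat (4 * A)).mul_const V
  have hmain : Tendsto (fun T => scaledNorm k (S T) (linStat h T)) atTop
      (𝓝 (E h ^ (1 / (k : ℝ)))) := by
    rw [Metric.tendsto_nhds]
    intro ε hε
    have hR1 := (Metric.tendsto_nhds.1 hlim') (ε / 3) (by positivity)
    have hR2 := hsmall.eventually_lt_const (by positivity : (0 : ℝ) < ε / 3)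
    -- `R` is fixed before T grows; this is legitimate because the tail bound 4A/R·V holds for all
    -- large T.
    obtain ⟨R, hR1, hR2, hR3⟩ := (hR1.and (hR2.and (eventually_ge_atTop 1))).exists
    have hb : HasCompactSupport (truncate h R) := hasCompactSupport_truncate h (by
      exact_mod_cast hR3)
    have hT1 := (Metric.tendsto_nhds.1 (hnu (truncate h R) (contDiff_truncate hh R) hb
      (truncate_nonneg h0 R))) (ε / 3) (by positivity)
    filter_upwards [hT1, hS, hcutle] with T h1 h2 h3
    have hbm : MemLp (truncate h R) (k : ℝ≥0∞) :=
      (contDiff_truncate hh R).continuous.memLp_of_hasCompactSupport hb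
    have hsub : MemLp (fun y => linStat h T y - linStat (truncate h R) T y) (k : ℝ≥0∞) :=
      (memLp_linStat hhm T).sub (memLp_linStat hbm T)
    have h4 := abs_scaledNorm_sub_le hk h2.le (memLp_linStat hhm T) (memLp_linStat hbm T)
      hsub.abs (fun t => le_rfl)
    have h5 : scaledNorm k (S T) (fun y => |linStat h T y - linStat (truncate h R) T y|)
        ≤ 4 * A / R * V := by
      unfold scaledNorm at h3 ⊢
      rw [lpNorm_fun_abs hsub.1]
      have h6 := lpNorm_linStat_sub_truncate_le hm hk h0 hA hR3 T
      have h7 : 0 < S T ^ (1 / (k : ℝ)) := Real.rpow_pos_of_pos h2 _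
      rw [div_le_iff₀ h7] at h3 ⊢
      refine h6.trans ?_
      rw [mul_assoc]
      gcongr
    have h8 := h4.trans h5
    rw [Real.dist_eq] at h1 hR1 ⊢
    rw [abs_lt] at h1 hR1 ⊢
    rw [abs_le] at h8
    constructor <;> linarith [h1.1, h1.2, hR1.1, hR1.2, h8.1, h8.2]
  have := hmain.pow k
  rw [one_div, Real.rpow_inv_natCast_pow hE0 hk] at this
  refine this.congr' ?_
  filter_upwards [hS] with T hT
  exact scaledNorm_pow hk hT.le (memLp_linStat hhm T).1 (linStat_nonneg h0 T)

end Decay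

/-! ### The Poisson kernel as weight -/

section PoissonMoments

open MeasureTheory ENNReal

/-- The Poisson kernel with Fourier transform `exp (-α|ξ|)`. -/
noncomputable def poissonKernelLine (α u : ℝ) : ℝ := 2 * α / (α ^ 2 + 4 * Real.pi ^ 2 * u ^ 2)

theorem poissonKernelLine_nonneg {α : ℝ} (hα : 0 < α) (u : ℝ) : 0 ≤ poissonKernelLine α u := by
  unfold poissonKernelLine
  positivity

theorem contDiff_poissonKernelLine {α : ℝ} (hα : 0 < α) :
    ContDiff ℝ ((⊤ : ℕ∞) : WithTop ℕ∞) (poissonKernelLine α) := by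
  unfold poissonKernelLine
  refine contDiff_const.div (by fun_prop) fun u => ?_
  positivity

theorem exists_poissonKernelLine_le {α : ℝ} (hα : 0 < α) :
    ∃ A, ∀ u, poissonKernelLine α u ≤ A / (1 + u ^ 2) := by
  refine ⟨2 / α + α, fun u => ?_⟩
  unfold poissonKernelLine
  rw [div_le_div_iff₀ (by positivity) (by positivity)]
  have hpi : 1 ≤ Real.pi ^ 2 := by nlinarith [Real.pi_gt_three]
  have h1 : 2 * α * (1 + u ^ 2) = (2 / α) * α ^ 2 + 2 * α * u ^ 2 := by field_simp
  have h2 : 2 * α * u ^ 2 ≤ α * (4 * Real.pi ^ 2 * u ^ 2) := by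
    have : 2 * u ^ 2 ≤ 4 * Real.pi ^ 2 * u ^ 2 := by nlinarith [sq_nonneg u]
    nlinarith
  have h3 : 0 ≤ (2 / α) * (4 * Real.pi ^ 2 * u ^ 2) := by positivity
  have h4 : 0 ≤ α * α ^ 2 := by positivity
  nlinarith

variable {h : ℝ → ℝ} {A : ℝ}

/-- Dominated convergence for the truncations of `h` in a functional of several variables. -/
theorem tendsto_integral_truncate {n : ℕ} (hm : Continuous h) {W : (Fin n → ℝ) → ℝ}
    (hW : Continuous W)
    {P : (Fin n → ℝ) → ℝ} (hP : Continuous P) {C : ℝ} (hC : ∀ x, |W x| ≤ C)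
    (hPm : ∀ u v : Fin n → ℝ, (∀ i, 0 ≤ u i) → (∀ i, u i ≤ v i) → |P u| ≤ P v)
    (h0 : ∀ u, 0 ≤ h u) (hint : Integrable fun x : Fin n → ℝ => P (fun i => h (x i))) :
    Tendsto (fun R : ℕ => ∫ x : Fin n → ℝ, P (fun i => truncate h R (x i)) * W x) atTop
      (𝓝 (∫ x : Fin n → ℝ, P (fun i => h (x i)) * W x)) := by
  have hC0 : 0 ≤ C := (abs_nonneg _).trans (hC 0)
  have htc : ∀ R : ℕ, Continuous (truncate h R) := fun R =>
    hm.mul (contDiff_cutoff.continuous.comp (continuous_id.div_const _))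
  refine tendsto_integral_of_dominated_convergence (fun x => P (fun i => h (x i)) * C) (fun R => ?_)
    (hint.mul_const C) (fun R => Eventually.of_forall fun x => ?_) (Eventually.of_forall fun x => ?_)
  · have h1 : Continuous fun x : Fin n → ℝ => (fun i => truncate h R (x i)) :=
      continuous_pi fun i => (htc R).comp (continuous_apply i)
    exact ((hP.comp h1).mul hW).aestronglyMeasurable
  · rw [Real.norm_eq_abs, abs_mul]
    have := hPm (fun i => truncate h R (x i)) (fun i => h (x i))
      (fun i => truncate_nonneg h0 _ _) (fun i => truncate_le h0 _ _)
    exact mul_le_mul this (hC x) (abs_nonneg _) ((abs_nonneg _).trans this)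
  · refine Tendsto.mul_const _ ?_
    refine (hP.tendsto _).comp ?_
    rw [tendsto_pi_nhds]
    exact fun i => tendsto_truncate h (x i)

theorem integrable_mul_fin_two {f g : ℝ → ℝ} (hf : Integrable f) (hg : Integrable g) :
    Integrable fun x : Fin 2 → ℝ => f (x 0) * g (x 1) := by
  have := Integrable.fintype_prod (f := ![f, g]) (μ := fun _ => volume) (fun i => by
    fin_cases i
    · exact hf
    · exact hg)
  simpa [Fin.prod_univ_two, volume_pi] using this

theorem integrable_mul_fin_three {f g e : ℝ → ℝ} (hf : Integrable f) (hg : Integrable g)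
    (he : Integrable e) : Integrable fun x : Fin 3 → ℝ => f (x 0) * g (x 1) * e (x 2) := by
  have := Integrable.fintype_prod (f := ![f, g, e]) (μ := fun _ => volume) (fun i => by
    fin_cases i
    · exact hf
    · exact hg
    · exact he)
  simpa [Fin.prod_univ_three, volume_pi] using this

theorem tendsto_integral_truncate_pow (hm : Continuous h) (h0 : ∀ u, 0 ≤ h u) {k : ℕ}
    (hi : Integrable fun u => h u ^ k) :
    Tendsto (fun R : ℕ => ∫ u, truncate h R u ^ k) atTop (𝓝 (∫ u, h u ^ k)) := by
  refine tendsto_integral_of_dominated_convergence (fun u => h u ^ k) (fun R => ?_) hi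
    (fun R => Eventually.of_forall fun u => ?_) (Eventually.of_forall fun u => ?_)
  · exact ((measurable_truncate hm.measurable R).pow_const k).aestronglyMeasurable
  · rw [Real.norm_eq_abs, abs_of_nonneg (pow_nonneg (truncate_nonneg h0 R u) k)]
    exact pow_le_pow_left₀ (truncate_nonneg h0 R u) (truncate_le h0 R u) k
  · exact (tendsto_truncate h u).pow k

theorem tendsto_sineMomentTwo_truncate (hm : Continuous h) (h0 : ∀ u, 0 ≤ h u)
    (hA : ∀ u, h u ≤ A / (1 + u ^ 2)) :
    Tendsto (fun R : ℕ => sineMomentTwo (truncate h R)) atTop (𝓝 (sineMomentTwo h)) := by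
  have hi : ∀ k : ℕ, k ≠ 0 → Integrable fun u => h u ^ k := fun k hk =>
    integrable_pow_of_le hm.measurable h0 hA hk
  have hi1 : Integrable h := by simpa using hi 1 one_ne_zero
  refine (tendsto_integral_truncate_pow hm h0 (hi 2 two_ne_zero)).add ?_
  refine tendsto_integral_truncate hm continuous_gueDensity (P := fun u => u 0 * u 1)
    (by fun_prop) abs_gueDensity_le ?_ h0 (integrable_mul_fin_two hi1 hi1)
  intro u v hu huv
  have := fun i => (hu i).trans (huv i)
  rw [abs_of_nonneg (mul_nonneg (hu 0) (hu 1))]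
  exact mul_le_mul (huv 0) (huv 1) (hu 1) (this 0)

theorem tendsto_sineMomentThree_truncate (hm : Continuous h) (h0 : ∀ u, 0 ≤ h u)
    (hA : ∀ u, h u ≤ A / (1 + u ^ 2)) :
    Tendsto (fun R : ℕ => sineMomentThree (truncate h R)) atTop (𝓝 (sineMomentThree h)) := by
  have hi : ∀ k : ℕ, k ≠ 0 → Integrable fun u => h u ^ k := fun k hk =>
    integrable_pow_of_le hm.measurable h0 hA hk
  have hi1 : Integrable h := by simpa using hi 1 one_ne_zero
  refine ((tendsto_integral_truncate_pow hm h0 (hi 3 three_ne_zero)).add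
    (Tendsto.const_mul _ ?_)).add ?_
  · refine tendsto_integral_truncate hm continuous_gueDensity
      (P := fun u => u 0 ^ 2 * u 1 + u 0 * u 1 ^ 2) (by fun_prop) abs_gueDensity_le ?_ h0
      ((integrable_mul_fin_two (hi 2 two_ne_zero) hi1).add
        (integrable_mul_fin_two hi1 (hi 2 two_ne_zero)))
    intro u v hu huv
    have hu0 := hu 0
    have hu1 := hu 1
    have h3 := huv 0
    have h4 := huv 1
    have h5 := hu0.trans h3
    have h6 := hu1.trans h4
    rw [abs_of_nonneg (by positivity)]
    gcongr
  · refine tendsto_integral_truncate hm continuous_gueDensity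
      (P := fun u => u 0 * u 1 * u 2) (by fun_prop) abs_gueDensity_le ?_ h0
      (integrable_mul_fin_three hi1 hi1 hi1)
    intro u v hu huv
    have hu0 := hu 0
    have hu1 := hu 1
    have hu2 := hu 2
    have h3 := huv 0
    have h4 := huv 1
    have h5 := hu0.trans h3
    have h6 := hu1.trans h4
    rw [abs_of_nonneg (by positivity)]
    exact mul_le_mul (mul_le_mul h3 h4 hu1 h5) (huv 2) hu2 (by positivity)

/-- With a = α/L, rescaling ordinates by L/2π turns 1/(a²+u²) into a multiple of the Poisson kernel
of parameter α, which no longer involves T. -/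
theorem zeroSum_eq_linStat {α T : ℝ} (hα : 0 < α) (hL : 0 < Real.log T) (t : ℝ) :
    zeroSum T (α / Real.log T) t = Real.log T ^ 2 / (2 * α)
      * linStat (poissonKernelLine α) T (Real.log T / (2 * Real.pi) * t) := by
  unfold zeroSum linStat
  rw [Finset.mul_sum]
  refine Finset.sum_congr rfl fun j _ => ?_
  unfold poissonKernelLine scaledOrdinate
  have hpi := Real.pi_pos
  have h1 : 0 < (α / Real.log T) ^ 2 + (t - j.ordinate) ^ 2 := by positivity
  have h2 : Real.log T / (2 * Real.pi) * t - Real.log T / (2 * Real.pi) * j.ordinate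
    = Real.log T / (2 * Real.pi) * (t - j.ordinate) := by ring
  have h3 : 4 * Real.pi ^ 2 * (Real.log T / (2 * Real.pi) * (t - j.ordinate)) ^ 2
    = (Real.log T) ^ 2 * (t - j.ordinate) ^ 2 := by
    field_simp
    ring
  rw [h2, h3]
  have h4 : 0 < α ^ 2 + Real.log T ^ 2 * (t - j.ordinate) ^ 2 := by positivity
  field_simp

theorem integral_zeroSum_pow {α T : ℝ} (hα : 0 < α) (hL : 0 < Real.log T) (k : ℕ) :
    ∫ t, zeroSum T (α / Real.log T) t ^ k = (Real.log T ^ 2 / (2 * α)) ^ k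
      * (2 * Real.pi / Real.log T * ∫ y, linStat (poissonKernelLine α) T y ^ k) := by
  simp_rw [zeroSum_eq_linStat hα hL, mul_pow]
  rw [integral_const_mul]
  congr 1
  rw [Measure.integral_comp_mul_left (fun y => linStat (poissonKernelLine α) T y ^ k),
    abs_of_pos (by positivity), inv_div, smul_eq_mul]

theorem tendsto_integral_zeroSum_pow {α : ℝ} (hα : 0 < α) {k : ℕ} (hk : k ≠ 0)
    {E : (ℝ → ℝ) → ℝ}
    (hE : ∀ b : ℝ → ℝ, ContDiff ℝ ((⊤ : ℕ∞) : WithTop ℕ∞) b → HasCompactSupport b →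
      Tendsto (fun T : ℝ => (∫ y, linStat b T y ^ k) / (T * Real.log T)) atTop
        (𝓝 (1 / (2 * Real.pi) * E b)))
    (hlim : Tendsto (fun R : ℕ => E (truncate (poissonKernelLine α) R)) atTop
      (𝓝 (E (poissonKernelLine α)))) :
    Tendsto (fun T : ℝ => (∫ t, zeroSum T (α / Real.log T) t ^ k) / (T * Real.log T ^ (2 * k)))
      atTop (𝓝 (E (poissonKernelLine α) / (2 * α) ^ k)) := by
  obtain ⟨A, hA⟩ := exists_poissonKernelLine_le hα
  have h1 := tendsto_integral_linStat_pow_of_decay hk hE (contDiff_poissonKernelLine hα)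
    (poissonKernelLine_nonneg hα) hA (hlim.const_mul _)
  have h2 := h1.const_mul (2 * Real.pi / (2 * α) ^ k)
  have hpi := Real.pi_pos
  refine (h2.congr' ?_).trans_eq ?_
  · filter_upwards [eventually_gt_atTop 1] with T hT
    have hL := Real.log_pos hT
    have hT0 : T ≠ 0 := by positivity
    rw [integral_zeroSum_pow hα hL, div_pow, ← pow_mul]
    field_simp
  · congr 1
    field_simp

/-- Second moment of `Σ_a` for `a = α / log T`. -/
theorem tendsto_integral_sigmaSum_sq (hRH : RiemannHypothesis) (hGUE : GUEHypothesis 3) {α : ℝ}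
    (hα : 0 < α) (hpos : 0 ≤ sineMomentTwo (poissonKernelLine α)) :
    Tendsto (fun T : ℝ => (∫ t in (0 : ℝ)..T, sigmaSum (α / Real.log T) t ^ 2)
      / (T * Real.log T ^ (2 * 2))) atTop (𝓝 (sineMomentTwo (poissonKernelLine α) / (2 * α) ^ 2)) := by
  obtain ⟨A, hA⟩ := exists_poissonKernelLine_le hα
  refine tendsto_integral_sigmaSum_pow_of_zeroSum hRH hα two_ne_zero (by positivity) ?_
  exact tendsto_integral_zeroSum_pow hα two_ne_zero
    (fun b hb hc => tendsto_integral_linStat_sq hRH (hGUE 1 (by norm_num) (by norm_num)) hb hc)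
    (tendsto_sineMomentTwo_truncate (contDiff_poissonKernelLine hα).continuous
      (poissonKernelLine_nonneg hα) hA)

/-- Third moment of `Σ_a` for `a = α / log T`. -/
theorem tendsto_integral_sigmaSum_cube (hRH : RiemannHypothesis) (hGUE : GUEHypothesis 3) {α : ℝ}
    (hα : 0 < α) (hpos : 0 ≤ sineMomentThree (poissonKernelLine α)) :
    Tendsto (fun T : ℝ => (∫ t in (0 : ℝ)..T, sigmaSum (α / Real.log T) t ^ 3)
      / (T * Real.log T ^ (2 * 3))) atTop
      (𝓝 (sineMomentThree (poissonKernelLine α) / (2 * α) ^ 3)) := by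
  obtain ⟨A, hA⟩ := exists_poissonKernelLine_le hα
  refine tendsto_integral_sigmaSum_pow_of_zeroSum hRH hα three_ne_zero (by positivity) ?_
  exact tendsto_integral_zeroSum_pow hα three_ne_zero
    (fun b hb hc => tendsto_integral_linStat_cube hRH (hGUE 1 (by norm_num) (by norm_num))
      (hGUE 2 (by norm_num) (by norm_num)) hb hc)
    (tendsto_sineMomentThree_truncate (contDiff_poissonKernelLine hα).continuous
      (poissonKernelLine_nonneg hα) hA)

end PoissonMoments

/-! ### Sine-kernel products as integrals over the unit cube -/

section SineKernelFourier

open MeasureTheory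

/-- Lebesgue measure on the unit cube. -/
noncomputable def unitCube (n : ℕ) : Measure (Fin n → ℝ) :=
  Measure.pi fun _ => volume.restrict (Set.Icc (0 : ℝ) 1)

instance isFiniteMeasure_unitCube (n : ℕ) : IsFiniteMeasure (unitCube n) := by
  unfold unitCube
  infer_instance

theorem integrable_unitCube {n : ℕ} {E : Type*} [NormedAddCommGroup E] {G : (Fin n → ℝ) → E}
    (hG : Continuous G) :
    Integrable G (unitCube n) := by
  have : unitCube n = (volume : Measure (Fin n → ℝ)).restrict
      (Set.univ.pi fun _ => Set.Icc (0 : ℝ) 1) := by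
    rw [volume_pi, Measure.restrict_pi_pi]
    rfl
  rw [this]
  exact hG.continuousOn.integrableOn_compact (isCompact_univ_pi fun _ => isCompact_Icc)

theorem integral_unitCube_succ {n : ℕ} {G : (Fin (n + 1) → ℝ) → ℝ} (hG : Continuous G) :
    ∫ ξ, G ξ ∂unitCube (n + 1)
      = ∫ a in (0 : ℝ)..1, ∫ ξ, G (Fin.cons (α := fun _ => ℝ) a ξ) ∂unitCube n := by
  have hmp := (measurePreserving_piFinSuccAbove
    (fun _ : Fin (n + 1) => volume.restrict (Set.Icc (0 : ℝ) 1)) 0).symm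
  have h1 := hmp.integral_comp' G
  have hint : Integrable (fun p => G ((MeasurableEquiv.piFinSuccAbove (fun _ => ℝ) 0).symm p)) _ :=
    (hmp.integrable_comp_emb (MeasurableEquiv.measurableEmbedding _)).2
    (integrable_unitCube hG)
  rw [unitCube, ← h1, integral_prod _ hint, intervalIntegral.integral_of_le zero_le_one,
    integral_Icc_eq_integral_Ioc]
  refine integral_congr_ae (Eventually.of_forall fun a => integral_congr_ae
    (Eventually.of_forall fun ξ => ?_))
  simp only
  congr 1
  exact Fin.insertNth_zero' a ξ

theorem integral_unitCube_one {G : (Fin 1 → ℝ) → ℝ} (hG : Continuous G) :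
    ∫ ξ, G ξ ∂unitCube 1 = ∫ a in (0 : ℝ)..1, G ![a] := by
  rw [integral_unitCube_succ hG]
  refine intervalIntegral.integral_congr fun a _ => ?_
  simp only [unitCube, Measure.pi_of_empty _ ![], integral_dirac]
  rfl

theorem integral_unitCube_two {G : (Fin 2 → ℝ) → ℝ} (hG : Continuous G) :
    ∫ ξ, G ξ ∂unitCube 2 = ∫ a in (0 : ℝ)..1, ∫ b in (0 : ℝ)..1, G ![a, b] := by
  rw [integral_unitCube_succ hG]
  refine intervalIntegral.integral_congr fun a _ => ?_
  exact integral_unitCube_one (G := fun ξ => G (Fin.cons (α := fun _ => ℝ) a ξ))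
    (hG.comp (Continuous.finCons (A := fun _ => ℝ) continuous_const continuous_id))

theorem integral_unitCube_three {G : (Fin 3 → ℝ) → ℝ} (hG : Continuous G) :
    ∫ ξ, G ξ ∂unitCube 3
      = ∫ a in (0 : ℝ)..1, ∫ b in (0 : ℝ)..1, ∫ c in (0 : ℝ)..1, G ![a, b, c] := by
  rw [integral_unitCube_succ hG]
  refine intervalIntegral.integral_congr fun a _ => ?_
  exact integral_unitCube_two (G := fun ξ => G (Fin.cons (α := fun _ => ℝ) a ξ))
    (hG.comp (Continuous.finCons (A := fun _ => ℝ) continuous_const continuous_id))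

/-- The interval [0,1] is not centred at 0, hence the phase; it disappears in products along a
permutation. -/
theorem integral_exp_two_pi_mul (w : ℝ) :
    ∫ ξ in Set.Icc (0 : ℝ) 1, Complex.exp (2 * Real.pi * Complex.I * (ξ * w))
      = Complex.exp (Real.pi * Complex.I * w) * Real.sinc (Real.pi * w) := by
  rw [integral_Icc_eq_integral_Ioc, ← intervalIntegral.integral_of_le zero_le_one]
  by_cases hw : w = 0
  · simp [hw]
  have hc : (2 * Real.pi * Complex.I * w : ℂ) ≠ 0 := by
    simp [hw, Real.pi_ne_zero]
  have h1 : ∀ ξ : ℝ, Complex.exp (2 * Real.pi * Complex.I * (ξ * w))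
      = Complex.exp ((2 * Real.pi * Complex.I * w) * ξ) := fun ξ => by
    congr 1
    ring
  simp_rw [h1]
  rw [integral_exp_mul_complex hc, Real.sinc_of_ne_zero (by positivity)]
  have h2 : Complex.exp (2 * Real.pi * Complex.I * w * (1 : ℝ))
      = Complex.exp (Real.pi * Complex.I * w) * Complex.exp (Real.pi * w * Complex.I) := by
    rw [← Complex.exp_add]
    congr 1
    push_cast
    ring
  have h3 : (1 : ℂ) = Complex.exp (Real.pi * Complex.I * w) * Complex.exp (-(Real.pi * w) * Complex.I) := by
    rw [← Complex.exp_add, ← Complex.exp_zero]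
    congr 1
    ring
  have h4 : Complex.exp (2 * Real.pi * Complex.I * w * (0 : ℝ)) = 1 := by simp
  rw [h2, h4, h3]
  push_cast
  rw [Complex.sin]
  have hw' : (w : ℂ) ≠ 0 := by exact_mod_cast hw
  have hpi : (Real.pi : ℂ) ≠ 0 := by exact_mod_cast Real.pi_ne_zero
  field_simp
  rw [Complex.I_sq]
  ring

variable {n : ℕ} {b φ : Fin n → ℝ → ℝ}

/-- Fubini's theorem for a product of sine kernels along a permutation. -/
theorem integral_mul_prod_sinc (hb : ∀ i, Integrable (b i))
    (hφ : ∀ i (ξ : ℝ), ∫ x : ℝ, (b i x : ℂ) * Complex.exp (2 * Real.pi * Complex.I * (x * ξ)) = φ i ξ)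
    (σ : Equiv.Perm (Fin n)) :
    ∫ x : Fin n → ℝ, (∏ i, b i (x i)) * ∏ i, Real.sinc (Real.pi * (x (σ i) - x i))
      = ∫ ξ, ∏ i, φ i (ξ (σ.symm i) - ξ i) ∂unitCube n := by
  set e : (Fin n → ℝ) → (Fin n → ℝ) → ℂ := fun x ξ =>
    ∏ i, Complex.exp (2 * Real.pi * Complex.I * (ξ i * (x (σ i) - x i : ℝ))) with he
  -- Summation by parts along σ: ∑ ξᵢ(x_{σi} - xᵢ) = ∑ xᵢ(ξ_{σ⁻¹i} - ξᵢ).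
  have he' : ∀ x ξ, e x ξ
      = ∏ i, Complex.exp (2 * Real.pi * Complex.I * (x i * (ξ (σ.symm i) - ξ i : ℝ))) := by
    intro x ξ
    simp only [he]
    rw [← Complex.exp_sum, ← Complex.exp_sum, ← Finset.mul_sum, ← Finset.mul_sum]
    congr 2
    have h1 : ∑ i, (ξ i : ℂ) * (x (σ i) : ℂ) = ∑ i, (x i : ℂ) * (ξ (σ.symm i) : ℂ) := by
      rw [← Equiv.sum_comp σ (fun i => (x i : ℂ) * (ξ (σ.symm i) : ℂ))]
      simp [mul_comm]
    push_cast
    simp_rw [mul_sub, Finset.sum_sub_distrib, h1, mul_comm]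
  have hen : ∀ x ξ, ‖e x ξ‖ = 1 := by
    intro x ξ
    simp only [he, norm_prod]
    refine Finset.prod_eq_one fun i _ => ?_
    rw [Complex.norm_exp]
    simp
  have hec : Continuous (Function.uncurry e) := by
    simp only [he, Function.uncurry_def]
    fun_prop
  set g : (Fin n → ℝ) → ℂ := fun x => ∏ i, (b i (x i) : ℂ) with hg
  have hgi : Integrable g := by
    rw [volume_pi]
    exact Integrable.fintype_prod (f := fun i x => (b i x : ℂ)) fun i => (hb i).ofReal
  -- The phases have modulus 1 and the cube has finite measure, so integrability of the weights
  -- alone justifies exchanging the integrals.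
  have hFi : Integrable (Function.uncurry fun x ξ => e x ξ * g x)
      (volume.prod (unitCube n)) := by
    have h1 := hgi.mul_prod (integrable_const (1 : ℂ) : Integrable (fun _ => (1 : ℂ)) (unitCube n))
    have h2 := h1.bdd_mul (f := Function.uncurry e) (c := 1) hec.aestronglyMeasurable
      (Eventually.of_forall fun p => (hen p.1 p.2).le)
    simpa [Function.uncurry_def] using h2
  have hswap := integral_integral_swap hFi
  have hl : ∀ x, ∫ ξ, e x ξ * g x ∂unitCube n
      = (((∏ i, b i (x i)) * ∏ i, Real.sinc (Real.pi * (x (σ i) - x i)) : ℝ) : ℂ) := by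
    intro x
    rw [integral_mul_const]
    simp only [he, unitCube]
    rw [integral_fintype_prod_eq_prod (f := fun i (s : ℝ) =>
      Complex.exp (2 * Real.pi * Complex.I * (s * (x (σ i) - x i : ℝ))))]
    simp_rw [integral_exp_two_pi_mul]
    rw [Finset.prod_mul_distrib, ← Complex.exp_sum, ← Finset.mul_sum]
    -- The phases combine into exp(πi∑(x_{σi} - xᵢ)) = 1.
    have h1 : ∑ i, ((x (σ i) - x i : ℝ) : ℂ) = 0 := by
      push_cast
      rw [Finset.sum_sub_distrib, Equiv.sum_comp σ (fun i => (x i : ℂ)), sub_self]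
    rw [h1, mul_zero, Complex.exp_zero, one_mul]
    simp only [hg]
    push_cast
    ring
  have hr : ∀ ξ : Fin n → ℝ, ∫ x, e x ξ * g x = ((∏ i, φ i (ξ (σ.symm i) - ξ i) : ℝ) : ℂ) := by
    intro ξ
    simp_rw [he', hg, ← Finset.prod_mul_distrib]
    rw [integral_fintype_prod_volume_eq_prod (f := fun i (s : ℝ) =>
      Complex.exp (2 * Real.pi * Complex.I * (s * (ξ (σ.symm i) - ξ i : ℝ))) * (b i s : ℂ))]
    push_cast
    refine Finset.prod_congr rfl fun i _ => ?_
    rw [← Complex.ofReal_sub, ← hφ i]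
    simp_rw [mul_comm]
  simp_rw [hl, hr] at hswap
  rw [integral_complex_ofReal, integral_complex_ofReal] at hswap
  exact_mod_cast hswap

end SineKernelFourier

/-! ### Fourier transforms and moments of the Poisson kernel -/

section PoissonFourier

open MeasureTheory

/-- A Cauchy-density majorant, used both for integrability and for decay at infinity. Half of the
exponent absorbs the linear factor and the other half the quadratic one. -/
theorem linear_mul_exp_neg_le {α ρ κ v : ℝ} (hα : 0 < α) (hρ : 0 ≤ ρ) (hκ : 0 ≤ κ) (hv : 0 ≤ v) :
    (ρ * v + κ) * Real.exp (-(α * v)) ≤ (2 * ρ / α + κ) * (1 + (α / 4 * v) ^ 2)⁻¹ := by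
  set x := α * v / 2 with hx
  have hx0 : 0 ≤ x := by positivity
  have h1 := Real.quadratic_le_exp_of_nonneg hx0
  have h2 : Real.exp (α * v) = Real.exp x * Real.exp x := by
    rw [← Real.exp_add]; congr 1; rw [hx]; ring
  have hv' : v = 2 / α * x := by rw [hx]; field_simp
  have h3 : ρ * v + κ ≤ (2 * ρ / α + κ) * Real.exp x := by
    have h4 : ρ * v = 2 * ρ / α * x := by rw [hv']; ring
    have h5 : x ≤ Real.exp x := by nlinarith
    have h6 : 1 ≤ Real.exp x := by nlinarith
    have h7 : 0 ≤ 2 * ρ / α := by positivity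
    rw [h4]
    nlinarith [mul_le_mul_of_nonneg_left h5 h7, mul_le_mul_of_nonneg_left h6 hκ]
  have h8 : 1 + (α / 4 * v) ^ 2 ≤ Real.exp x := by
    have : (α / 4 * v) ^ 2 = x ^ 2 / 4 := by rw [hx]; ring
    rw [this]
    nlinarith [sq_nonneg x]
  rw [Real.exp_neg, ← div_eq_mul_inv, ← div_eq_mul_inv, div_le_div_iff₀ (Real.exp_pos _)
    (by positivity), h2]
  have h9 : 0 ≤ 2 * ρ / α + κ := by positivity
  have h10 := Real.exp_pos x
  calc (ρ * v + κ) * (1 + (α / 4 * v) ^ 2) ≤ (2 * ρ / α + κ) * Real.exp x * Real.exp x := by gcongr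
    _ = _ := by ring

theorem integral_linear_mul_cexp_neg {s : ℂ} (hs : 0 < s.re) {ρ κ : ℝ} (hρ : 0 ≤ ρ) (hκ : 0 ≤ κ) :
    IntegrableOn (fun v : ℝ => ((ρ * v + κ : ℝ) : ℂ) * Complex.exp (-(s * v))) (Set.Ioi 0) ∧
    ∫ v in Set.Ioi (0 : ℝ), ((ρ * v + κ : ℝ) : ℂ) * Complex.exp (-(s * v))
      = ρ / s ^ 2 + κ / s := by
  have hs0 : s ≠ 0 := fun h => by simp [h] at hs
  have hn : ∀ {ρ κ v : ℝ}, 0 ≤ ρ → 0 ≤ κ → 0 ≤ v →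
      ‖((ρ * v + κ : ℝ) : ℂ) * Complex.exp (-(s * v))‖
        ≤ (2 * ρ / s.re + κ) * (1 + (s.re / 4 * v) ^ 2)⁻¹ := by
    intro ρ κ v hρ hκ hv
    rw [norm_mul, Complex.norm_exp, Complex.norm_real, Real.norm_eq_abs,
      abs_of_nonneg (by positivity)]
    simpa using linear_mul_exp_neg_le hs hρ hκ hv
  have hbi : ∀ C : ℝ, Integrable (fun v : ℝ => C * (1 + (s.re / 4 * v) ^ 2)⁻¹) := fun C =>
    (integrable_inv_one_add_sq.comp_mul_left' (by positivity : s.re / 4 ≠ 0)).const_mul C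
  have hint : IntegrableOn (fun v : ℝ => ((ρ * v + κ : ℝ) : ℂ) * Complex.exp (-(s * v)))
      (Set.Ioi 0) := by
    refine Integrable.mono' (hbi (2 * ρ / s.re + κ)).integrableOn ?_ ?_
    · exact Continuous.aestronglyMeasurable (by fun_prop)
    · refine (ae_restrict_mem measurableSet_Ioi).mono fun v hv => hn hρ hκ (le_of_lt hv)
  refine ⟨hint, ?_⟩
  set F : ℝ → ℂ := fun v => -(((ρ * v + κ : ℝ) : ℂ) / s + ρ / s ^ 2) * Complex.exp (-(s * v)) with hF
  have hderiv : ∀ v ∈ Set.Ici (0 : ℝ), HasDerivAt F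
      (((ρ * v + κ : ℝ) : ℂ) * Complex.exp (-(s * v))) v := by
    intro v _
    have h1 : HasDerivAt (fun v : ℝ => ((ρ * v + κ : ℝ) : ℂ)) (ρ : ℂ) v := by
      have : HasDerivAt (fun v : ℝ => ρ * v + κ) ρ v := by
        simpa using ((hasDerivAt_id v).const_mul ρ).add_const κ
      exact this.ofReal_comp
    have h2 : HasDerivAt (fun v : ℝ => -(s * (v : ℂ))) (-s) v := by
      simpa using! ((hasDerivAt_id v).ofReal_comp.const_mul s).neg
    have h3 := ((h1.div_const s).add_const ((ρ : ℂ) / s ^ 2)).neg.mul h2.cexp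
    convert! h3 using 1
    simp only [Pi.neg_apply]
    field_simp
    ring
  have hzero : ∀ {ρ κ : ℝ}, 0 ≤ ρ → 0 ≤ κ →
      Tendsto (fun v : ℝ => ((ρ * v + κ : ℝ) : ℂ) * Complex.exp (-(s * v))) atTop (𝓝 0) := by
    intro ρ κ hρ hκ
    refine squeeze_zero_norm' (a := fun v => (2 * ρ / s.re + κ) * (1 + (s.re / 4 * v) ^ 2)⁻¹) ?_ ?_
    · filter_upwards [eventually_ge_atTop 0] with v hv using hn hρ hκ hv
    · have h1 : Tendsto (fun v : ℝ => 1 + (s.re / 4 * v) ^ 2) atTop atTop := by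
        refine tendsto_atTop_add_const_left _ _ ((tendsto_pow_atTop two_ne_zero).comp ?_)
        exact tendsto_id.const_mul_atTop (by positivity)
      simpa using (tendsto_inv_atTop_zero.comp h1).const_mul (2 * ρ / s.re + κ)
  have hlim : Tendsto F atTop (𝓝 0) := by
    have h1 := (hzero hρ hκ).const_mul (-1 / s)
    have h2 := (hzero (ρ := 0) (κ := 1) le_rfl zero_le_one).const_mul (-(ρ / s ^ 2))
    have h3 := h1.add h2
    rw [mul_zero, mul_zero, add_zero] at h3
    refine h3.congr fun v => ?_
    simp only [hF]
    push_cast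
    ring
  rw [integral_Ioi_of_hasDerivAt_of_tendsto' hderiv hint hlim]
  simp [hF]
  ring

/-- The Fourier transform of `(ρ|v| + κ) exp (-α|v|)`. -/
theorem integral_linear_abs_mul_exp {α ρ κ : ℝ} (hα : 0 < α) (hρ : 0 ≤ ρ) (hκ : 0 ≤ κ) :
    Integrable (fun v : ℝ => (ρ * |v| + κ) * Real.exp (-(α * |v|))) ∧
    ∀ w : ℝ, ∫ v : ℝ, (((ρ * |v| + κ) * Real.exp (-(α * |v|)) : ℝ) : ℂ)
        * Complex.exp (-(2 * Real.pi * Complex.I * (v * w)))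
      = (ρ / (α + 2 * Real.pi * w * Complex.I) ^ 2 + κ / (α + 2 * Real.pi * w * Complex.I))
        + (ρ / (α - 2 * Real.pi * w * Complex.I) ^ 2 + κ / (α - 2 * Real.pi * w * Complex.I)) := by
  have hint : Integrable (fun v : ℝ => (ρ * |v| + κ) * Real.exp (-(α * |v|))) := by
    refine Integrable.mono' ((integrable_inv_one_add_sq.comp_mul_left'
      (by positivity : α / 4 ≠ 0)).const_mul (2 * ρ / α + κ)) ?_ (Eventually.of_forall fun v => ?_)
    · exact Continuous.aestronglyMeasurable (by fun_prop)
    · rw [Real.norm_eq_abs, abs_of_nonneg (by positivity)]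
      simpa only [mul_pow, sq_abs] using linear_mul_exp_neg_le hα hρ hκ (abs_nonneg v)
  refine ⟨hint, fun w => ?_⟩
  set f : ℝ → ℂ := fun v => (((ρ * |v| + κ) * Real.exp (-(α * |v|)) : ℝ) : ℂ)
    * Complex.exp (-(2 * Real.pi * Complex.I * (v * w))) with hf
  have hfi : Integrable f := by
    refine hint.ofReal.mul_bdd (c := 1) ?_ (Eventually.of_forall fun v => ?_)
    · exact Continuous.aestronglyMeasurable (by fun_prop)
    · rw [Complex.norm_exp]
      simp
  have hsplit := integral_add_compl (measurableSet_Ioi (a := (0 : ℝ))) hfi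
  rw [Set.compl_Ioi] at hsplit
  rw [← hsplit]
  have hneg : ∫ v in Set.Iic (0 : ℝ), f v = ∫ v in Set.Ioi (0 : ℝ), f (-v) := by
    simp [integral_comp_neg_Ioi 0 f]
  rw [hneg]
  congr 1
  · rw [← (integral_linear_mul_cexp_neg (s := α + 2 * Real.pi * w * Complex.I) (by simpa) hρ hκ).2]
    refine setIntegral_congr_fun measurableSet_Ioi fun v hv => ?_
    simp only [hf, abs_of_pos (Set.mem_Ioi.1 hv)]
    push_cast
    rw [mul_assoc, ← Complex.exp_add]
    congr 2
    ring
  · rw [← (integral_linear_mul_cexp_neg (s := α - 2 * Real.pi * w * Complex.I) (by simpa) hρ hκ).2]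
    refine setIntegral_congr_fun measurableSet_Ioi fun v hv => ?_
    simp only [hf, abs_neg, abs_of_pos (Set.mem_Ioi.1 hv)]
    push_cast
    rw [mul_assoc, ← Complex.exp_add]
    congr 2
    ring

open FourierTransform in
/-- Fourier inversion in the form used here. -/
theorem integral_mul_cexp_of_fourier {f g : ℝ → ℝ} (hf : Continuous f) (hfi : Integrable f)
    (hg : Integrable g)
    (h : ∀ w : ℝ, ∫ v : ℝ, (f v : ℂ) * Complex.exp (-(2 * Real.pi * Complex.I * (v * w))) = g w)
    (ξ : ℝ) : ∫ x : ℝ, (g x : ℂ) * Complex.exp (2 * Real.pi * Complex.I * (x * ξ)) = f ξ := by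
  have hF : 𝓕 (fun v => (f v : ℂ)) = fun w => (g w : ℂ) := by
    ext w
    rw [Real.fourier_real_eq_integral_exp_smul, ← h w]
    refine integral_congr_ae (Eventually.of_forall fun v => ?_)
    simp only [smul_eq_mul]
    rw [mul_comm]
    congr 2
    push_cast
    ring
  have hinv := Continuous.fourierInv_fourier_eq (f := fun v => (f v : ℂ)) (by fun_prop) hfi.ofReal
    (by rw [hF]; exact hg.ofReal)
  have := congrFun hinv ξ
  rw [hF, Real.fourierInv_eq'] at this
  rw [← this]
  refine integral_congr_ae (Eventually.of_forall fun x => ?_)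
  simp only [smul_eq_mul]
  rw [mul_comm]
  congr 2
  simp
  ring

variable {α : ℝ}

theorem add_mul_I_ne_zero (hα : 0 < α) (r : ℝ) :
    (α + r * Complex.I : ℂ) ≠ 0 ∧ (α - r * Complex.I : ℂ) ≠ 0 := by
  constructor <;>
  · intro h
    have := congrArg Complex.re h
    simp at this
    exact hα.ne' this

theorem integrable_poissonKernelLine_pow (hα : 0 < α) {k : ℕ} (hk : k ≠ 0) :
    Integrable (fun x => poissonKernelLine α x ^ k) := by
  obtain ⟨A, hA⟩ := exists_poissonKernelLine_le hα
  exact integrable_pow_of_le (contDiff_poissonKernelLine hα).continuous.measurable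
    (poissonKernelLine_nonneg hα) hA hk

theorem integrable_poissonKernelLine (hα : 0 < α) : Integrable (poissonKernelLine α) := by
  simpa using integrable_poissonKernelLine_pow hα one_ne_zero

/-- The transform of exp(-α|v|) is explicitly the Poisson kernel, and inversion gives the statement.
-/
theorem fourier_poissonKernelLine (hα : 0 < α) (ξ : ℝ) :
    ∫ x : ℝ, (poissonKernelLine α x : ℂ) * Complex.exp (2 * Real.pi * Complex.I * (x * ξ))
      = (Real.exp (-(α * |ξ|)) : ℝ) := by
  obtain ⟨hi, hF⟩ := integral_linear_abs_mul_exp hα (ρ := 0) (κ := 1) le_rfl zero_le_one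
  simp only [zero_mul, zero_add, one_mul] at hi hF
  refine integral_mul_cexp_of_fourier (f := fun v => Real.exp (-(α * |v|))) (by fun_prop) hi
    (integrable_poissonKernelLine hα) (fun w => ?_) ξ
  rw [hF w]
  obtain ⟨h1, h2⟩ := add_mul_I_ne_zero hα (2 * Real.pi * w)
  push_cast at h1 h2
  have h3 : (α ^ 2 + 4 * Real.pi ^ 2 * w ^ 2 : ℂ) ≠ 0 := by
    have : (0 : ℝ) < α ^ 2 + 4 * Real.pi ^ 2 * w ^ 2 := by positivity
    exact_mod_cast this.ne'
  have h4 : (α + 2 * Real.pi * w * Complex.I) * (α - 2 * Real.pi * w * Complex.I)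
      = (α ^ 2 + 4 * Real.pi ^ 2 * w ^ 2 : ℂ) := by
    ring_nf
    rw [Complex.I_sq]
    ring
  unfold poissonKernelLine
  push_cast
  rw [← h4, zero_div, zero_div, zero_add, zero_add, div_add_div _ _ h1 h2]
  congr 1
  ring

/-- A square corresponds to a self-convolution: that of exp(-α|v|) is (|v|+1/α)exp(-α|v|). Its
transform is computed directly and then inverted. -/
theorem fourier_poissonKernelLine_sq (hα : 0 < α) (ξ : ℝ) :
    ∫ x : ℝ, ((poissonKernelLine α x ^ 2 : ℝ) : ℂ) * Complex.exp (2 * Real.pi * Complex.I * (x * ξ))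
      = ((|ξ| + 1 / α) * Real.exp (-(α * |ξ|)) : ℝ) := by
  obtain ⟨hi, hF⟩ := integral_linear_abs_mul_exp hα (ρ := 1) (κ := 1 / α) zero_le_one
    (by positivity)
  simp only [one_mul] at hi hF
  refine integral_mul_cexp_of_fourier (f := fun v => (|v| + 1 / α) * Real.exp (-(α * |v|)))
    (by fun_prop) hi (integrable_poissonKernelLine_pow hα two_ne_zero) (fun w => ?_) ξ
  rw [hF w]
  obtain ⟨h1, h2⟩ := add_mul_I_ne_zero hα (2 * Real.pi * w)
  push_cast at h1 h2
  have hα' : (α : ℂ) ≠ 0 := by exact_mod_cast hα.ne'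
  have h4 : (α + 2 * Real.pi * w * Complex.I) * (α - 2 * Real.pi * w * Complex.I)
      = (α ^ 2 + 4 * Real.pi ^ 2 * w ^ 2 : ℂ) := by
    ring_nf
    rw [Complex.I_sq]
    ring
  unfold poissonKernelLine
  push_cast
  rw [← h4]
  field_simp
  ring

theorem integral_poissonKernelLine_sq (hα : 0 < α) : ∫ x, poissonKernelLine α x ^ 2 = 1 / α := by
  have := fourier_poissonKernelLine_sq hα 0
  simp only [Complex.ofReal_zero, mul_zero, Complex.exp_zero, mul_one, abs_zero, neg_zero,
    Real.exp_zero, zero_add] at this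
  rw [integral_complex_ofReal] at this
  exact_mod_cast this

theorem tendsto_div_one_add_sq : Tendsto (fun u : ℝ => u / (1 + u ^ 2)) atTop (𝓝 0) := by
  refine squeeze_zero' (g := fun u : ℝ => u⁻¹) ?_ ?_ tendsto_inv_atTop_zero
  · filter_upwards [eventually_ge_atTop 0] with u hu
    positivity
  · filter_upwards [eventually_gt_atTop 0] with u hu
    rw [div_le_iff₀ (by positivity)]
    field_simp
    linarith

theorem integral_inv_one_add_sq_cube : ∫ u : ℝ, ((1 + u ^ 2)⁻¹) ^ 3 = 3 * Real.pi / 8 := by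
  -- The primitive given by the reduction formula; it is odd, so only the limit at +∞ has to be
  -- found.
  set F : ℝ → ℝ := fun u => 3 / 8 * Real.arctan u + 3 / 8 * (u / (1 + u ^ 2))
    + 1 / 4 * (u / (1 + u ^ 2) * (1 / (1 + u ^ 2))) with hF
  have hderiv : ∀ u, HasDerivAt F (((1 + u ^ 2)⁻¹) ^ 3) u := by
    intro u
    have hu : 1 + u ^ 2 ≠ 0 := by positivity
    have h1 : HasDerivAt (fun u : ℝ => 1 + u ^ 2) (2 * u) u := by
      simpa using ((hasDerivAt_pow 2 u).const_add 1)
    have h2 := (hasDerivAt_id u).div h1 hu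
    have h3 := (hasDerivAt_const u (1 : ℝ)).div h1 hu
    have h4 := (((Real.hasDerivAt_arctan u).const_mul (3 / 8)).add (h2.const_mul (3 / 8))).add
      ((h2.mul h3).const_mul (1 / 4))
    convert! h4 using 1
    simp only [id, Pi.div_apply]
    field_simp
    ring
  have hint : Integrable fun u : ℝ => ((1 + u ^ 2)⁻¹) ^ 3 := by
    refine integrable_pow_of_le (A := 1) (by fun_prop) (fun u => by positivity)
      (fun u => by rw [one_div]) three_ne_zero
  have hinv : Tendsto (fun u : ℝ => 1 / (1 + u ^ 2)) atTop (𝓝 0) := by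
    have h1 : Tendsto (fun u : ℝ => 1 + u ^ 2) atTop atTop :=
      tendsto_atTop_add_const_left _ _ (tendsto_pow_atTop two_ne_zero)
    simpa using! tendsto_inv_atTop_zero.comp h1
  have htop : Tendsto F atTop (𝓝 (3 / 8 * (Real.pi / 2) + 3 / 8 * 0 + 1 / 4 * (0 * 0))) :=
    ((((Real.tendsto_arctan_atTop.mono_right nhdsWithin_le_nhds).const_mul _).add
      (tendsto_div_one_add_sq.const_mul _)).add
      ((tendsto_div_one_add_sq.mul hinv).const_mul _))
  have hodd : ∀ u, F (-u) = -F u := by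
    intro u
    simp only [hF, Real.arctan_neg, neg_sq]
    ring
  have hbot : Tendsto F atBot (𝓝 (-(3 / 8 * (Real.pi / 2) + 3 / 8 * 0 + 1 / 4 * (0 * 0)))) := by
    have := (htop.comp tendsto_neg_atBot_atTop).neg
    refine this.congr fun u => ?_
    simp only [Function.comp]
    rw [hodd, neg_neg]
  rw [integral_of_hasDerivAt_of_tendsto hderiv hint hbot htop]
  ring

theorem integral_poissonKernelLine_cube (hα : 0 < α) :
    ∫ x, poissonKernelLine α x ^ 3 = 3 / (2 * α ^ 2) := by
  have hpi := Real.pi_pos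
  have h0 : ∀ x, poissonKernelLine α x ^ 3
      = (2 / α) ^ 3 * ((1 + (2 * Real.pi / α * x) ^ 2)⁻¹) ^ 3 := by
    intro x
    unfold poissonKernelLine
    have : 0 < α ^ 2 + 4 * Real.pi ^ 2 * x ^ 2 := by positivity
    rw [← mul_pow]
    congr 1
    field_simp
    ring
  simp_rw [h0]
  rw [integral_const_mul, Measure.integral_comp_mul_left (fun u => ((1 + u ^ 2)⁻¹) ^ 3),
    integral_inv_one_add_sq_cube, abs_of_pos (by positivity), smul_eq_mul]
  field_simp
  ring

end PoissonFourier

/-! ### Determinantal integrals expanded over permutations -/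

section MomentEvaluation

open MeasureTheory

/-- The product of sine kernels along a permutation. -/
noncomputable def sineProd {n : ℕ} (σ : Equiv.Perm (Fin n)) (x : Fin n → ℝ) : ℝ :=
  ∏ i, Real.sinc (Real.pi * (x (σ i) - x i))

theorem integrable_mul_sineProd {n : ℕ} {b : Fin n → ℝ → ℝ} (hb : ∀ i, Integrable (b i))
    (σ : Equiv.Perm (Fin n)) : Integrable fun x : Fin n → ℝ => (∏ i, b i (x i)) * sineProd σ x := by
  have h1 : Integrable fun x : Fin n → ℝ => ∏ i, b i (x i) := by
    rw [volume_pi]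
    exact Integrable.fintype_prod hb
  refine h1.mul_bdd (c := 1) ?_ (Eventually.of_forall fun x => ?_)
  · unfold sineProd
    refine (continuous_finsetProd _ fun i _ => Real.continuous_sinc.comp ?_).aestronglyMeasurable
    fun_prop
  · rw [sineProd, norm_prod]
    exact Finset.prod_le_one (fun _ _ => norm_nonneg _) fun i _ => Real.abs_sinc_le_one _

theorem gueDensity_two (x : Fin 2 → ℝ) :
    gueDensity x = sineProd 1 x - sineProd (Equiv.swap 0 1) x := by
  unfold gueDensity sineProd
  rw [Matrix.det_fin_two]
  simp [Fin.prod_univ_two]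
  ring

theorem gueDensity_three (x : Fin 3 → ℝ) :
    gueDensity x = sineProd 1 x - sineProd (Equiv.swap 0 1) x - sineProd (Equiv.swap 0 2) x
      - sineProd (Equiv.swap 1 2) x + sineProd (finRotate 3) x + sineProd (finRotate 3).symm x := by
  have e1 : ∀ i : Fin 3, (finRotate 3) i = ![1, 2, 0] i := by decide
  have e2 : ∀ i : Fin 3, (finRotate 3).symm i = ![2, 0, 1] i := by decide
  have e3 : ∀ i : Fin 3, Equiv.swap (0 : Fin 3) 1 i = ![1, 0, 2] i := by decide
  have e4 : ∀ i : Fin 3, Equiv.swap (0 : Fin 3) 2 i = ![2, 1, 0] i := by decide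
  have e5 : ∀ i : Fin 3, Equiv.swap (1 : Fin 3) 2 i = ![0, 2, 1] i := by decide
  unfold gueDensity sineProd
  rw [Matrix.det_fin_three]
  simp [Fin.prod_univ_three, e1, e2, e3, e4, e5]
  ring

/-- The identity gives the product of the total masses; the transposition gives the integral over
the unit square. -/
theorem integral_mul_gueDensity_two {f g F G : ℝ → ℝ} (hf : Integrable f) (hg : Integrable g)
    (hF : Continuous F) (hG : Continuous G)
    (hfF : ∀ ξ : ℝ, ∫ x : ℝ, (f x : ℂ) * Complex.exp (2 * Real.pi * Complex.I * (x * ξ)) = F ξ)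
    (hgG : ∀ ξ : ℝ, ∫ x : ℝ, (g x : ℂ) * Complex.exp (2 * Real.pi * Complex.I * (x * ξ)) = G ξ) :
    ∫ x : Fin 2 → ℝ, f (x 0) * g (x 1) * gueDensity x
      = F 0 * G 0 - ∫ a in (0 : ℝ)..1, ∫ b in (0 : ℝ)..1, F (b - a) * G (a - b) := by
  have hb : ∀ i, Integrable ((![f, g] : Fin 2 → ℝ → ℝ) i) := fun i => by
    fin_cases i
    · exact hf
    · exact hg
  have hφ : ∀ i (ξ : ℝ), ∫ x : ℝ, ((![f, g] : Fin 2 → ℝ → ℝ) i x : ℂ)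
      * Complex.exp (2 * Real.pi * Complex.I * (x * ξ)) = (![F, G] : Fin 2 → ℝ → ℝ) i ξ := fun i => by
    fin_cases i
    · exact hfF
    · exact hgG
  have hsplit : ∀ x : Fin 2 → ℝ, f (x 0) * g (x 1) * gueDensity x
      = (∏ i, (![f, g] : Fin 2 → ℝ → ℝ) i (x i)) * sineProd 1 x
        - (∏ i, (![f, g] : Fin 2 → ℝ → ℝ) i (x i)) * sineProd (Equiv.swap 0 1) x := by
    intro x
    rw [gueDensity_two, Fin.prod_univ_two]
    simp
    ring
  simp_rw [hsplit]
  rw [integral_sub (integrable_mul_sineProd hb _) (integrable_mul_sineProd hb _)]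
  have h1 := integral_mul_prod_sinc hb hφ 1
  have h2 := integral_mul_prod_sinc hb hφ (Equiv.swap 0 1)
  rw [integral_unitCube_two] at h1 h2
  · have hone : (1 : Equiv.Perm (Fin 2)).symm = 1 := rfl
    unfold sineProd
    rw [h1, h2]
    simp [Fin.prod_univ_two, hone]
  · simp only [Fin.prod_univ_two]
    simp
    fun_prop
  · simp only [Fin.prod_univ_two]
    simp
    fun_prop

/-- Evenness of F makes the three transpositions contribute equally, and likewise the two 3-cycles.
-/
theorem integral_mul_gueDensity_three {f F : ℝ → ℝ} (hf : Integrable f) (hF : Continuous F)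
    (hfF : ∀ ξ : ℝ, ∫ x : ℝ, (f x : ℂ) * Complex.exp (2 * Real.pi * Complex.I * (x * ξ)) = F ξ)
    (heven : ∀ ξ, F (-ξ) = F ξ) :
    ∫ x : Fin 3 → ℝ, f (x 0) * f (x 1) * f (x 2) * gueDensity x
      = F 0 ^ 3 - 3 * F 0 * (∫ a in (0 : ℝ)..1, ∫ b in (0 : ℝ)..1, F (a - b) ^ 2)
        + 2 * ∫ a in (0 : ℝ)..1, ∫ b in (0 : ℝ)..1, ∫ c in (0 : ℝ)..1,
          F (a - b) * F (b - c) * F (c - a) := by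
  have hsymm : ∀ u v, F (u - v) = F (v - u) := fun u v => by rw [← heven, neg_sub]
  have e1 : ∀ i : Fin 3, (finRotate 3) i = ![1, 2, 0] i := by decide
  have e2 : ∀ i : Fin 3, (finRotate 3).symm i = ![2, 0, 1] i := by decide
  have e3 : ∀ i : Fin 3, Equiv.swap (0 : Fin 3) 1 i = ![1, 0, 2] i := by decide
  have e4 : ∀ i : Fin 3, Equiv.swap (0 : Fin 3) 2 i = ![2, 1, 0] i := by decide
  have e5 : ∀ i : Fin 3, Equiv.swap (1 : Fin 3) 2 i = ![0, 2, 1] i := by decide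
  have hb : ∀ _ : Fin 3, Integrable f := fun _ => hf
  have hi := integrable_mul_sineProd hb
  set P : Equiv.Perm (Fin 3) → (Fin 3 → ℝ) → ℝ := fun σ x => (∏ i, f (x i)) * sineProd σ x with hP
  have hsplit : (fun x : Fin 3 → ℝ => f (x 0) * f (x 1) * f (x 2) * gueDensity x)
      = P 1 - P (Equiv.swap 0 1) - P (Equiv.swap 0 2) - P (Equiv.swap 1 2) + P (finRotate 3)
        + P (finRotate 3).symm := by
    ext x
    simp only [hP, Pi.add_apply, Pi.sub_apply]
    rw [gueDensity_three, Fin.prod_univ_three]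
    ring
  have hval : ∀ σ : Equiv.Perm (Fin 3), ∫ x : Fin 3 → ℝ, P σ x
      = ∫ a in (0 : ℝ)..1, ∫ b in (0 : ℝ)..1, ∫ c in (0 : ℝ)..1,
          ∏ i, F (![a, b, c] (σ.symm i) - ![a, b, c] i) := by
    intro σ
    simp only [hP, sineProd]
    rw [integral_mul_prod_sinc hb (φ := fun _ => F) (fun _ => hfF) σ, integral_unitCube_three]
    fun_prop
  rw [hsplit, integral_add' (((((hi 1).sub (hi _)).sub (hi _)).sub (hi _)).add (hi _)) (hi _),
    integral_add' ((((hi 1).sub (hi _)).sub (hi _)).sub (hi _)) (hi _),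
    integral_sub' (((hi 1).sub (hi _)).sub (hi _)) (hi _),
    integral_sub' ((hi 1).sub (hi _)) (hi _), integral_sub' (hi 1) (hi _)]
  rw [hval, hval, hval, hval, hval, hval]
  have v1 : (∫ a in (0 : ℝ)..1, ∫ b in (0 : ℝ)..1, ∫ c in (0 : ℝ)..1,
      ∏ i, F (![a, b, c] ((1 : Equiv.Perm (Fin 3)).symm i) - ![a, b, c] i)) = F 0 ^ 3 := by
    have hone : (1 : Equiv.Perm (Fin 3)).symm = 1 := rfl
    simp [hone]
  have v2 : (∫ a in (0 : ℝ)..1, ∫ b in (0 : ℝ)..1, ∫ c in (0 : ℝ)..1,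
      ∏ i, F (![a, b, c] ((Equiv.swap (0 : Fin 3) 1).symm i) - ![a, b, c] i))
      = F 0 * ∫ a in (0 : ℝ)..1, ∫ b in (0 : ℝ)..1, F (a - b) ^ 2 := by
    simp only [Equiv.symm_swap, e3, Fin.prod_univ_three]
    simp only [Matrix.cons_val, sub_self, intervalIntegral.integral_const, sub_zero, one_smul,
      intervalIntegral.integral_mul_const]
    rw [mul_comm]
    congr 1
    refine intervalIntegral.integral_congr fun a _ => intervalIntegral.integral_congr fun b _ => ?_
    rw [hsymm b a, pow_two]
  have v3 : (∫ a in (0 : ℝ)..1, ∫ b in (0 : ℝ)..1, ∫ c in (0 : ℝ)..1,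
      ∏ i, F (![a, b, c] ((Equiv.swap (0 : Fin 3) 2).symm i) - ![a, b, c] i))
      = F 0 * ∫ a in (0 : ℝ)..1, ∫ b in (0 : ℝ)..1, F (a - b) ^ 2 := by
    simp only [Equiv.symm_swap, e4, Fin.prod_univ_three]
    simp only [Matrix.cons_val, sub_self, intervalIntegral.integral_const, sub_zero, one_smul]
    rw [← intervalIntegral.integral_const_mul]
    refine intervalIntegral.integral_congr fun a _ => ?_
    rw [← intervalIntegral.integral_const_mul]
    refine intervalIntegral.integral_congr fun b _ => ?_
    rw [hsymm b a]
    ring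
  have v4 : (∫ a in (0 : ℝ)..1, ∫ b in (0 : ℝ)..1, ∫ c in (0 : ℝ)..1,
      ∏ i, F (![a, b, c] ((Equiv.swap (1 : Fin 3) 2).symm i) - ![a, b, c] i))
      = F 0 * ∫ a in (0 : ℝ)..1, ∫ b in (0 : ℝ)..1, F (a - b) ^ 2 := by
    simp only [Equiv.symm_swap, e5, Fin.prod_univ_three]
    simp only [Matrix.cons_val, sub_self, intervalIntegral.integral_const, sub_zero, one_smul]
    rw [← intervalIntegral.integral_const_mul]
    refine intervalIntegral.integral_congr fun a _ => ?_
    rw [← intervalIntegral.integral_const_mul]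
    refine intervalIntegral.integral_congr fun b _ => ?_
    rw [hsymm b a]
    ring
  have v5 : (∫ a in (0 : ℝ)..1, ∫ b in (0 : ℝ)..1, ∫ c in (0 : ℝ)..1,
      ∏ i, F (![a, b, c] ((finRotate 3).symm i) - ![a, b, c] i))
      = ∫ a in (0 : ℝ)..1, ∫ b in (0 : ℝ)..1, ∫ c in (0 : ℝ)..1,
          F (a - b) * F (b - c) * F (c - a) := by
    simp only [e2, Fin.prod_univ_three]
    refine intervalIntegral.integral_congr fun a _ => intervalIntegral.integral_congr fun b _ =>
      intervalIntegral.integral_congr fun c _ => ?_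
    simp only [Matrix.cons_val]
    ring
  have v6 : (∫ a in (0 : ℝ)..1, ∫ b in (0 : ℝ)..1, ∫ c in (0 : ℝ)..1,
      ∏ i, F (![a, b, c] ((finRotate 3).symm.symm i) - ![a, b, c] i))
      = ∫ a in (0 : ℝ)..1, ∫ b in (0 : ℝ)..1, ∫ c in (0 : ℝ)..1,
          F (a - b) * F (b - c) * F (c - a) := by
    simp only [Equiv.symm_symm, e1, Fin.prod_univ_three]
    refine intervalIntegral.integral_congr fun a _ => intervalIntegral.integral_congr fun b _ =>
      intervalIntegral.integral_congr fun c _ => ?_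
    simp only [Matrix.cons_val]
    rw [hsymm b a, hsymm c b, hsymm a c]
  rw [v1, v2, v3, v4, v5, v6]
  ring

end MomentEvaluation

/-! ### Elementary integrals of exponentials over squares and cubes -/

section ExplicitMoments

open MeasureTheory intervalIntegral

/-- Splitting the inner integral at b = a leaves G(a) + G(1-a), and either summand integrates to
H(1). -/
theorem integral_integral_abs_sub {F G H : ℝ → ℝ} (hF : Continuous F)
    (hG : ∀ x, HasDerivAt G (F x) x) (hH : ∀ x, HasDerivAt H (G x) x) (hG0 : G 0 = 0)
    (hH0 : H 0 = 0) :
    ∫ a in (0 : ℝ)..1, ∫ b in (0 : ℝ)..1, F |a - b| = 2 * H 1 := by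
  have hGc : Continuous G := continuous_iff_continuousAt.2 fun x => (hG x).continuousAt
  have hFG : ∀ u v, ∫ x in u..v, F x = G v - G u := fun u v =>
    integral_eq_sub_of_hasDerivAt (fun x _ => hG x) (hF.intervalIntegrable _ _)
  have hGH : ∀ u v, ∫ x in u..v, G x = H v - H u := fun u v =>
    integral_eq_sub_of_hasDerivAt (fun x _ => hH x) (hGc.intervalIntegrable _ _)
  have hinner : ∀ a ∈ Set.uIcc (0 : ℝ) 1, ∫ b in (0 : ℝ)..1, F |a - b| = G a + G (1 - a) := by
    intro a ha
    rw [Set.uIcc_of_le zero_le_one] at ha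
    have hc : Continuous fun b => F |a - b| := by fun_prop
    rw [← integral_add_adjacent_intervals (hc.intervalIntegrable 0 a) (hc.intervalIntegrable a 1)]
    have h1 : ∫ b in (0 : ℝ)..a, F |a - b| = ∫ b in (0 : ℝ)..a, F (a - b) := by
      refine integral_congr fun b hb => ?_
      rw [Set.uIcc_of_le ha.1] at hb
      simp only [abs_of_nonneg (sub_nonneg.2 hb.2)]
    have h2 : ∫ b in a..1, F |a - b| = ∫ b in a..1, F (b - a) := by
      refine integral_congr fun b hb => ?_
      rw [Set.uIcc_of_le ha.2] at hb
      simp only [abs_sub_comm a b, abs_of_nonneg (sub_nonneg.2 hb.1)]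
    rw [h1, h2, integral_comp_sub_left F a, integral_comp_sub_right F a, hFG, hFG]
    simp [hG0]
  have hGi : IntervalIntegrable (fun a => G (1 - a)) volume 0 1 :=
    Continuous.intervalIntegrable (by fun_prop) _ _
  rw [integral_congr hinner, integral_add (hGc.intervalIntegrable _ _) hGi,
    integral_comp_sub_left G 1, hGH, hGH]
  simp [hH0]
  ring

variable {β : ℝ}

theorem hasDerivAt_exp_neg_mul (β x : ℝ) :
    HasDerivAt (fun x => Real.exp (-(β * x))) (-(β * Real.exp (-(β * x)))) x := by
  have h1 : HasDerivAt (fun x : ℝ => -(β * x)) (-β) x := by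
    simpa using! ((hasDerivAt_id x).const_mul β).neg
  convert! h1.exp using 1
  ring

theorem integral_exp_neg_mul (hβ : β ≠ 0) (u v : ℝ) :
    ∫ x in u..v, Real.exp (-(β * x)) = (Real.exp (-(β * u)) - Real.exp (-(β * v))) / β := by
  have h : ∀ x ∈ Set.uIcc u v, HasDerivAt (fun x => -(Real.exp (-(β * x)) / β))
      (Real.exp (-(β * x))) x := by
    intro x _
    convert! ((hasDerivAt_exp_neg_mul β x).div_const β).neg using 1
    field_simp
  rw [integral_eq_sub_of_hasDerivAt h (Continuous.intervalIntegrable (by fun_prop) _ _)]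
  ring

theorem integral_integral_exp_abs (hβ : β ≠ 0) :
    ∫ a in (0 : ℝ)..1, ∫ b in (0 : ℝ)..1, Real.exp (-(β * |a - b|))
      = 2 * ((1 - (1 - Real.exp (-β)) / β) / β) := by
  have h := integral_integral_abs_sub (F := fun x => Real.exp (-(β * x)))
    (G := fun x => (1 - Real.exp (-(β * x))) / β)
    (H := fun x => (x - (1 - Real.exp (-(β * x))) / β) / β) (by fun_prop)
    (fun x => by
      convert! ((hasDerivAt_exp_neg_mul β x).const_sub 1).div_const β using 1
      field_simp) (fun x => by
      convert! ((hasDerivAt_id x).sub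
        (((hasDerivAt_exp_neg_mul β x).const_sub 1).div_const β)).div_const β using 1
      field_simp) (by simp) (by simp)
  simpa using h

theorem integral_integral_linear_mul_exp_abs (hβ : β ≠ 0) :
    ∫ a in (0 : ℝ)..1, ∫ b in (0 : ℝ)..1, (|a - b| + 2 / β) * Real.exp (-(β * |a - b|))
      = 2 * (3 / β ^ 2 + (1 / β ^ 2 + 4 / β ^ 3) * Real.exp (-β) - 4 / β ^ 3) := by
  have h := integral_integral_abs_sub (F := fun x => (x + 2 / β) * Real.exp (-(β * x)))
    (G := fun x => 3 / β ^ 2 - (x / β + 3 / β ^ 2) * Real.exp (-(β * x)))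
    (H := fun x => 3 / β ^ 2 * x + (x / β ^ 2 + 4 / β ^ 3) * Real.exp (-(β * x)) - 4 / β ^ 3)
    (by fun_prop)
    (fun x => by
      have h1 := ((((hasDerivAt_id x).div_const β).add_const (3 / β ^ 2)).mul
        (hasDerivAt_exp_neg_mul β x)).const_sub (3 / β ^ 2)
      convert! h1 using 1
      simp only [id]
      field_simp
      ring) (fun x => by
      have h1 := (((hasDerivAt_id x).const_mul (3 / β ^ 2)).add
        ((((hasDerivAt_id x).div_const (β ^ 2)).add_const (4 / β ^ 3)).mul
        (hasDerivAt_exp_neg_mul β x))).sub_const (4 / β ^ 3)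
      convert! h1 using 1
      simp only [id]
      field_simp
      ring) (by simp) (by simp)
  simpa using h

theorem integral_integral_exp_max (hβ : β ≠ 0) :
    ∫ a in (0 : ℝ)..1, ∫ b in (0 : ℝ)..1, Real.exp (-(β * max a b))
      = 2 * ((1 - Real.exp (-β)) / β ^ 2 - Real.exp (-β) / β) := by
  have hinner : ∀ a ∈ Set.uIcc (0 : ℝ) 1, ∫ b in (0 : ℝ)..1, Real.exp (-(β * max a b))
      = (a + 1 / β) * Real.exp (-(β * a)) - Real.exp (-β) / β := by
    intro a ha
    rw [Set.uIcc_of_le zero_le_one] at ha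
    have hc : Continuous fun b => Real.exp (-(β * max a b)) := by fun_prop
    rw [← integral_add_adjacent_intervals (hc.intervalIntegrable 0 a) (hc.intervalIntegrable a 1)]
    have h1 : ∫ b in (0 : ℝ)..a, Real.exp (-(β * max a b))
        = ∫ b in (0 : ℝ)..a, Real.exp (-(β * a)) := by
      refine integral_congr fun b hb => ?_
      rw [Set.uIcc_of_le ha.1] at hb
      simp only [max_eq_left hb.2]
    have h2 : ∫ b in a..1, Real.exp (-(β * max a b)) = ∫ b in a..1, Real.exp (-(β * b)) := by
      refine integral_congr fun b hb => ?_
      rw [Set.uIcc_of_le ha.2] at hb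
      simp only [max_eq_right hb.1]
    rw [h1, h2, integral_exp_neg_mul hβ, intervalIntegral.integral_const, smul_eq_mul]
    simp
    ring
  rw [integral_congr hinner]
  have h : ∀ x ∈ Set.uIcc (0 : ℝ) 1, HasDerivAt
      (fun x => -((x / β + 2 / β ^ 2) * Real.exp (-(β * x))) - Real.exp (-β) / β * x)
      ((x + 1 / β) * Real.exp (-(β * x)) - Real.exp (-β) / β) x := by
    intro x _
    have h1 := ((((hasDerivAt_id x).div_const β).add_const (2 / β ^ 2)).mul
        (hasDerivAt_exp_neg_mul β x)).neg.sub ((hasDerivAt_id x).const_mul (Real.exp (-β) / β))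
    convert! h1 using 1
    simp only [id]
    field_simp
    ring
  rw [integral_eq_sub_of_hasDerivAt h (Continuous.intervalIntegrable (by fun_prop) _ _)]
  simp
  field_simp
  ring

/-- The reflection (a,b) ↦ (1-a,1-b) exchanges 1 - min with max. -/
theorem integral_integral_exp_one_sub_min (hβ : β ≠ 0) :
    ∫ a in (0 : ℝ)..1, ∫ b in (0 : ℝ)..1, Real.exp (-(β * (1 - min a b)))
      = 2 * ((1 - Real.exp (-β)) / β ^ 2 - Real.exp (-β) / β) := by
  rw [← integral_integral_exp_max hβ]
  have h1 := integral_comp_sub_left (a := 0) (b := 1)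
    (fun a => ∫ b in (0 : ℝ)..1, Real.exp (-(β * max a b))) 1
  simp only [sub_self, sub_zero] at h1
  rw [← h1]
  refine integral_congr fun a _ => ?_
  have h2 := integral_comp_sub_left (a := 0) (b := 1)
    (fun b => Real.exp (-(β * max (1 - a) b))) 1
  simp only [sub_self, sub_zero] at h2
  rw [← h2]
  refine integral_congr fun b _ => ?_
  simp only [max_sub_sub_left]

/-- The three pairwise distances add up to twice the range of {a,b,c}, so the exponent is β times
that range. It equals b-c, b-a or c-a according to the position of c. -/
theorem integral_exp_three_abs_of_le (hβ : β ≠ 0) {a b : ℝ} (ha : 0 ≤ a) (hab : a ≤ b)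
    (hb : b ≤ 1) :
    ∫ c in (0 : ℝ)..1, Real.exp (-(β / 2 * (|a - b| + |b - c| + |c - a|)))
      = (|a - b| + 2 / β) * Real.exp (-(β * |a - b|))
        - (Real.exp (-(β * max a b)) + Real.exp (-(β * (1 - min a b)))) / β := by
  have hc : Continuous fun c => Real.exp (-(β / 2 * (|a - b| + |b - c| + |c - a|))) := by fun_prop
  rw [← integral_add_adjacent_intervals (hc.intervalIntegrable 0 a) (hc.intervalIntegrable a 1),
    ← integral_add_adjacent_intervals (hc.intervalIntegrable a b) (hc.intervalIntegrable b 1)]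
  have e : |a - b| = b - a := by rw [abs_sub_comm, abs_of_nonneg (sub_nonneg.2 hab)]
  have h1 : ∫ c in (0 : ℝ)..a, Real.exp (-(β / 2 * (|a - b| + |b - c| + |c - a|)))
      = ∫ c in (0 : ℝ)..a, Real.exp (-(β * (b - c))) := by
    refine integral_congr fun c hc => ?_
    rw [Set.uIcc_of_le ha] at hc
    simp only [e]
    rw [abs_of_nonneg (by linarith [hc.2] : 0 ≤ b - c), abs_sub_comm c a,
      abs_of_nonneg (by linarith [hc.2] : 0 ≤ a - c)]
    congr 1
    ring
  have h2 : ∫ c in a..b, Real.exp (-(β / 2 * (|a - b| + |b - c| + |c - a|)))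
      = ∫ c in a..b, Real.exp (-(β * (b - a))) := by
    refine integral_congr fun c hc => ?_
    rw [Set.uIcc_of_le hab] at hc
    simp only [e]
    rw [abs_of_nonneg (by linarith [hc.2] : 0 ≤ b - c),
      abs_of_nonneg (by linarith [hc.1] : 0 ≤ c - a)]
    congr 1
    ring
  have h3 : ∫ c in b..1, Real.exp (-(β / 2 * (|a - b| + |b - c| + |c - a|)))
      = ∫ c in b..1, Real.exp (-(β * (c - a))) := by
    refine integral_congr fun c hc => ?_
    rw [Set.uIcc_of_le hb] at hc
    simp only [e]
    rw [abs_sub_comm b c, abs_of_nonneg (by linarith [hc.1] : 0 ≤ c - b),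
      abs_of_nonneg (by linarith [hc.1] : 0 ≤ c - a)]
    congr 1
    ring
  rw [h1, h2, h3, integral_comp_sub_left (fun x => Real.exp (-(β * x))) b,
    integral_comp_sub_right (fun x => Real.exp (-(β * x))) a, integral_exp_neg_mul hβ,
    integral_exp_neg_mul hβ, intervalIntegral.integral_const, smul_eq_mul, e, max_eq_right hab, min_eq_left hab,
    sub_zero]
  ring

theorem integral_exp_three_abs (hβ : β ≠ 0) {a b : ℝ} (ha : a ∈ Set.Icc (0 : ℝ) 1)
    (hb : b ∈ Set.Icc (0 : ℝ) 1) :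
    ∫ c in (0 : ℝ)..1, Real.exp (-(β / 2 * (|a - b| + |b - c| + |c - a|)))
      = (|a - b| + 2 / β) * Real.exp (-(β * |a - b|))
        - (Real.exp (-(β * max a b)) + Real.exp (-(β * (1 - min a b)))) / β := by
  rcases le_total a b with h | h
  · exact integral_exp_three_abs_of_le hβ ha.1 h hb.2
  · have := integral_exp_three_abs_of_le hβ hb.1 h ha.2
    rw [abs_sub_comm b a, max_comm, min_comm] at this
    rw [← this]
    refine integral_congr fun c _ => ?_
    congr 3
    rw [abs_sub_comm b c, abs_sub_comm c a]
    ring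

theorem integral_integral_integral_exp_three_abs (hβ : β ≠ 0) :
    ∫ a in (0 : ℝ)..1, ∫ b in (0 : ℝ)..1, ∫ c in (0 : ℝ)..1,
        Real.exp (-(β / 2 * (|a - b| + |b - c| + |c - a|)))
      = 2 * (3 / β ^ 2 + (1 / β ^ 2 + 4 / β ^ 3) * Real.exp (-β) - 4 / β ^ 3)
        - 4 * ((1 - Real.exp (-β)) / β ^ 2 - Real.exp (-β) / β) / β := by
  have hcont2 : ∀ {f : ℝ → ℝ → ℝ}, Continuous (Function.uncurry f) →
      Continuous fun a => ∫ b in (0 : ℝ)..1, f a b := fun hf =>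
    continuous_parametric_intervalIntegral_of_continuous' hf 0 1
  set f₁ : ℝ → ℝ → ℝ := fun a b => (|a - b| + 2 / β) * Real.exp (-(β * |a - b|)) with hf₁
  set f₂ : ℝ → ℝ → ℝ := fun a b => Real.exp (-(β * max a b)) with hf₂
  set f₃ : ℝ → ℝ → ℝ := fun a b => Real.exp (-(β * (1 - min a b))) with hf₃
  have c₁ : Continuous (Function.uncurry f₁) := by
    simp only [hf₁, Function.uncurry_def]; fun_prop
  have c₂ : Continuous (Function.uncurry f₂) := by
    simp only [hf₂, Function.uncurry_def]; fun_prop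
  have c₃ : Continuous (Function.uncurry f₃) := by
    simp only [hf₃, Function.uncurry_def]; fun_prop
  have h1 : ∀ a ∈ Set.uIcc (0 : ℝ) 1, (∫ b in (0 : ℝ)..1, ∫ c in (0 : ℝ)..1,
      Real.exp (-(β / 2 * (|a - b| + |b - c| + |c - a|))))
      = (∫ b in (0 : ℝ)..1, f₁ a b) - ((∫ b in (0 : ℝ)..1, f₂ a b)
        + ∫ b in (0 : ℝ)..1, f₃ a b) / β := by
    intro a ha
    rw [Set.uIcc_of_le zero_le_one] at ha
    have i : ∀ {f : ℝ → ℝ → ℝ}, Continuous (Function.uncurry f) →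
        IntervalIntegrable (f a) volume 0 1 := fun hf =>
      (hf.comp (by fun_prop : Continuous fun b : ℝ => (a, b))).intervalIntegrable _ _
    rw [← integral_add (i c₂) (i c₃), ← intervalIntegral.integral_div, ← integral_sub (i c₁)
      (((i c₂).add (i c₃)).div_const β)]
    refine integral_congr fun b hb => ?_
    rw [Set.uIcc_of_le zero_le_one] at hb
    exact integral_exp_three_abs hβ ha hb
  rw [integral_congr h1]
  have i : ∀ {f : ℝ → ℝ → ℝ}, Continuous (Function.uncurry f) →
      IntervalIntegrable (fun a => ∫ b in (0 : ℝ)..1, f a b) volume 0 1 := fun hf =>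
    (hcont2 hf).intervalIntegrable _ _
  rw [integral_sub (i c₁) (((i c₂).add (i c₃)).div_const β), intervalIntegral.integral_div,
    integral_add (i c₂) (i c₃)]
  rw [integral_integral_linear_mul_exp_abs hβ, integral_integral_exp_max hβ,
    integral_integral_exp_one_sub_min hβ]
  ring

variable {α : ℝ}

/-- The diagonal term 1/α cancels against the leading part of the integral over the square. -/
theorem sineMomentTwo_poissonKernelLine (hα : 0 < α) :
    sineMomentTwo (poissonKernelLine α) = 1 + (1 - Real.exp (-(2 * α))) / (2 * α ^ 2) := by
  have hi := integrable_poissonKernelLine hα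
  have hF : Continuous fun ξ : ℝ => Real.exp (-(α * |ξ|)) := by fun_prop
  unfold sineMomentTwo
  rw [integral_poissonKernelLine_sq hα, integral_mul_gueDensity_two hi hi hF hF
    (fourier_poissonKernelLine hα) (fourier_poissonKernelLine hα)]
  have h1 : (∫ a in (0 : ℝ)..1, ∫ b in (0 : ℝ)..1,
      Real.exp (-(α * |b - a|)) * Real.exp (-(α * |a - b|)))
      = ∫ a in (0 : ℝ)..1, ∫ b in (0 : ℝ)..1, Real.exp (-(2 * α * |a - b|)) := by
    refine integral_congr fun a _ => integral_congr fun b _ => ?_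
    rw [abs_sub_comm b a, ← Real.exp_add]
    congr 1
    ring
  rw [h1, integral_integral_exp_abs (by positivity)]
  simp
  field_simp
  ring

/-- All terms containing exp(-2α) cancel between the pair and triple contributions, which is why the
third moment is rational in α while the second is not. -/
theorem sineMomentThree_poissonKernelLine (hα : 0 < α) :
    sineMomentThree (poissonKernelLine α) = 1 + 3 / (2 * α ^ 2) := by
  have hi := integrable_poissonKernelLine hα
  have hi2 := integrable_poissonKernelLine_pow hα two_ne_zero
  have hF : Continuous fun ξ : ℝ => Real.exp (-(α * |ξ|)) := by fun_prop
  have hG : Continuous fun ξ : ℝ => (|ξ| + 1 / α) * Real.exp (-(α * |ξ|)) := by fun_prop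
  have hα2 : (2 * α) ≠ 0 := by positivity
  have m1 := integral_mul_gueDensity_two hi2 hi hG hF (fourier_poissonKernelLine_sq hα)
    (fourier_poissonKernelLine hα)
  have m2 := integral_mul_gueDensity_two hi hi2 hF hG (fourier_poissonKernelLine hα)
    (fourier_poissonKernelLine_sq hα)
  have m3 := integral_mul_gueDensity_three hi hF (fourier_poissonKernelLine hα)
    (fun ξ => by rw [abs_neg])
  have h1 : (∫ a in (0 : ℝ)..1, ∫ b in (0 : ℝ)..1,
      (|b - a| + 1 / α) * Real.exp (-(α * |b - a|)) * Real.exp (-(α * |a - b|)))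
      = ∫ a in (0 : ℝ)..1, ∫ b in (0 : ℝ)..1,
        (|a - b| + 2 / (2 * α)) * Real.exp (-(2 * α * |a - b|)) := by
    refine integral_congr fun a _ => integral_congr fun b _ => ?_
    rw [abs_sub_comm b a, mul_assoc, ← Real.exp_add, mul_div_mul_left 1 α two_ne_zero |>.symm]
    congr 2
    · ring
    · ring
  have h2 : (∫ a in (0 : ℝ)..1, ∫ b in (0 : ℝ)..1,
      Real.exp (-(α * |b - a|)) * ((|a - b| + 1 / α) * Real.exp (-(α * |a - b|))))
      = ∫ a in (0 : ℝ)..1, ∫ b in (0 : ℝ)..1,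
        (|a - b| + 2 / (2 * α)) * Real.exp (-(2 * α * |a - b|)) := by
    rw [← h1]
    refine integral_congr fun a _ => integral_congr fun b _ => ?_
    rw [abs_sub_comm b a]
    ring
  have h3 : (∫ a in (0 : ℝ)..1, ∫ b in (0 : ℝ)..1, Real.exp (-(α * |a - b|)) ^ 2)
      = ∫ a in (0 : ℝ)..1, ∫ b in (0 : ℝ)..1, Real.exp (-(2 * α * |a - b|)) := by
    refine integral_congr fun a _ => integral_congr fun b _ => ?_
    rw [pow_two, ← Real.exp_add]
    congr 1
    ring
  have h4 : (∫ a in (0 : ℝ)..1, ∫ b in (0 : ℝ)..1, ∫ c in (0 : ℝ)..1,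
      Real.exp (-(α * |a - b|)) * Real.exp (-(α * |b - c|)) * Real.exp (-(α * |c - a|)))
      = ∫ a in (0 : ℝ)..1, ∫ b in (0 : ℝ)..1, ∫ c in (0 : ℝ)..1,
        Real.exp (-(2 * α / 2 * (|a - b| + |b - c| + |c - a|))) := by
    refine integral_congr fun a _ => integral_congr fun b _ => integral_congr fun c _ => ?_
    rw [← Real.exp_add, ← Real.exp_add]
    congr 1
    ring
  rw [h1, integral_integral_linear_mul_exp_abs hα2] at m1
  rw [h2, integral_integral_linear_mul_exp_abs hα2] at m2
  rw [h3, h4, integral_integral_exp_abs hα2, integral_integral_integral_exp_three_abs hα2] at m3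
  simp only [abs_zero, mul_zero, neg_zero, Real.exp_zero, zero_add, mul_one, one_mul, one_pow]
    at m1 m2 m3
  have hW : ∀ {f g : ℝ → ℝ}, Integrable f → Integrable g →
      Integrable fun x : Fin 2 → ℝ => f (x 0) * g (x 1) * gueDensity x := fun hf hg =>
    (integrable_mul_fin_two hf hg).mul_bdd continuous_gueDensity.aestronglyMeasurable
      (Eventually.of_forall fun x => abs_gueDensity_le x)
  have m12 : ∫ x : Fin 2 → ℝ, (poissonKernelLine α (x 0) ^ 2 * poissonKernelLine α (x 1)
      + poissonKernelLine α (x 0) * poissonKernelLine α (x 1) ^ 2) * gueDensity x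
      = (∫ x : Fin 2 → ℝ, poissonKernelLine α (x 0) ^ 2 * poissonKernelLine α (x 1) * gueDensity x)
      + ∫ x : Fin 2 → ℝ, poissonKernelLine α (x 0) * poissonKernelLine α (x 1) ^ 2
        * gueDensity x := by
    rw [← MeasureTheory.integral_add (hW hi2 hi) (hW hi hi2)]
    simp_rw [add_mul]
  unfold sineMomentThree
  rw [integral_poissonKernelLine_cube hα, m12, m1, m2, m3]
  field_simp
  ring

end ExplicitMoments

/-! ### Uniformity in α by monotonicity -/

section Uniformity

open MeasureTheory

/-- Pointwise convergence of antitone functions to a continuous limit is uniform on compact sets. -/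
theorem tendstoUniformlyOn_of_antitoneOn {R : ℝ → ℝ → ℝ} {M : ℝ → ℝ}
    (hR : ∀ᶠ T in atTop, AntitoneOn (R T) (Set.Ioi 0)) (hM : ContinuousOn M (Set.Ioi 0))
    (h : ∀ α, 0 < α → Tendsto (fun T => R T α) atTop (𝓝 (M α))) {c C : ℝ} (hc : 0 < c) :
    TendstoUniformlyOn R M atTop (Set.Icc c C) := by
  suffices hloc : TendstoLocallyUniformlyOn R M atTop (Set.Ioi 0) by
    have := hloc.mono (fun x (hx : x ∈ Set.Icc c C) => lt_of_lt_of_le hc hx.1)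
    exact (tendstoLocallyUniformlyOn_iff_tendstoUniformlyOn_of_compact isCompact_Icc).1 this
  rw [Metric.tendstoLocallyUniformlyOn_iff]
  intro ε hε x hx
  have hxc : ContinuousAt M x := hM.continuousAt (Ioi_mem_nhds hx)
  obtain ⟨δ, hδ, hδM⟩ := Metric.continuousAt_iff.1 hxc (ε / 4) (by positivity)
  set η := min (δ / 2) (x / 2) with hη
  have hx' : 0 < x := hx
  have hη0 : 0 < η := by positivity
  have hηδ : η < δ := (min_le_left _ _).trans_lt (by linarith)
  have hηx : η < x := (min_le_right _ _).trans_lt (by linarith)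
  refine ⟨Set.Ioo (x - η) (x + η), mem_nhdsWithin_of_mem_nhds
    (Ioo_mem_nhds (by linarith) (by linarith)), ?_⟩
  have hl := (Metric.tendsto_nhds.1 (h (x - η) (by linarith))) (ε / 4) (by positivity)
  have hr := (Metric.tendsto_nhds.1 (h (x + η) (by linarith))) (ε / 4) (by positivity)
  filter_upwards [hR, hl, hr] with T hT h1 h2 y hy
  -- Monotonicity traps the value at y between those at x-η and x+η. So pointwise convergence at
  -- these two points controls a whole neighbourhood of x.
  have a1 : R T y ≤ R T (x - η) := hT (show 0 < x - η by linarith)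
    (show 0 < y by linarith [hy.1]) hy.1.le
  have a2 : R T (x + η) ≤ R T y := hT (show 0 < y by linarith [hy.1])
    (show 0 < x + η by linarith) hy.2.le
  have m1 := hδM (x := y) (by rw [Real.dist_eq, abs_lt]; constructor <;> linarith [hy.1, hy.2])
  have m2 := hδM (x := x - η) (by rw [Real.dist_eq, abs_lt]; constructor <;> linarith)
  have m3 := hδM (x := x + η) (by rw [Real.dist_eq, abs_lt]; constructor <;> linarith)
  rw [Real.dist_eq, abs_lt] at h1 h2 m1 m2 m3 ⊢
  constructor <;> linarith [h1.1, h1.2, h2.1, h2.2, m1.1, m1.2, m2.1, m2.2, m3.1, m3.2]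

/-- Each term of Σ_a decreases in a, while the normalisation depends on T alone. -/
theorem antitoneOn_integral_sigmaSum_pow (hRH : RiemannHypothesis) (k : ℕ) {T : ℝ} (hT : 1 < T) :
    AntitoneOn (fun α => (∫ t in (0 : ℝ)..T, sigmaSum (α / Real.log T) t ^ k)
      / (T * Real.log T ^ (2 * k))) (Set.Ioi 0) := by
  intro α hα α' hα' hle
  have hL := Real.log_pos hT
  have h1 : 0 < α / Real.log T := div_pos hα hL
  have h2 : 0 < α' / Real.log T := div_pos hα' hL
  have h3 : α / Real.log T ≤ α' / Real.log T := by gcongr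
  have h4 : 0 < T * Real.log T ^ (2 * k) := by positivity
  beta_reduce
  gcongr
  refine intervalIntegral.integral_mono_on (by linarith)
    (((continuous_sigmaSum hRH h2).pow k).intervalIntegrable _ _)
    (((continuous_sigmaSum hRH h1).pow k).intervalIntegrable _ _) fun t _ => ?_
  exact pow_le_pow_left₀ (sigmaSum_nonneg _ _) (sigmaSum_anti hRH h1 h3 t) k

/-- Convergence of the normalized moments for each `α` gives the asymptotics uniformly for
`c / log T ≤ a ≤ C / log T`. -/
theorem exists_forall_abs_integral_sigmaSum_pow_sub_le (hRH : RiemannHypothesis) {k : ℕ}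
    {E : ℝ → ℝ} (hE : ContinuousOn E (Set.Ioi 0)) (hE1 : ∀ α, 0 < α → 1 ≤ E α)
    (h : ∀ α, 0 < α → Tendsto (fun T : ℝ => (∫ t in (0 : ℝ)..T, sigmaSum (α / Real.log T) t ^ k)
      / (T * Real.log T ^ (2 * k))) atTop (𝓝 (E α / (2 * α) ^ k)))
    {c C : ℝ} (hc : 0 < c) (hcC : c ≤ C) {ε : ℝ} (hε : 0 < ε) :
    ∃ T₀ : ℝ, ∀ T a : ℝ, T₀ ≤ T → c / Real.log T ≤ a → a ≤ C / Real.log T →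
      1 < T ∧ 0 < a ∧
      |(∫ t in (0 : ℝ)..T, sigmaSum a t ^ k)
          - T * Real.log T ^ k / (2 * a) ^ k * E (a * Real.log T)|
        ≤ ε * (T * Real.log T ^ k / (2 * a) ^ k * E (a * Real.log T)) := by
  have hM : ContinuousOn (fun α => E α / (2 * α) ^ k) (Set.Ioi 0) := by
    refine hE.div (by fun_prop) fun α hα => ?_
    have : 0 < α := hα
    positivity
  have hanti : ∀ᶠ T : ℝ in atTop, AntitoneOn (fun α =>
      (∫ t in (0 : ℝ)..T, sigmaSum (α / Real.log T) t ^ k) / (T * Real.log T ^ (2 * k)))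
      (Set.Ioi 0) := by
    filter_upwards [eventually_gt_atTop 1] with T hT
    exact antitoneOn_integral_sigmaSum_pow hRH k hT
  have hunif := tendstoUniformlyOn_of_antitoneOn hanti hM h (C := C) hc
  rw [Metric.tendstoUniformlyOn_iff] at hunif
  have hC : 0 < C := hc.trans_le hcC
  -- An absolute error of this size is a relative error of at most ε, since E ≥ 1 and α ≤ C bound
  -- the limit below by (2C)^(-k).
  have hev := (hunif (ε / (2 * C) ^ k) (by positivity)).and (eventually_gt_atTop 1)
  obtain ⟨T₀, hT₀⟩ := eventually_atTop.1 hev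
  refine ⟨T₀, fun T a hT ha1 ha2 => ?_⟩
  obtain ⟨h1, h2⟩ := hT₀ T hT
  have hL := Real.log_pos h2
  have ha : 0 < a := lt_of_lt_of_le (by positivity) ha1
  refine ⟨h2, ha, ?_⟩
  rw [div_le_iff₀ hL] at ha1
  rw [le_div_iff₀ hL] at ha2
  set L := Real.log T with hLdef
  have h3 := h1 (a * L) ⟨ha1, ha2⟩
  rw [dist_comm, Real.dist_eq, mul_div_assoc, div_self hL.ne', mul_one] at h3
  set I := ∫ t in (0 : ℝ)..T, sigmaSum a t ^ k with hI
  have hT0 : 0 < T := by linarith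
  have hS : 0 < T * L ^ (2 * k) := by positivity
  have hEa := hE1 (a * L) (by positivity)
  have e1 : T * L ^ k / (2 * a) ^ k * E (a * L) = T * L ^ (2 * k) * (E (a * L) / (2 * (a * L)) ^ k) := by
    rw [show 2 * (a * L) = 2 * a * L by ring, mul_pow (2 * a) L, two_mul k, pow_add]
    field_simp
  have e2 : I - T * L ^ (2 * k) * (E (a * L) / (2 * (a * L)) ^ k)
      = T * L ^ (2 * k) * (I / (T * L ^ (2 * k)) - E (a * L) / (2 * (a * L)) ^ k) := by
    field_simp
  rw [e1, e2, abs_mul, abs_of_pos hS]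
  have h4 : ε / (2 * C) ^ k ≤ ε * (E (a * L) / (2 * (a * L)) ^ k) := by
    rw [← mul_div_assoc]
    have : ε ≤ ε * E (a * L) := by nlinarith
    gcongr
  calc T * L ^ (2 * k) * |I / (T * L ^ (2 * k)) - E (a * L) / (2 * (a * L)) ^ k|
      ≤ T * L ^ (2 * k) * (ε * (E (a * L) / (2 * (a * L)) ^ k)) := by
        gcongr
        exact h3.le.trans h4
    _ = _ := by ring

end Uniformity

/-! ### The estimates in the range a ≍ 1/log T -/

/-- The relation `a ≍ 1/log T` is `c/log T ≤ a ≤ C/log T`; every estimate is uniform in such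
`a`, with implied constants that depend on `c` and `C` only. -/
theorem proposition3 (hRH : RiemannHypothesis) (hGUE : GUEHypothesis 3)
    (c C : ℝ) (hc : 0 < c) (hcC : c ≤ C) :
    (∀ a : ℝ, 0 < a →
      (∀ t : ℝ, Summable fun j : ZetaZeroIndex => 1 / (a ^ 2 + (t - j.ordinate) ^ 2)) ∧
      ∀ (k : ℕ) (T : ℝ), IntervalIntegrable (fun t => sigmaSum a t ^ k) MeasureTheory.volume 0 T) ∧
    (∃ K : ℝ, ∀ T a : ℝ, 2 ≤ T → c / Real.log T ≤ a → a ≤ C / Real.log T →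
      ∀ t : ℝ, sigmaSum a t ≤ K * (Real.log (|t| + 2) / a ^ 2)) ∧
    (∃ K T₀ : ℝ, ∀ T a : ℝ, T₀ ≤ T → c / Real.log T ≤ a → a ≤ C / Real.log T →
      |(∫ t in (0 : ℝ)..T, sigmaSum a t)
          - 1 / (2 * a) * (T * Real.log (T / (2 * Real.pi)) - T)|
        ≤ K * (Real.log T ^ 2 * Real.log (Real.log T))) ∧
    (∀ ε : ℝ, 0 < ε → ∃ T₀ : ℝ, ∀ T a : ℝ, T₀ ≤ T →
      c / Real.log T ≤ a → a ≤ C / Real.log T →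
      |(∫ t in (0 : ℝ)..T, sigmaSum a t ^ 2)
          - 1 / (4 * a ^ 2) * T * Real.log T ^ 2
              * (1 + (1 - T ^ (-2 * a)) / (2 * a ^ 2 * Real.log T ^ 2))|
        ≤ ε * (1 / (4 * a ^ 2) * T * Real.log T ^ 2
              * (1 + (1 - T ^ (-2 * a)) / (2 * a ^ 2 * Real.log T ^ 2)))) ∧
    (∀ ε : ℝ, 0 < ε → ∃ T₀ : ℝ, ∀ T a : ℝ, T₀ ≤ T →
      c / Real.log T ≤ a → a ≤ C / Real.log T →
      |(∫ t in (0 : ℝ)..T, sigmaSum a t ^ 3)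
          - 1 / (8 * a ^ 3) * T * Real.log T ^ 3
              * (1 + 3 / (2 * a ^ 2 * Real.log T ^ 2))|
        ≤ ε * (1 / (8 * a ^ 3) * T * Real.log T ^ 3
              * (1 + 3 / (2 * a ^ 2 * Real.log T ^ 2)))) := by
  have hC : 0 < C := hc.trans_le hcC
  refine ⟨fun a ha => ⟨fun t => summable_one_div_sq_add_sq hRH ha t, fun k T =>
    ((continuous_sigmaSum hRH ha).pow k).intervalIntegrable _ _⟩, ?_, ?_, ?_, ?_⟩
  · obtain ⟨K, -, hK⟩ := exists_sigmaSum_le hRH (C / Real.log 2)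
    refine ⟨K, fun T a hT ha1 ha2 t => ?_⟩
    have hL : 0 < Real.log T := Real.log_pos (by linarith)
    refine hK a (lt_of_lt_of_le (by positivity) ha1) (ha2.trans ?_) t
    have := Real.log_pos one_lt_two
    gcongr
  · obtain ⟨K, hK0, hK⟩ := exists_abs_integral_sigmaSum_sub_le hRH
    have hev : ∀ᶠ T : ℝ in atTop, 3 ≤ T ∧ C ≤ Real.log T ∧ Real.exp 1 ≤ Real.log T :=
      (eventually_ge_atTop 3).and ((Real.tendsto_log_atTop.eventually_ge_atTop C).and
        (Real.tendsto_log_atTop.eventually_ge_atTop (Real.exp 1)))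
    obtain ⟨T₀, hT₀⟩ := eventually_atTop.1 hev
    refine ⟨K / c, T₀, fun T a hT ha1 ha2 => ?_⟩
    obtain ⟨hT3, hCL, heL⟩ := hT₀ T hT
    have hL : 0 < Real.log T := Real.log_pos (by linarith)
    have ha : 0 < a := lt_of_lt_of_le (by positivity) ha1
    have ha' : a ≤ 3 / 2 := by
      refine ha2.trans ?_
      rw [div_le_iff₀ hL]
      linarith
    refine (hK a T ha ha' hT3).trans ?_
    have hll : 1 ≤ Real.log (Real.log T) := by
      rw [Real.le_log_iff_exp_le hL]
      exact heL
    have h1 : K * Real.log T / a ≤ K * Real.log T / (c / Real.log T) := by gcongr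
    have h2 : K * Real.log T / (c / Real.log T) = K / c * (Real.log T ^ 2 * 1) := by
      field_simp
    rw [h2] at h1
    refine h1.trans ?_
    gcongr
  · intro ε hε
    have hE1 : ∀ α : ℝ, 0 < α → 1 ≤ 1 + (1 - Real.exp (-(2 * α))) / (2 * α ^ 2) := by
      intro α hα
      have : Real.exp (-(2 * α)) ≤ 1 := Real.exp_le_one_iff.2 (by linarith)
      have : 0 ≤ (1 - Real.exp (-(2 * α))) / (2 * α ^ 2) :=
        div_nonneg (by linarith) (by positivity)
      linarith
    have hcont : ContinuousOn (fun α : ℝ => 1 + (1 - Real.exp (-(2 * α))) / (2 * α ^ 2))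
        (Set.Ioi 0) := by
      refine continuousOn_const.add (ContinuousOn.div (by fun_prop) (by fun_prop) fun α hα => ?_)
      have : 0 < α := hα
      positivity
    obtain ⟨T₀, hT₀⟩ := exists_forall_abs_integral_sigmaSum_pow_sub_le hRH (k := 2) hcont hE1
      (fun α hα => by
        have := tendsto_integral_sigmaSum_sq hRH hGUE hα (by
          rw [sineMomentTwo_poissonKernelLine hα]; linarith [hE1 α hα])
        rwa [sineMomentTwo_poissonKernelLine hα] at this) hc hcC hε
    refine ⟨T₀, fun T a hT ha1 ha2 => ?_⟩
    obtain ⟨hT1, ha, h⟩ := hT₀ T a hT ha1 ha2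
    have hL := Real.log_pos hT1
    -- Substituting α = a log T turns exp(-2α) into T^(-2a).
    have e : T * Real.log T ^ 2 / (2 * a) ^ 2
        * (1 + (1 - Real.exp (-(2 * (a * Real.log T)))) / (2 * (a * Real.log T) ^ 2))
        = 1 / (4 * a ^ 2) * T * Real.log T ^ 2
              * (1 + (1 - T ^ (-2 * a)) / (2 * a ^ 2 * Real.log T ^ 2)) := by
      rw [Real.rpow_def_of_pos (by linarith), show Real.log T * (-2 * a) = -(2 * (a * Real.log T)) by
        ring]
      ring
    rwa [e] at h
  · intro ε hε
    have hE1 : ∀ α : ℝ, 0 < α → 1 ≤ 1 + 3 / (2 * α ^ 2) := by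
      intro α hα
      have : 0 ≤ 3 / (2 * α ^ 2) := by positivity
      linarith
    have hcont : ContinuousOn (fun α : ℝ => 1 + 3 / (2 * α ^ 2)) (Set.Ioi 0) := by
      refine continuousOn_const.add (ContinuousOn.div (by fun_prop) (by fun_prop) fun α hα => ?_)
      have : 0 < α := hα
      positivity
    obtain ⟨T₀, hT₀⟩ := exists_forall_abs_integral_sigmaSum_pow_sub_le hRH (k := 3) hcont hE1
      (fun α hα => by
        have := tendsto_integral_sigmaSum_cube hRH hGUE hα (by
          rw [sineMomentThree_poissonKernelLine hα]; linarith [hE1 α hα])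
        rwa [sineMomentThree_poissonKernelLine hα] at this) hc hcC hε
    refine ⟨T₀, fun T a hT ha1 ha2 => ?_⟩
    obtain ⟨hT1, ha, h⟩ := hT₀ T a hT ha1 ha2
    have hL := Real.log_pos hT1
    have e : T * Real.log T ^ 3 / (2 * a) ^ 3 * (1 + 3 / (2 * (a * Real.log T) ^ 2))
        = 1 / (8 * a ^ 3) * T * Real.log T ^ 3
              * (1 + 3 / (2 * a ^ 2 * Real.log T ^ 2)) := by
      ring
    rwa [e] at h
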